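/- Let $M$ be a closed (compact, boundaryless, Hausdorff) smooth manifold and let $\mathcal X^1(M)$ be the space of $C^1$ vector fields on $M$ with the $C^1$ topology. For $X\in\mathcal X^1(M)$ let $\phi^t$ be its flow, $\mathrm{Sing}(X)=\{x: X(x)=0\}$, let $\mathbb PM$ be the projective tangent bundle (its points are the pairs $(x,L)$ with $x\in M$ and $L$ a line in $T_xM$), and let $\phi_{\mathbb P}^t(x,L)=(\phi^t(x),D\phi^t(x)L)$ be the flow induced on $\mathbb PM$. A point $\sigma\in\mathrm{Sing}(X)$ is hyperbolic if no eigenvalue of $DX(\sigma)$ has real part $0$. Let $U\subset M$ be compact. The maximal invariant set of $X$ in $U$ is $\Lambda_{X,U}=\bigcap_{t\in\mathbb R}\phi^t(U)$, and the lifted maximal invariant set is $$\Lambda_{\mathbb P,U}(X)=\overline{\{\langle X(x)\rangle : x\in\Lambda_{X,U}\setminus\mathrm{Sing}(X)\}}\subset\mathbb PM .$$ For $\sigma\in\mathrm{Sing}(X)\cap U$ hyperbolic, let the Lyapunov exponents of $\sigma$ be the real parts of the eigenvalues of $DX(\sigma)$, and for an exponent $\lambda$ let $E_\lambda\subset T_\sigma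 M$ be the sum of the generalized eigenspaces of the eigenvalues with real part $\lambda$. For an exponent $\lambda<0$, the strong stable space $E^{ss}_\lambda=\bigoplus_{\mu\le\lambda}E_\mu$ has the strong stable manifold $W^{ss}_\lambda(\sigma)$, the set of the points whose positive orbit converges to $\sigma$ with exponential rate at most $\lambda$ (that is, $d(\phi^t(x),\sigma)=O(e^{ct})$ as $t\to+\infty$ for every $c>\lambda$); it is escaping if $\Lambda_{X,U}\cap W^{ss}_\lambda(\sigma)=\{\sigma\}$. The escaping stable space $E^{ss}_{\sigma,U}$ is the biggest strong stable space whose strong stable manifold is escaping ($\{0\}$ if there is none). The escaping unstable space $E^{uu}_{\sigma,U}$ is defined analogously for the exponents $\lambda>0$, with time reversed. The central space $E^c_{\sigma,U}$ is the sum of the remaining spaces $E_\lambda$, so that $T_\sigma M=E^{ss}_{\sigma,U}\oplus E^c_{\sigma,U}\oplus E^{uu}_{\sigma,U}$, and $\mathbb P^c_{\sigma,U}\subset\mathbb PM$ is the set of the lines contained in it. The extended maximal invariant set of $X$ in $U$ is $$B(X,U)=\Lambda_{\mathbb P,U}(X)\cup\bigcup_{\sigma\in\mathrm{Sing}(X)\cap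 U}\mathbb P^c_{\sigma,U}.$$ Let $U\subset M$ be compact and let $X$ be a $C^1$ vector field all of whose singular points are hyperbolic. Then: 1. $B(X,U)$ is a compact subset of $\mathbb PM$; 2. $B(X,U)$ is invariant under $\phi_{\mathbb P}^t$: for every $t\in\mathbb R$ the map $\phi^t$ is differentiable with invertible derivative at every point (so that $\phi_{\mathbb P}^t$ is defined), and $\phi_{\mathbb P}^t(B(X,U))=B(X,U)$; 3. $Y\mapsto B(Y,U)$ is upper semicontinuous at $X$ for the $C^1$ topology: for every open set $W\subset\mathbb PM$ with $B(X,U)\subset W$ there is a $C^1$ neighbourhood $\mathcal U$ of $X$ such that $B(Y,U)\subset W$ for every $Y\in\mathcal U$. -/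

import Mathlib

open scoped Manifold ContDiff Topology UniformConvergence LinearAlgebra.Projectivization
open Set Filter Asymptotics

noncomputable section

namespace ExtendedMaximal

/-- `C¹` vector fields on `M`, as `C¹` sections of the tangent bundle. -/
abbrev VField (E M : Type*) [NormedAddCommGroup E] [NormedSpace ℝ E] [TopologicalSpace M]
    [ChartedSpace E M] [IsManifold 𝓘(ℝ, E) ∞ M] :=
  ContMDiffSection 𝓘(ℝ, E) E 1 (TangentSpace 𝓘(ℝ, E) : M → Type _)

variable {E M : Type*} [NormedAddCommGroup E] [NormedSpace ℝ E] [FiniteDimensional ℝ E]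
  [TopologicalSpace M] [ChartedSpace E M] [IsManifold 𝓘(ℝ, E) ∞ M]

/-- Integral curves through nearby points exist on a common time interval. -/
theorem exists_local_integralCurve (X : VField E M) (x₀ : M) :
    ∃ ε > (0 : ℝ), ∀ᶠ x in 𝓝 x₀, ∃ γ : ℝ → M, γ 0 = x ∧
      IsMIntegralCurveOn (I := 𝓘(ℝ, E)) γ (fun y => X y) (Ioo (-ε) ε) := by
  have : CompleteSpace E := FiniteDimensional.complete ℝ E
  have hv := X.contMDiff x₀
  rw [contMDiffAt_iff] at hv
  obtain ⟨_, hv⟩ := hv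
  obtain ⟨δ, hδ, a, r, L, K, hr, hpl⟩ := IsPicardLindelof.of_contDiffAt_one (hv.contDiffAt
    (range_mem_nhds_isInteriorPoint (BoundarylessManifold.isInteriorPoint))).snd
  obtain ⟨α, hα, hc⟩ := (hpl 0).exists_forall_mem_closedBall_eq_hasDerivWithinAt_continuousOn
  set z₀ := extChartAt 𝓘(ℝ, E) x₀ x₀ with hz₀
  have hopen : IsOpen (extChartAt 𝓘(ℝ, E) x₀).target := isOpen_extChartAt_target x₀
  have hnh : Metric.closedBall z₀ (r : ℝ) ×ˢ Icc (0 - δ) (0 + δ) ∈ 𝓝 (z₀, (0 : ℝ)) :=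
    prod_mem_nhds (Metric.closedBall_mem_nhds _ hr) (Icc_mem_nhds (by linarith) (by linarith))
  have hcα : ContinuousAt α (z₀, 0) := hc.continuousAt hnh
  have hα0 : α (z₀, 0) = z₀ := (hα z₀ (Metric.mem_closedBall_self hr.le)).1
  have hmem : α ⁻¹' (extChartAt 𝓘(ℝ, E) x₀).target ∈ 𝓝 (z₀, (0 : ℝ)) :=
    hcα (by rw [hα0]; exact hopen.mem_nhds (mem_extChartAt_target x₀))
  obtain ⟨u, hu, w, hw, huw⟩ := mem_nhds_prod_iff.1 (inter_mem hnh hmem)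
  obtain ⟨ε, hε, hεw⟩ := Metric.mem_nhds_iff.1 hw
  refine ⟨ε, hε, ?_⟩
  have hcont : ContinuousAt (extChartAt 𝓘(ℝ, E) x₀) x₀ := continuousAt_extChartAt x₀
  filter_upwards [hcont hu, extChartAt_source_mem_nhds (I := 𝓘(ℝ, E)) x₀] with x hxu hxs
  have hball : ∀ t ∈ Ioo (-ε) ε, t ∈ w := fun t ht => hεw (by
    rw [Real.ball_eq_Ioo]; simpa using ht)
  have key : ∀ t ∈ Ioo (-ε) ε, (extChartAt 𝓘(ℝ, E) x₀ x, t) ∈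
      (Metric.closedBall z₀ (r : ℝ) ×ˢ Icc (0 - δ) (0 + δ)) ∩
        α ⁻¹' (extChartAt 𝓘(ℝ, E) x₀).target := fun t ht => huw ⟨hxu, hball t ht⟩
  set f : ℝ → E := fun t => α (extChartAt 𝓘(ℝ, E) x₀ x, t) with hf
  have hxb := (key 0 ⟨by linarith, hε⟩).1.1
  refine ⟨fun t => (extChartAt 𝓘(ℝ, E) x₀).symm (f t), ?_, ?_⟩
  · simp only [hf]
    rw [(hα _ hxb).1, PartialEquiv.left_inv _ hxs]
  intro t ht
  let xt : M := (extChartAt 𝓘(ℝ, E) x₀).symm (f t)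
  have hIcc : Icc (0 - δ) (0 + δ) ∈ 𝓝 t := by
    filter_upwards [Ioo_mem_nhds ht.1 ht.2] with s hs using (key s hs).1.2
  have h : HasDerivAt f (tangentCoordChange 𝓘(ℝ, E) xt x₀ xt (X xt)) t :=
    ((hα _ hxb).2 t (key t ht).1.2).hasDerivAt hIcc
  have hf3 : f t ∈ (extChartAt 𝓘(ℝ, E) x₀).target := (key t ht).2
  have hft1 : xt ∈ (extChartAt 𝓘(ℝ, E) x₀).source := (extChartAt 𝓘(ℝ, E) x₀).map_target hf3
  have hft2 := mem_extChartAt_source (I := 𝓘(ℝ, E)) xt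
  apply HasMFDerivAt.hasMFDerivWithinAt
  refine ⟨ContinuousAt.comp (continuousAt_extChartAt_symm'' hf3) h.continuousAt, ?_⟩
  have hw : ∀ v : E, HasDerivAt f (tangentCoordChange 𝓘(ℝ, E) xt x₀ xt v) t →
      HasDerivAt ((extChartAt 𝓘(ℝ, E) xt ∘ (extChartAt 𝓘(ℝ, E) x₀).symm) ∘ f) v t := by
    intro v hv
    rw [← tangentCoordChange_self (I := 𝓘(ℝ, E)) (x := xt) (z := xt) (v := v) hft2,
      ← tangentCoordChange_comp (x := x₀) ⟨⟨hft2, hft1⟩, hft2⟩]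
    apply HasFDerivAt.comp_hasDerivAt _ _ hv
    have := hasFDerivWithinAt_tangentCoordChange (I := 𝓘(ℝ, E)) ⟨hft1, hft2⟩
    rw [(extChartAt 𝓘(ℝ, E) x₀).right_inv hf3] at this
    simpa using this
  exact (hw _ h).hasFDerivAt.hasFDerivWithinAt

/-- On a closed manifold every `C¹` vector field is complete. -/
theorem exists_integralCurve [CompactSpace M] [T2Space M] (X : VField E M) (x : M) :
    ∃ γ : ℝ → M, γ 0 = x ∧ IsMIntegralCurve (I := 𝓘(ℝ, E)) γ (fun y => X y) := by
  have hunif : ∃ ε > (0 : ℝ), ∀ x ∈ (univ : Set M), ∃ γ : ℝ → M, γ 0 = x ∧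
      IsMIntegralCurveOn (I := 𝓘(ℝ, E)) γ (fun y => X y) (Ioo (-ε) ε) := by
    refine isCompact_univ.induction_on (p := fun s : Set M => ∃ ε > (0 : ℝ), ∀ x ∈ s,
      ∃ γ : ℝ → M, γ 0 = x ∧ IsMIntegralCurveOn (I := 𝓘(ℝ, E)) γ (fun y => X y) (Ioo (-ε) ε))
      ⟨1, one_pos, by simp⟩ ?_ ?_ ?_
    · rintro s t hst ⟨ε, hε, h⟩
      exact ⟨ε, hε, fun x hx => h x (hst hx)⟩
    · rintro s t ⟨ε, hε, h⟩ ⟨δ, hδ, k⟩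
      refine ⟨min ε δ, lt_min hε hδ, fun x hx => ?_⟩
      rcases hx with hx | hx
      · obtain ⟨γ, h0, hγ⟩ := h x hx
        exact ⟨γ, h0, hγ.mono (Ioo_subset_Ioo (neg_le_neg (min_le_left _ _)) (min_le_left _ _))⟩
      · obtain ⟨γ, h0, hγ⟩ := k x hx
        exact ⟨γ, h0, hγ.mono (Ioo_subset_Ioo (neg_le_neg (min_le_right _ _)) (min_le_right _ _))⟩
    · intro x _
      obtain ⟨ε, hε, h⟩ := exists_local_integralCurve X x
      exact ⟨_, mem_nhdsWithin_of_mem_nhds h, ε, hε, fun y hy => hy⟩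
  obtain ⟨ε, hε, h⟩ := hunif
  have : CompleteSpace E := FiniteDimensional.complete ℝ E
  exact exists_isMIntegralCurve_of_isMIntegralCurveOn X.contMDiff hε (fun x => h x (mem_univ x)) x

section Flow

variable [CompactSpace M] [T2Space M]

/-- The flow `φ^t(x)` of `X`. -/
def flow (X : VField E M) (t : ℝ) (x : M) : M :=
  Classical.choose (exists_integralCurve X x) t

theorem flow_zero (X : VField E M) (x : M) : flow X 0 x = x :=
  (Classical.choose_spec (exists_integralCurve X x)).1

theorem isMIntegralCurve_flow (X : VField E M) (x : M) :
    IsMIntegralCurve (I := 𝓘(ℝ, E)) (fun t => flow X t x) (fun y => X y) :=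
  (Classical.choose_spec (exists_integralCurve X x)).2

/-- The maximal invariant set `Λ_{X,U} = ⋂_t φ^t(U)`. -/
def maximalInvariantSet (X : VField E M) (U : Set M) : Set M :=
  ⋂ t : ℝ, flow X t '' U

end Flow

/-- The set of singular points of `X`. -/
def sing (X : VField E M) : Set M := {x | X x = 0}

/-! ### The projective tangent bundle -/

variable (E M) in
/-- The projective tangent bundle: pairs of a point `x` and a line in `T_x M`. -/
structure ProjTangentBundle where
  /-- the base point -/
  base : M
  /-- the line in the tangent space at the base point -/
  line : ℙ ℝ (TangentSpace 𝓘(ℝ, E) base)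

/-- The projection from nonzero tangent vectors to the lines that they span. -/
def spanLine (v : {v : TangentBundle 𝓘(ℝ, E) M // v.2 ≠ 0}) : ProjTangentBundle E M :=
  ⟨v.1.1, Projectivization.mk ℝ v.1.2 v.2⟩

/-- The quotient topology from the bundle of nonzero tangent vectors. -/
instance : TopologicalSpace (ProjTangentBundle E M) :=
  TopologicalSpace.coinduced spanLine inferInstance

/-- The action `φ_ℙ^t(x, L) = (φ^t(x), Dφ^t(L))` of the flow on the projective tangent bundle.
(The derivative `Dφ^t(x)` is always invertible, so that the second branch is never used.) -/
def projFlow [CompactSpace M] [T2Space M] (X : VField E M) (t : ℝ) (p : ProjTangentBundle E M) :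
    ProjTangentBundle E M :=
  open scoped Classical in
  if h : Function.Injective (mfderiv 𝓘(ℝ, E) 𝓘(ℝ, E) (flow X t) p.base) then
    ⟨flow X t p.base, Projectivization.map
      (mfderiv 𝓘(ℝ, E) 𝓘(ℝ, E) (flow X t) p.base).toLinearMap h p.line⟩
  else p

/-- The lifted maximal invariant set: the closure in `ℙM` of the set of the lines `⟨X(x)⟩`,
`x ∈ Λ_{X,U}` regular. -/
def liftedMaximalInvariantSet [CompactSpace M] [T2Space M] (X : VField E M) (U : Set M) :
    Set (ProjTangentBundle E M) :=
  closure {p | ∃ (x : M) (hx : X x ≠ 0), x ∈ maximalInvariantSet X U ∧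
    p = ⟨x, Projectivization.mk ℝ (X x) hx⟩}

/-! ### The vector field in charts, and the `C¹` topology -/

/-- The expression of `X` in the chart at `x₀`, as a map defined on the target of this chart. -/
def localRep (X : VField E M) (x₀ : M) (z : E) : E :=
  (trivializationAt E (TangentSpace 𝓘(ℝ, E)) x₀
    ⟨(extChartAt 𝓘(ℝ, E) x₀).symm z, X ((extChartAt 𝓘(ℝ, E) x₀).symm z)⟩).2

/-- The compact subsets of the target of the chart at `x₀`. -/
def chartCompacts (E : Type*) {M : Type*} [NormedAddCommGroup E] [NormedSpace ℝ E]
    [TopologicalSpace M] [ChartedSpace E M] (x₀ : M) : Set (Set E) :=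
  {K | IsCompact K ∧ K ⊆ (extChartAt 𝓘(ℝ, E) x₀).target}

/-- The `C¹` topology: uniform convergence of the chart expressions and of their first derivatives
on the compact subsets of the charts. -/
instance : TopologicalSpace (VField E M) :=
  ⨅ x₀ : M, TopologicalSpace.induced
    (fun X : VField E M =>
      ((UniformOnFun.ofFun (chartCompacts E x₀) (localRep X x₀) : E →ᵤ[chartCompacts E x₀] E),
       (UniformOnFun.ofFun (chartCompacts E x₀) (fderiv ℝ (localRep X x₀)) :
          E →ᵤ[chartCompacts E x₀] (E →L[ℝ] E))))
    inferInstance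

/-! ### Linear algebra at a singular point -/

section Linear

variable {V : Type*} [AddCommGroup V] [Module ℝ V]

/-- The sum of the generalized eigenspaces of `A` for the (complex) eigenvalues of real part `r`:
the eigenvalues `r ± i b` of `A` are the solutions `z` of `(z - r)² = -b²`. -/
def exponentSpace (A : Module.End ℝ V) (r : ℝ) : Submodule ℝ V :=
  ⨆ b : ℝ, Module.End.maxGenEigenspace ((A - algebraMap ℝ (Module.End ℝ V) r) ^ 2) (-b ^ 2)

/-- The real parts of the complex eigenvalues of `A`, that is, the Lyapunov exponents of the
linear flow `exp(tA)`. -/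
def exponents [Module.Finite ℝ V] (A : Module.End ℝ V) : Set ℝ :=
  {r | ∃ z : ℂ, (A.charpoly.map (algebraMap ℝ ℂ)).IsRoot z ∧ z.re = r}

end Linear

/-- The linear part `DX(σ) : T_σ M → T_σ M` of `X` at a singular point `σ`, computed in the chart
at `σ` (which is the chart that identifies `T_σ M` with `E`). -/
def linearPart (X : VField E M) (σ : M) : Module.End ℝ (TangentSpace 𝓘(ℝ, E) σ) :=
  (fderiv ℝ (localRep X σ) (extChartAt 𝓘(ℝ, E) σ σ)).toLinearMap

instance (σ : M) : Module.Finite ℝ (TangentSpace 𝓘(ℝ, E) σ) :=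
  inferInstanceAs (FiniteDimensional ℝ E)

/-- A singular point is hyperbolic if no eigenvalue of `DX(σ)` lies on the imaginary axis. -/
def IsHyperbolicSing (X : VField E M) (σ : M) : Prop :=
  σ ∈ sing X ∧ 0 ∉ exponents (linearPart X σ)

/-! ### Escaping spaces and the central space -/

section Center

variable [CompactSpace M] [T2Space M]

/-- The strong stable manifold of `σ` for the exponent `r < 0`: the points whose positive orbit
tends to `σ` with exponential rate at most `r`. It is tangent at `σ` to the sum of the spaces of the
exponents `≤ r`. -/
def strongStableManifold (X : VField E M) (σ : M) (r : ℝ) : Set M :=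
  {x | Tendsto (fun t => flow X t x) atTop (𝓝 σ) ∧ ∀ c > r,
    (fun t => extChartAt 𝓘(ℝ, E) σ (flow X t x) - extChartAt 𝓘(ℝ, E) σ σ)
      =O[atTop] fun t => Real.exp (c * t)}

/-- The strong unstable manifold of `σ` for the exponent `r > 0`: the points whose negative orbit
tends to `σ` with exponential rate at least `r`. -/
def strongUnstableManifold (X : VField E M) (σ : M) (r : ℝ) : Set M :=
  {x | Tendsto (fun t => flow X t x) atBot (𝓝 σ) ∧ ∀ c < r,
    (fun t => extChartAt 𝓘(ℝ, E) σ (flow X t x) - extChartAt 𝓘(ℝ, E) σ σ)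
      =O[atBot] fun t => Real.exp (c * t)}

/-- The escaping stable space: the biggest strong stable space whose strong stable manifold meets
`Λ_{X,U}` only at `σ` (the strong stable spaces are nested, so that their supremum is the biggest of
them; it is trivial if none of them is escaping). -/
def escapingStableSpace (X : VField E M) (U : Set M) (σ : M) :
    Submodule ℝ (TangentSpace 𝓘(ℝ, E) σ) :=
  ⨆ r ∈ {r : ℝ | r ∈ exponents (linearPart X σ) ∧ r < 0 ∧
      maximalInvariantSet X U ∩ strongStableManifold X σ r = {σ}},
    ⨆ s ≤ r, exponentSpace (linearPart X σ) s

/-- The escaping unstable space. -/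
def escapingUnstableSpace (X : VField E M) (U : Set M) (σ : M) :
    Submodule ℝ (TangentSpace 𝓘(ℝ, E) σ) :=
  ⨆ r ∈ {r : ℝ | r ∈ exponents (linearPart X σ) ∧ 0 < r ∧
      maximalInvariantSet X U ∩ strongUnstableManifold X σ r = {σ}},
    ⨆ s ≥ r, exponentSpace (linearPart X σ) s

/-- The central space: the sum of the spaces of those exponents that occur neither in the escaping
stable space nor in the escaping unstable space. It is the center space that is complementary to
the sum of these two. -/
def centralSpace (X : VField E M) (U : Set M) (σ : M) : Submodule ℝ (TangentSpace 𝓘(ℝ, E) σ) :=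
  ⨆ r ∈ {r : ℝ | r ∈ exponents (linearPart X σ) ∧
      ¬ exponentSpace (linearPart X σ) r ≤ escapingStableSpace X U σ ∧
      ¬ exponentSpace (linearPart X σ) r ≤ escapingUnstableSpace X U σ},
    exponentSpace (linearPart X σ) r

/-- The projective space of the central space of `σ`, inside `ℙM`. -/
def projCentralSpace (X : VField E M) (U : Set M) (σ : M) : Set (ProjTangentBundle E M) :=
  {p | ∃ L : ℙ ℝ (TangentSpace 𝓘(ℝ, E) σ), L.submodule ≤ centralSpace X U σ ∧ p = ⟨σ, L⟩}

/-- The extended maximal invariant set `B(X,U)`. -/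
def extendedMaximalInvariantSet (X : VField E M) (U : Set M) : Set (ProjTangentBundle E M) :=
  liftedMaximalInvariantSet X U ∪ ⋃ σ ∈ sing X ∩ U, projCentralSpace X U σ

end Center

end ExtendedMaximal

end

open ExtendedMaximal

/-! Everything follows from one separation statement. Call extended directions the lines `⟨X(x)⟩`
over regular points of `Λ_{X,U}` together with the central lines, with no closure taken. A line `p`
that is not an extended direction of `X` has an open neighbourhood in `ℙM` disjoint from `B(Y,U)`
for every `Y` close to `X` (`exists_avoiding_nhds`). With `Y = X` this shows that `B(X,U)` is
exactly the set of extended directions and is closed in the compact space `ℙM`; covering the compact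
complement of `W` by finitely many such neighbourhoods gives upper semicontinuity. Invariance is
then checked on extended directions: the flow carries `X` to itself, and at a singular point it is
`exp(t DX(σ))`, which preserves sums of generalized eigenspaces.

The separation is made by a quadratic form, negative on `p` and positive on all nearby extended
directions of nearby fields. Over a point outside `Λ_{X,U}`, or over a regular point, continuity of
the flow and of the field suffices. The substance is the case of a hyperbolic singular point `σ` and
a vector `u` outside the central space. Then `u` is outside `E^c ⊕ E^uu` or outside `E^ss ⊕ E^c`,
and replacing `X` by `-X` reduces to the first case. Let `r` be the largest escaping exponent and
`g₀ < g₁ < 0` two rates in the spectral gap just above `r`. There is a symmetric form `B` with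
`B(u,u) < 0` such that `exp(-2gt) B(v,v)` increases along the linear flow for `g = g₀, g₁`
(`exists_lyapunov_neg`). This is an open condition on the linear map, so it persists for `DY(z)`
with `z` near `σ` and `Y` near `X`; and along an orbit `Y` itself solves the variational equation.

The key lemma is `eventually_form_pos`: `B(Y,Y) > 0` at regular points of `Λ_{Y,U}` near `σ`. If `B
≤ 0` at such a point, then `B ≤ 0` along its backward orbit while it stays near `σ`, and the orbit
must come from a fixed sphere around `σ`, after a long stay. By compactness (`exists_escape_time`),
long stays with `B ≤ 0` are impossible: an orbit of `X` in `Λ_{X,U}` that starts on the sphere and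
stays near `σ` with `B ≤ 0` forever lies in the escaping strong stable manifold
(`mem_strongStableManifold_of_nonpos`).

Central spaces at singular points of `Y` near `σ` follow: positivity of `B` forces growth at rate
`g₁`, so the strong stable manifolds of exponents below `g₁` escape for `Y`
(`escaping_of_form_pos`), the central exponents are at least `g₁`, and `B` is positive on the sum of
their spaces. Neither continuation of `σ` nor hyperbolicity of the singular points of `Y` is used.
-/

noncomputable section

namespace ExtendedMaximal


/-! ### Spectral decomposition of a real endomorphism -/

section Algebra

open Polynomial

/-- The real quadratic polynomial whose complex roots have real part `i.1` and imaginary part of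
square `i.2`. -/
def realQuadratic (i : ℝ × ℝ) : ℝ[X] := (X - C i.1) ^ 2 + C i.2

theorem aeval_realQuadratic {R : Type*} [Ring R] [Algebra ℝ R] (i : ℝ × ℝ) (a : R) :
    aeval a (realQuadratic i) = (a - algebraMap ℝ R i.1) ^ 2 + algebraMap ℝ R i.2 := by
  simp [realQuadratic]

/-- Over `ℂ` a root `z` determines the pair as `(Re z, (Im z)²)`, so distinct pairs share no root.
Nonnegativity matters: with a negative second entry the roots are real and can coincide for
different pairs. -/
theorem isCoprime_realQuadratic {i j : ℝ × ℝ} (hi : 0 ≤ i.2) (hj : 0 ≤ j.2) (hij : i ≠ j) :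
    IsCoprime (realQuadratic i) (realQuadratic j) := by
  refine (isCoprime_iff_aeval_ne_zero_of_isAlgClosed (k := ℝ) ℂ _ _).2 ?_
  have key : ∀ (k : ℝ × ℝ), 0 ≤ k.2 → ∀ z : ℂ, aeval z (realQuadratic k) = 0 →
      z.re = k.1 ∧ z.im ^ 2 = k.2 := by
    intro k hk z hz
    rw [aeval_realQuadratic] at hz
    have h1 := congrArg Complex.re hz
    have h2 := congrArg Complex.im hz
    simp [pow_two] at h1 h2
    have h3 : (z.re - k.1) * z.im = 0 := by linarith
    rcases mul_eq_zero.1 h3 with h | h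
    · refine ⟨by linarith, ?_⟩
      rw [h] at h1
      nlinarith
    · rw [h] at h1
      have h4 : (z.re - k.1) ^ 2 = 0 := by nlinarith [sq_nonneg (z.re - k.1)]
      have h5 : z.re - k.1 = 0 := by simpa using h4
      rw [h5] at h1
      refine ⟨by linarith, ?_⟩
      rw [h]
      linarith
  intro z
  by_contra! h
  obtain ⟨a, b⟩ := key i hi z h.1
  obtain ⟨c, d⟩ := key j hj z h.2
  exact hij (Prod.ext (by rw [← a, ← c]) (by rw [← b, ← d]))

/-- Cayley–Hamilton and Bézout in `ℝ[X]`. Indexing by `(Re z, (Im z)²)` merges conjugate roots, so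
no complexification of `V` is needed. The maps `p i` come from a Bézout identity evaluated at `A`;
only their sum, their commutation with `A` and their annihilators are used, not that they are
projections. -/
theorem exists_spectral_decomposition {V : Type*} [AddCommGroup V] [Module ℝ V]
    [Module.Finite ℝ V] (A : Module.End ℝ V) :
    ∃ (s : Finset (ℝ × ℝ)) (n : ℝ × ℝ → ℕ) (p : ℝ × ℝ → Module.End ℝ V),
      (∀ i ∈ s, i.1 ∈ exponents A) ∧ (∀ i ∈ s, 0 ≤ i.2) ∧ (∀ i, Commute A (p i)) ∧
      (∑ i ∈ s, p i = 1) ∧ ∀ i ∈ s,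
        ((A - algebraMap ℝ (Module.End ℝ V) i.1) ^ 2 + algebraMap ℝ (Module.End ℝ V) i.2) ^ n i
          * p i = 0 := by
  classical
  set χ := A.charpoly.map (algebraMap ℝ ℂ) with hχ
  have hχm : χ.Monic := A.charpoly_monic.map _
  set f : ℂ → ℝ × ℝ := fun z => (z.re, z.im ^ 2) with hf
  set s := (χ.roots.map f).toFinset with hs
  set n : ℝ × ℝ → ℕ := fun i => (χ.roots.map f).count i with hn
  set P : ℝ[X] := ∏ i ∈ s, realQuadratic i ^ n i with hP
  have hnn : ∀ i ∈ s, 0 ≤ i.2 := by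
    intro i hi
    simp only [hs, Multiset.mem_toFinset, Multiset.mem_map] at hi
    obtain ⟨z, -, rfl⟩ := hi
    exact sq_nonneg _
  have hdvd : A.charpoly ∣ P := by
    rw [← map_dvd_map' (algebraMap ℝ ℂ)]
    have h1 : χ = (χ.roots.map fun z => X - C z).prod :=
      (IsAlgClosed.splits χ).eq_prod_roots_of_monic hχm
    have h2 : P = (χ.roots.map fun z => realQuadratic (f z)).prod := by
      rw [hP, ← Finset.prod_multiset_map_count, Multiset.map_map]
      rfl
    rw [← hχ, h2, Polynomial.map_multiset_prod, Multiset.map_map]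
    conv_lhs => rw [h1]
    -- Each root contributes a whole quadratic, so `P` has twice the degree of the characteristic
    -- polynomial; divisibility is all that is needed.
    apply Multiset.prod_dvd_prod_of_dvd
    intro z _
    rw [dvd_iff_isRoot, IsRoot.def]
    simp only [Function.comp, eval_map_algebraMap, aeval_realQuadratic, hf]
    apply Complex.ext <;> simp [pow_two]
  have hP0 : aeval A P = 0 := by
    obtain ⟨q, hq⟩ := hdvd
    rw [hq, map_mul, LinearMap.aeval_self_charpoly, zero_mul]
  have hexp : ∀ i ∈ s, i.1 ∈ exponents A := by
    intro i hi
    simp only [hs, Multiset.mem_toFinset, Multiset.mem_map] at hi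
    obtain ⟨z, hz, rfl⟩ := hi
    exact ⟨z, (mem_roots hχm.ne_zero).1 hz, rfl⟩
  -- Bézout needs a nonempty family. Without roots `P = 1` annihilates `V`, so `1 = 0` and the zero
  -- maps do.
  rcases s.eq_empty_or_nonempty with he | hne
  · refine ⟨s, n, fun _ => 0, hexp, hnn, fun i => Commute.zero_right _, ?_, by simp⟩
    rw [he] at hP ⊢
    rw [hP] at hP0
    simpa using hP0.symm
  · obtain ⟨μ, hμ⟩ := (exists_sum_eq_one_iff_pairwise_coprime hne
      (s := fun i => realQuadratic i ^ n i)).2 (by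
        intro i j hij
        exact (isCoprime_realQuadratic (hnn i i.2) (hnn j j.2)
          (fun h => hij (Subtype.ext h))).pow)
    refine ⟨s, n, fun i => aeval A (μ i * ∏ j ∈ s \ {i}, realQuadratic j ^ n j), hexp, hnn,
      fun i => ?_, ?_, fun i hi => ?_⟩
    · conv_lhs => rw [← aeval_X (R := ℝ) A]
      exact (Commute.all X _).map (aeval A)
    · rw [← map_sum, hμ, map_one]
    · rw [← aeval_realQuadratic, ← map_pow, ← map_mul]
      have : realQuadratic i ^ n i * (μ i * ∏ j ∈ s \ {i}, realQuadratic j ^ n j) = μ i * P := by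
        rw [hP, Finset.prod_eq_mul_prod_sdiff_singleton i _ (fun h => absurd hi h)]
        ring
      rw [this, map_mul, hP0, mul_zero]

end Algebra


/-! ### Bilinear forms adapted to a linear map -/

section Forms

variable {E : Type*} [NormedAddCommGroup E] [NormedSpace ℝ E] [FiniteDimensional ℝ E]

/-- The symmetric bilinear form `(v, w) ↦ ⟨L v, L w⟩`, for an auxiliary inner product. -/
def gramForm (L : E →L[ℝ] E) : E →L[ℝ] E →L[ℝ] ℝ :=
  (innerSL ℝ (E := EuclideanSpace ℝ (Fin (Module.finrank ℝ E)))).bilinearComp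
    ((toEuclidean (E := E) : E →L[ℝ] _).comp L) ((toEuclidean (E := E) : E →L[ℝ] _).comp L)

theorem gramForm_apply (L : E →L[ℝ] E) (v w : E) :
    gramForm L v w = inner ℝ (toEuclidean (L v)) (toEuclidean (L w)) := rfl

theorem gramForm_symm (L : E →L[ℝ] E) (v w : E) : gramForm L v w = gramForm L w v := by
  rw [gramForm_apply, gramForm_apply, real_inner_comm]

theorem gramForm_self (L : E →L[ℝ] E) (v : E) : gramForm L v v = ‖toEuclidean (L v)‖ ^ 2 := by
  rw [gramForm_apply, real_inner_self_eq_norm_sq]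

theorem gramForm_self_nonneg (L : E →L[ℝ] E) (v : E) : 0 ≤ gramForm L v v := by
  rw [gramForm_self]; positivity

theorem exists_le_gramForm_id :
    ∃ m > (0 : ℝ), ∀ v : E, m * ‖v‖ ^ 2 ≤ gramForm (ContinuousLinearMap.id ℝ E) v v := by
  set K := ‖(toEuclidean (E := E)).symm.toContinuousLinearMap‖ with hK
  refine ⟨((K + 1) ^ 2)⁻¹, by positivity, fun v => ?_⟩
  rw [gramForm_self, inv_mul_le_iff₀ (by positivity), ← mul_pow]
  have h := (toEuclidean (E := E)).symm.toContinuousLinearMap.le_opNorm (toEuclidean v)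
  have h' : ‖v‖ ≤ (K + 1) * ‖toEuclidean v‖ := by
    simp only [ContinuousLinearEquiv.coe_coe, ContinuousLinearEquiv.symm_apply_apply] at h
    nlinarith [norm_nonneg (toEuclidean v)]
  exact pow_le_pow_left₀ (norm_nonneg v) h' 2

/-- An almost isometric inner product on a generalized eigenspace: if `J` is the linear map
`A - r`, then `B` changes slowly along the flow of `A`, up to the factor `exp(2 r t)`. -/
theorem exists_block_form (J : E →L[ℝ] E) {c : ℝ} (hc : 0 ≤ c) (n : ℕ) {ε : ℝ} (hε : 0 < ε) :
    ∃ B : E →L[ℝ] E →L[ℝ] ℝ, (∀ v w, B v w = B w v) ∧ (∃ m > 0, ∀ v, m * ‖v‖ ^ 2 ≤ B v v) ∧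
      ∀ v, ((J ^ 2 + c • (1 : E →L[ℝ] E)) ^ n) v = 0 → |B (J v) v| ≤ ε * B v v := by
  obtain ⟨m, hm, hmle⟩ := exists_le_gramForm_id (E := E)
  -- Weighted arithmetic–geometric mean: a mixed term of weight `2k` is dominated by `1/(2κ)` times
  -- the squares of weights `2(k+1)` and `2k`. A large `κ` makes the nilpotent part negligible.
  have am : ∀ (x y : EuclideanSpace ℝ (Fin (Module.finrank ℝ E))) (κ : ℝ), 0 < κ → ∀ k : ℕ,
      |κ ^ (2 * k) * inner ℝ x y| ≤
        κ⁻¹ / 2 * (κ ^ (2 * (k + 1)) * ‖x‖ ^ 2 + κ ^ (2 * k) * ‖y‖ ^ 2) := by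
    intro x y κ hκ k
    rw [abs_mul, abs_of_pos (by positivity)]
    have h1 := abs_real_inner_le_norm x y
    have h2 : κ ^ (2 * k) * |inner ℝ x y| ≤ κ ^ (2 * k) * (‖x‖ * ‖y‖) := by gcongr
    refine h2.trans ?_
    have h3 : κ ^ (2 * (k + 1)) = κ ^ (2 * k) * κ ^ 2 := by ring
    rw [h3]
    have h4 : κ⁻¹ / 2 * (κ ^ (2 * k) * κ ^ 2 * ‖x‖ ^ 2 + κ ^ (2 * k) * ‖y‖ ^ 2)
        - κ ^ (2 * k) * (‖x‖ * ‖y‖) = κ ^ (2 * k) * (κ⁻¹ / 2) * (κ * ‖x‖ - ‖y‖) ^ 2 := by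
      field_simp
      ring
    have h5 : 0 ≤ κ ^ (2 * k) * (κ⁻¹ / 2) * (κ * ‖x‖ - ‖y‖) ^ 2 := by positivity
    linarith
  rcases hc.eq_or_lt with rfl | hc
  -- Real eigenvalue: `J` is nilpotent on the vectors in question and `B(v,v) = ∑ κ^(2k) |J^k v|²`.
  -- The bound `2 * n + 1` keeps the term `k = 0`, hence definiteness, even for `n = 0`.
  · set κ := ε⁻¹ with hκ
    have hκ0 : 0 < κ := by positivity
    set B : E →L[ℝ] E →L[ℝ] ℝ := ∑ k ∈ Finset.range (2 * n + 1), κ ^ (2 * k) • gramForm (J ^ k)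
      with hB
    have hBa : ∀ v w, B v w = ∑ k ∈ Finset.range (2 * n + 1),
        κ ^ (2 * k) * gramForm (J ^ k) v w := by
      intro v w
      simp [hB]
    refine ⟨B, fun v w => ?_, ⟨m, hm, fun v => ?_⟩, fun v hv => ?_⟩
    · rw [hBa, hBa]
      exact Finset.sum_congr rfl fun k _ => by rw [gramForm_symm]
    · rw [hBa, Finset.sum_range_succ']
      have h1 : gramForm (J ^ 0) v v = gramForm (ContinuousLinearMap.id ℝ E) v v := rfl
      have h2 : 0 ≤ ∑ k ∈ Finset.range (2 * n), κ ^ (2 * (k + 1)) * gramForm (J ^ (k + 1)) v v :=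
        Finset.sum_nonneg fun k _ => mul_nonneg (by positivity) (gramForm_self_nonneg _ _)
      have := hmle v
      simp only [mul_zero, pow_zero, one_mul] at *
      linarith
    · have hv' : (J ^ (2 * n + 1)) v = 0 := by
        rw [zero_smul, add_zero, ← pow_mul] at hv
        rw [pow_succ', mul_apply_eq_comp, hv, map_zero]
      set a : ℕ → ℝ := fun k => κ ^ (2 * k) * ‖toEuclidean ((J ^ k) v)‖ ^ 2 with ha
      have ha0 : ∀ k, 0 ≤ a k := fun k => by positivity
      have h1 : B v v = ∑ k ∈ Finset.range (2 * n + 1), a k := by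
        rw [hBa]; exact Finset.sum_congr rfl fun k _ => by rw [gramForm_self]
      have h2 : ∑ k ∈ Finset.range (2 * n + 1), a (k + 1) ≤ B v v := by
        have e1 := Finset.sum_range_succ' a (2 * n + 1)
        have e2 := Finset.sum_range_succ a (2 * n + 1)
        have e3 : a (2 * n + 1) = 0 := by simp only [ha, hv', map_zero, norm_zero]; ring
        rw [h1]
        linarith [ha0 0]
      rw [hBa]
      refine (Finset.abs_sum_le_sum_abs _ _).trans ?_
      calc ∑ k ∈ Finset.range (2 * n + 1), |κ ^ (2 * k) * gramForm (J ^ k) (J v) v|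
          ≤ ∑ k ∈ Finset.range (2 * n + 1), κ⁻¹ / 2 * (a (k + 1) + a k) := by
            refine Finset.sum_le_sum fun k _ => ?_
            have := am (toEuclidean ((J ^ (k + 1)) v)) (toEuclidean ((J ^ k) v)) κ hκ0 k
            rw [gramForm_apply]
            rwa [pow_succ, mul_apply_eq_comp] at this
        _ ≤ ε * B v v := by
            rw [← Finset.mul_sum, Finset.sum_add_distrib, ← h1, hκ, inv_inv]
            nlinarith
  -- Conjugate pair: with `w = N^k v`, the form `c|w|² + |Jw|²` satisfies `c⟨Jw,w⟩ + ⟨J²w,Jw⟩ =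
  -- ⟨Nw,Jw⟩`, so only the nilpotent `N` contributes, and the weights absorb it. The summand `c⁻¹`
  -- in `κ` compensates for `|w|²` entering the form with coefficient `c` only.
  · set N := J ^ 2 + c • (1 : E →L[ℝ] E) with hN
    set κ := (c⁻¹ + 1) / (2 * ε) with hκ
    have hκ0 : 0 < κ := by positivity
    have hcomm : Commute J N := by
      rw [hN]
      exact ((Commute.refl J).pow_right 2).add_right ((Commute.one_right J).smul_right c)
    set B : E →L[ℝ] E →L[ℝ] ℝ := ∑ k ∈ Finset.range (n + 1),
      κ ^ (2 * k) • (c • gramForm (N ^ k) + gramForm (J * N ^ k)) with hB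
    have hBa : ∀ v w, B v w = ∑ k ∈ Finset.range (n + 1),
        κ ^ (2 * k) * (c * gramForm (N ^ k) v w + gramForm (J * N ^ k) v w) := by
      intro v w
      simp [hB, mul_add]
    refine ⟨B, fun v w => ?_, ⟨c * m, by positivity, fun v => ?_⟩, fun v hv => ?_⟩
    · rw [hBa, hBa]
      exact Finset.sum_congr rfl fun k _ => by rw [gramForm_symm, gramForm_symm (J * N ^ k)]
    · rw [hBa, Finset.sum_range_succ']
      have h1 : gramForm (N ^ 0) v v = gramForm (ContinuousLinearMap.id ℝ E) v v := rfl
      have h2 : 0 ≤ ∑ k ∈ Finset.range n, κ ^ (2 * (k + 1)) *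
          (c * gramForm (N ^ (k + 1)) v v + gramForm (J * N ^ (k + 1)) v v) :=
        Finset.sum_nonneg fun k _ => mul_nonneg (by positivity)
          (add_nonneg (mul_nonneg hc.le (gramForm_self_nonneg _ _)) (gramForm_self_nonneg _ _))
      have h3 := gramForm_self_nonneg (J * N ^ 0) v
      have h4 := mul_le_mul_of_nonneg_left (hmle v) hc.le
      rw [← mul_assoc] at h4
      simp only [mul_zero, pow_zero, one_mul] at *
      rw [h1]
      linarith
    · have hv' : (N ^ (n + 1)) v = 0 := by
        rw [pow_succ', mul_apply_eq_comp, hv, map_zero]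
      set a : ℕ → ℝ := fun k => κ ^ (2 * k) * ‖toEuclidean ((N ^ k) v)‖ ^ 2 with ha
      set b : ℕ → ℝ := fun k => κ ^ (2 * k) * ‖toEuclidean (J ((N ^ k) v))‖ ^ 2 with hb
      have ha0 : ∀ k, 0 ≤ a k := fun k => by positivity
      have hb0 : ∀ k, 0 ≤ b k := fun k => by positivity
      have h1 : B v v = c * ∑ k ∈ Finset.range (n + 1), a k + ∑ k ∈ Finset.range (n + 1), b k := by
        rw [hBa, Finset.mul_sum, ← Finset.sum_add_distrib]
        refine Finset.sum_congr rfl fun k _ => ?_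
        rw [gramForm_self, gramForm_self]
        simp only [ha, hb, mul_apply_eq_comp]
        ring
      have h2 : ∑ k ∈ Finset.range (n + 1), a (k + 1) ≤ ∑ k ∈ Finset.range (n + 1), a k := by
        have e1 := Finset.sum_range_succ' a (n + 1)
        have e2 := Finset.sum_range_succ a (n + 1)
        have e3 : a (n + 1) = 0 := by simp only [ha, hv', map_zero, norm_zero]; ring
        linarith [ha0 0]
      rw [hBa]
      refine (Finset.abs_sum_le_sum_abs _ _).trans ?_
      calc ∑ k ∈ Finset.range (n + 1),
            |κ ^ (2 * k) * (c * gramForm (N ^ k) (J v) v + gramForm (J * N ^ k) (J v) v)|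
          ≤ ∑ k ∈ Finset.range (n + 1), κ⁻¹ / 2 * (a (k + 1) + b k) := by
            refine Finset.sum_le_sum fun k _ => ?_
            have h3 := am (toEuclidean ((N ^ (k + 1)) v)) (toEuclidean (J ((N ^ k) v))) κ hκ0 k
            have h4 : c * gramForm (N ^ k) (J v) v + gramForm (J * N ^ k) (J v) v =
                inner ℝ (toEuclidean ((N ^ (k + 1)) v)) (toEuclidean (J ((N ^ k) v))) := by
              have e1 : (N ^ k) (J v) = J ((N ^ k) v) := by
                have := congrArg (fun L : E →L[ℝ] E => L v) (hcomm.pow_right k).eq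
                simpa using this.symm
              have e2 : (N ^ (k + 1)) v = J (J ((N ^ k) v)) + c • (N ^ k) v := by
                rw [pow_succ', mul_apply_eq_comp]
                generalize (N ^ k) v = w
                simp [hN, pow_two]
              rw [gramForm_apply, gramForm_apply, e2, map_add, map_smul, inner_add_left,
                real_inner_smul_left]
              simp only [mul_apply_eq_comp, e1]
              rw [real_inner_comm (toEuclidean ((N ^ k) v))]
              ring
            rw [h4]
            exact h3
        _ ≤ ε * B v v := by
            rw [← Finset.mul_sum, Finset.sum_add_distrib, h1]
            set Sa := ∑ k ∈ Finset.range (n + 1), a k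
            set Sb := ∑ k ∈ Finset.range (n + 1), b k
            have hSa : 0 ≤ Sa := Finset.sum_nonneg fun k _ => ha0 k
            have hSb : 0 ≤ Sb := Finset.sum_nonneg fun k _ => hb0 k
            have h5 : κ⁻¹ / 2 = ε / (c⁻¹ + 1) := by rw [hκ]; field_simp
            have h6 : κ⁻¹ / 2 * (Sa + Sb) ≤ ε * (c * Sa + Sb) := by
              rw [h5, div_mul_eq_mul_div, div_le_iff₀ (by positivity), mul_assoc]
              gcongr
              have : (c * Sa + Sb) * (c⁻¹ + 1) = Sa + Sb + (c * Sa + c⁻¹ * Sb) := by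
                field_simp
                ring
              rw [this]
              have : 0 ≤ c * Sa + c⁻¹ * Sb := by positivity
              linarith
            refine le_trans ?_ h6
            gcongr

end Forms


/-! ### Growth and decay of solutions controlled by quadratic forms -/

section Lyapunov

variable {E : Type*} [NormedAddCommGroup E] [NormedSpace ℝ E]

/-- The quadratic form of `B` grows, with rate at least `c`, along the flow of `A - g`. -/
def IsLyapunov (B : E →L[ℝ] E →L[ℝ] ℝ) (A : E →L[ℝ] E) (g c : ℝ) : Prop :=
  ∀ v, c * ‖v‖ ^ 2 ≤ B (A v - g • v) v

theorem IsLyapunov.neg {B : E →L[ℝ] E →L[ℝ] ℝ} {A : E →L[ℝ] E} {g c : ℝ}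
    (h : IsLyapunov B A g c) : IsLyapunov (-B) (-A) (-g) c := by
  intro v
  refine (h v).trans_eq ?_
  have : (-A) v - (-g) • v = -(A v - g • v) := by simp; abel
  rw [this]
  simp

/-- The condition is open in `A` for a fixed form. This is the advantage of forms over invariant
subspaces: nothing has to be followed when the point or the vector field moves. -/
theorem IsLyapunov.perturb {B : E →L[ℝ] E →L[ℝ] ℝ} {A A' : E →L[ℝ] E} {g c : ℝ}
    (h : IsLyapunov B A g c) (hA : ‖B‖ * ‖A' - A‖ ≤ c / 2) : IsLyapunov B A' g (c / 2) := by
  intro v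
  have h1 := h v
  have h2 : B (A' v - g • v) v = B (A v - g • v) v + B ((A' - A) v) v := by
    rw [← add_apply, ← map_add]
    congr 2
    simp
  have h3 : |B ((A' - A) v) v| ≤ c / 2 * ‖v‖ ^ 2 := by
    refine (B.le_opNorm₂ _ _).trans ?_
    calc ‖B‖ * ‖(A' - A) v‖ * ‖v‖ ≤ ‖B‖ * (‖A' - A‖ * ‖v‖) * ‖v‖ := by
          gcongr; exact (A' - A).le_opNorm v
      _ = ‖B‖ * ‖A' - A‖ * ‖v‖ ^ 2 := by ring
      _ ≤ _ := by gcongr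
  have h4 := neg_abs_le (B ((A' - A) v) v)
  rw [h2]
  linarith

/-- The weight `exp(-2gt)` turns `v'` into `v' - g v`, and symmetry merges the two halves of the
derivative. -/
theorem hasDerivAt_scaled_form {B : E →L[ℝ] E →L[ℝ] ℝ} (hB : ∀ v w, B v w = B w v) (g : ℝ)
    {v : ℝ → E} {v' : E} {t : ℝ} (hv : HasDerivAt v v' t) :
    HasDerivAt (fun t => Real.exp (-2 * g * t) * B (v t) (v t))
      (2 * Real.exp (-2 * g * t) * B (v' - g • v t) (v t)) t := by
  have h1 : HasDerivAt (fun t => B (v t) (v t)) (B v' (v t) + B (v t) v') t :=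
    (B.hasFDerivAt.comp_hasDerivAt t hv).clm_apply hv
  have h2 : HasDerivAt (fun t => Real.exp (-2 * g * t)) (Real.exp (-2 * g * t) * (-2 * g)) t := by
    have := ((hasDerivAt_id t).const_mul (-2 * g)).exp
    simpa using this
  refine (h2.mul h1).congr_deriv ?_
  rw [hB (v t) v', map_sub, map_smul, sub_apply, smul_apply, smul_eq_mul]
  ring

theorem monotoneOn_scaled_form {B : E →L[ℝ] E →L[ℝ] ℝ} (hB : ∀ v w, B v w = B w v) {g c : ℝ}
    (hc : 0 ≤ c) {I : Set ℝ} (hI : Convex ℝ I) {v : ℝ → E} {a : ℝ → E →L[ℝ] E}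
    (hv : ∀ t ∈ I, HasDerivAt v (a t (v t)) t) (ha : ∀ t ∈ I, IsLyapunov B (a t) g c) :
    MonotoneOn (fun t => Real.exp (-2 * g * t) * B (v t) (v t)) I := by
  have hd := fun t ht => hasDerivAt_scaled_form hB g (hv t ht)
  refine monotoneOn_of_deriv_nonneg hI (fun t ht => (hd t ht).continuousAt.continuousWithinAt)
    (fun t ht => (hd t (interior_subset ht)).differentiableAt.differentiableWithinAt)
    fun t ht => ?_
  rw [(hd t (interior_subset ht)).deriv]
  have := ha t (interior_subset ht) (v t)
  have h0 : 0 ≤ c * ‖v t‖ ^ 2 := by positivity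
  have := h0.trans this
  positivity

theorem strictMonoOn_scaled_form {B : E →L[ℝ] E →L[ℝ] ℝ} (hB : ∀ v w, B v w = B w v) {g c : ℝ}
    (hc : 0 < c) {I : Set ℝ} (hI : Convex ℝ I) {v : ℝ → E} {a : ℝ → E →L[ℝ] E}
    (hv : ∀ t ∈ I, HasDerivAt v (a t (v t)) t) (ha : ∀ t ∈ I, IsLyapunov B (a t) g c)
    (hne : ∀ t ∈ I, v t ≠ 0) :
    StrictMonoOn (fun t => Real.exp (-2 * g * t) * B (v t) (v t)) I := by
  have hd := fun t ht => hasDerivAt_scaled_form hB g (hv t ht)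
  refine strictMonoOn_of_deriv_pos hI (fun t ht => (hd t ht).continuousAt.continuousWithinAt)
    fun t ht => ?_
  rw [(hd t (interior_subset ht)).deriv]
  have := ha t (interior_subset ht) (v t)
  have h0 : 0 < c * ‖v t‖ ^ 2 := by
    have := norm_pos_iff.2 (hne t (interior_subset ht))
    positivity
  have := h0.trans_le this
  positivity

/-- If the quadratic form becomes positive, then the solution grows at least as `exp (g t)`. -/
theorem exists_growth_of_pos {B : E →L[ℝ] E →L[ℝ] ℝ} (hB : ∀ v w, B v w = B w v) {g c t₀ : ℝ}
    (hc : 0 ≤ c) {v : ℝ → E} {a : ℝ → E →L[ℝ] E}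
    (hv : ∀ t ≥ t₀, HasDerivAt v (a t (v t)) t) (ha : ∀ t ≥ t₀, IsLyapunov B (a t) g c)
    (h0 : 0 < B (v t₀) (v t₀)) :
    ∃ κ > 0, ∀ t ≥ t₀, κ * Real.exp (g * t) ≤ ‖v t‖ := by
  have hm := monotoneOn_scaled_form hB hc (convex_Ici t₀) hv ha
  set q := Real.exp (-2 * g * t₀) * B (v t₀) (v t₀) with hq
  have hq0 : 0 < q := by positivity
  refine ⟨√(q / (‖B‖ + 1)), by positivity, fun t ht => ?_⟩
  have h1 : q ≤ Real.exp (-2 * g * t) * B (v t) (v t) := hm (mem_Ici.2 le_rfl) ht ht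
  have h2 : B (v t) (v t) ≤ (‖B‖ + 1) * ‖v t‖ ^ 2 := by
    have := (le_abs_self _).trans (B.le_opNorm₂ (v t) (v t))
    nlinarith [sq_nonneg ‖v t‖]
  have h3 : Real.exp (g * t) ^ 2 * Real.exp (-2 * g * t) = 1 := by
    rw [← Real.exp_nat_mul, ← Real.exp_add]
    simp; ring
  have h4 : q * Real.exp (g * t) ^ 2 ≤ (‖B‖ + 1) * ‖v t‖ ^ 2 := by
    calc q * Real.exp (g * t) ^ 2
        ≤ Real.exp (-2 * g * t) * B (v t) (v t) * Real.exp (g * t) ^ 2 := by gcongr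
      _ = (Real.exp (g * t) ^ 2 * Real.exp (-2 * g * t)) * B (v t) (v t) := by ring
      _ ≤ _ := by rw [h3, one_mul]; exact h2
  have h5 : (√(q / (‖B‖ + 1)) * Real.exp (g * t)) ^ 2 ≤ ‖v t‖ ^ 2 := by
    rw [mul_pow, Real.sq_sqrt (by positivity), div_mul_eq_mul_div, div_le_iff₀ (by positivity)]
    linarith
  exact le_of_sq_le_sq h5 (norm_nonneg _)

omit [NormedSpace ℝ E] in
theorem not_isBigO_of_growth {v : ℝ → E} {g c κ t₀ : ℝ} (hcg : c < g) (hκ : 0 < κ)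
    (h : ∀ t ≥ t₀, κ * Real.exp (g * t) ≤ ‖v t‖) :
    ¬ v =O[atTop] fun t => Real.exp (c * t) := by
  intro hO
  obtain ⟨C, hC⟩ := hO.bound
  have h1 : Tendsto (fun t => κ * Real.exp ((g - c) * t)) atTop atTop :=
    (Real.tendsto_exp_atTop.comp (tendsto_id.const_mul_atTop (sub_pos.2 hcg))).const_mul_atTop hκ
  obtain ⟨t, ht1, ht2, ht3⟩ := (hC.and ((eventually_ge_atTop t₀).and
    (h1.eventually_gt_atTop C))).exists
  have h4 := (h t ht2).trans ht1
  rw [Real.norm_of_nonneg (Real.exp_pos _).le] at h4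
  have h5 : Real.exp (g * t) = Real.exp ((g - c) * t) * Real.exp (c * t) := by
    rw [← Real.exp_add]; ring_nf
  rw [h5, ← mul_assoc] at h4
  have := le_of_mul_le_mul_right h4 (Real.exp_pos _)
  linarith

variable [FiniteDimensional ℝ E]

/-- If the quadratic form stays nonpositive, then the solution is bounded by `exp (g t)`. -/
theorem exists_bound_of_nonpos {B : E →L[ℝ] E →L[ℝ] ℝ} (hB : ∀ v w, B v w = B w v)
    {g c t₀ K : ℝ} (hc : 0 < c) {v : ℝ → E} {a : ℝ → E →L[ℝ] E}
    (hv : ∀ t ≥ t₀, HasDerivAt v (a t (v t)) t) (ha : ∀ t ≥ t₀, IsLyapunov B (a t) g c)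
    (hK : ∀ t ≥ t₀, ‖a t‖ ≤ K) (h0 : ∀ t ≥ t₀, B (v t) (v t) ≤ 0) :
    ∃ C, ∀ t ≥ t₀, ‖v t‖ ≤ C * Real.exp (g * t) := by
  obtain ⟨m, hm, hmle⟩ := exists_le_gramForm_id (E := E)
  set G := gramForm (ContinuousLinearMap.id ℝ E) with hG
  have hK0 : 0 ≤ K := (norm_nonneg _).trans (hK t₀ le_rfl)
  -- A small multiple of a Euclidean form is subtracted: with this `δ` the form `B - δ G` is still
  -- monotone (constant `0`), and where `B ≤ 0` it is at most `-δ m |v|²`, so monotonicity bounds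
  -- `|v|` from above.
  set δ := c / (‖G‖ * (K + |g|) + 1) with hδ
  have hδ0 : 0 < δ := by positivity
  have hB' : ∀ v w, (B - δ • G) v w = (B - δ • G) w v := by
    intro v w
    simp [hB v w, hG, gramForm_symm _ v w]
  have ha' : ∀ t ≥ t₀, IsLyapunov (B - δ • G) (a t) g 0 := by
    intro t ht w
    have h1 := ha t ht w
    have h2 : |G (a t w - g • w) w| ≤ (‖G‖ * (K + |g|) + 1) * ‖w‖ ^ 2 := by
      refine (G.le_opNorm₂ _ _).trans ?_
      have h3 : ‖a t w - g • w‖ ≤ (K + |g|) * ‖w‖ := by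
        refine (norm_sub_le _ _).trans ?_
        rw [norm_smul, add_mul, Real.norm_eq_abs]
        gcongr
        exact (a t).le_of_opNorm_le (hK t ht) w
      calc ‖G‖ * ‖a t w - g • w‖ * ‖w‖ ≤ ‖G‖ * ((K + |g|) * ‖w‖) * ‖w‖ := by gcongr
        _ ≤ _ := by nlinarith [sq_nonneg ‖w‖]
    have h4 : δ * |G (a t w - g • w) w| ≤ c * ‖w‖ ^ 2 := by
      calc δ * |G (a t w - g • w) w| ≤ δ * ((‖G‖ * (K + |g|) + 1) * ‖w‖ ^ 2) := by gcongr
        _ = _ := by rw [hδ]; field_simp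
    have h5 : δ * G (a t w - g • w) w ≤ δ * |G (a t w - g • w) w| := by
      gcongr; exact le_abs_self _
    simp only [sub_apply, smul_apply, smul_eq_mul, zero_mul]
    linarith
  have hmono := monotoneOn_scaled_form hB' le_rfl (convex_Ici t₀) hv ha'
  set D := - (Real.exp (-2 * g * t₀) * (B - δ • G) (v t₀) (v t₀)) with hD
  refine ⟨√(|D| / (δ * m)), fun t ht => ?_⟩
  have h1 : -D ≤ Real.exp (-2 * g * t) * (B - δ • G) (v t) (v t) := by
    rw [hD, neg_neg]; exact hmono (mem_Ici.2 le_rfl) ht ht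
  have h2 : (B - δ • G) (v t) (v t) ≤ - (δ * (m * ‖v t‖ ^ 2)) := by
    have := hmle (v t)
    have := h0 t ht
    simp only [sub_apply, smul_apply, smul_eq_mul]
    nlinarith
  have h3 : Real.exp (g * t) ^ 2 * Real.exp (-2 * g * t) = 1 := by
    rw [← Real.exp_nat_mul, ← Real.exp_add]
    simp; ring
  have h4 : Real.exp (-2 * g * t) * (δ * (m * ‖v t‖ ^ 2)) ≤ |D| := by
    have := mul_le_mul_of_nonneg_left h2 (Real.exp_pos (-2 * g * t)).le
    have := le_abs_self D
    linarith
  have h5 : ‖v t‖ ^ 2 ≤ (√(|D| / (δ * m)) * Real.exp (g * t)) ^ 2 := by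
    rw [mul_pow, Real.sq_sqrt (by positivity), div_mul_eq_mul_div, le_div_iff₀ (by positivity)]
    calc ‖v t‖ ^ 2 * (δ * m)
        = (Real.exp (g * t) ^ 2 * Real.exp (-2 * g * t)) * (δ * (m * ‖v t‖ ^ 2)) := by
          rw [h3]; ring
      _ = Real.exp (g * t) ^ 2 * (Real.exp (-2 * g * t) * (δ * (m * ‖v t‖ ^ 2))) := by ring
      _ ≤ Real.exp (g * t) ^ 2 * |D| := by gcongr
      _ = _ := by ring
  exact le_of_sq_le_sq h5 (by positivity)

end Lyapunov


/-! ### Decay of the linear flow and the exponent spaces -/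

section Decay

variable {E : Type*} [NormedAddCommGroup E] [NormedSpace ℝ E] [FiniteDimensional ℝ E]

theorem hasDerivAt_linearFlow (A : E →L[ℝ] E) (v : E) (t : ℝ) :
    HasDerivAt (fun t : ℝ => NormedSpace.exp (t • A) v) (A (NormedSpace.exp (t • A) v)) t := by
  have : CompleteSpace E := FiniteDimensional.complete ℝ E
  have h := (hasDerivAt_exp_smul_const' (𝕂 := ℝ) A t).clm_apply (hasDerivAt_const t v)
  simpa using h

omit [FiniteDimensional ℝ E] in
theorem linearFlow_zero (A : E →L[ℝ] E) (v : E) : NormedSpace.exp ((0 : ℝ) • A) v = v := by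
  simp

theorem linearFlow_ne_zero (A : E →L[ℝ] E) {v : E} (hv : v ≠ 0) (t : ℝ) :
    NormedSpace.exp (t • A) v ≠ 0 := by
  intro h
  have h2 := ODE_solution_unique_univ (v := fun _ => A) (s := fun _ => univ) (t₀ := t)
    (fun _ => A.lipschitz.lipschitzOnWith)
    (fun s => ⟨hasDerivAt_linearFlow A v s, mem_univ _⟩) (g := fun _ => 0)
    (fun s => ⟨by simpa using hasDerivAt_const s (0 : E), mem_univ _⟩) h
  exact hv (by simpa using congrFun h2 0)

/-- Both sides solve the linear equation of `A'` with the same initial value. It serves for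
operators commuting with `A`, for restrictions to invariant subspaces and for changes of chart. -/
theorem linearFlow_intertwine {F : Type*} [NormedAddCommGroup F] [NormedSpace ℝ F]
    [FiniteDimensional ℝ F] {A : E →L[ℝ] E} {A' : F →L[ℝ] F} {L : E →L[ℝ] F}
    (h : ∀ v, L (A v) = A' (L v)) (t : ℝ) (v : E) :
    L (NormedSpace.exp (t • A) v) = NormedSpace.exp (t • A') (L v) := by
  have h1 : ∀ s : ℝ, HasDerivAt (fun s : ℝ => L (NormedSpace.exp (s • A) v))
      (A' (L (NormedSpace.exp (s • A) v))) s := by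
    intro s
    rw [← h]
    exact L.hasFDerivAt.comp_hasDerivAt s (hasDerivAt_linearFlow A v s)
  have h2 := ODE_solution_unique_univ (v := fun _ => A') (s := fun _ => univ) (t₀ := 0)
    (fun _ => A'.lipschitz.lipschitzOnWith) (fun s => ⟨h1 s, mem_univ _⟩)
    (fun s => ⟨hasDerivAt_linearFlow A' (L v) s, mem_univ _⟩) (by simp)
  exact congrFun h2 t

/-- The vectors `v` for which `exp (t A) v` is negligible with respect to `exp (g t)` in the
future. -/
def fwdDecay (A : E →L[ℝ] E) (g : ℝ) : Submodule ℝ E where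
  carrier := {v | Tendsto (fun t : ℝ => Real.exp (-g * t) • NormedSpace.exp (t • A) v) atTop (𝓝 0)}
  add_mem' {v w} hv hw := by
    have := hv.add hw
    simpa using this
  zero_mem' := by simp
  smul_mem' c v hv := by
    have := hv.const_smul c
    simpa [smul_comm c] using this

/-- The vectors `v` for which `exp (t A) v` is negligible with respect to `exp (g t)` in the
past. -/
def bwdDecay (A : E →L[ℝ] E) (g : ℝ) : Submodule ℝ E := fwdDecay (-A) (-g)

omit [FiniteDimensional ℝ E] in
theorem mem_fwdDecay {A : E →L[ℝ] E} {g : ℝ} {v : E} : v ∈ fwdDecay A g ↔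
    Tendsto (fun t : ℝ => Real.exp (-g * t) • NormedSpace.exp (t • A) v) atTop (𝓝 0) := Iff.rfl

theorem map_mem_fwdDecay {F : Type*} [NormedAddCommGroup F] [NormedSpace ℝ F]
    [FiniteDimensional ℝ F] {A : E →L[ℝ] E} {A' : F →L[ℝ] F} {L : E →L[ℝ] F}
    (h : ∀ v, L (A v) = A' (L v)) {g : ℝ} {v : E} (hv : v ∈ fwdDecay A g) :
    L v ∈ fwdDecay A' g := by
  rw [mem_fwdDecay] at *
  have := (L.continuous.tendsto 0).comp hv
  simp only [map_zero] at this
  refine this.congr fun t => ?_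
  simp [linearFlow_intertwine h]

theorem map_mem_bwdDecay {F : Type*} [NormedAddCommGroup F] [NormedSpace ℝ F]
    [FiniteDimensional ℝ F] {A : E →L[ℝ] E} {A' : F →L[ℝ] F} {L : E →L[ℝ] F}
    (h : ∀ v, L (A v) = A' (L v)) {g : ℝ} {v : E} (hv : v ∈ bwdDecay A g) :
    L v ∈ bwdDecay A' g :=
  map_mem_fwdDecay (fun v => by simp [h]) hv

/-- The scaled form is strictly increasing and tends to `0` in the future, hence is negative at time
`0`. -/
theorem form_neg_of_mem_fwdDecay {B : E →L[ℝ] E →L[ℝ] ℝ} (hB : ∀ v w, B v w = B w v)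
    {A : E →L[ℝ] E} {g c : ℝ} (hc : 0 < c) (h : IsLyapunov B A g c) {v : E} (hv : v ≠ 0)
    (hvd : v ∈ fwdDecay A g) : B v v < 0 := by
  have hmono := strictMonoOn_scaled_form hB hc convex_univ
    (fun t _ => hasDerivAt_linearFlow A v t) (fun t _ => h) (fun t _ => linearFlow_ne_zero A hv t)
  have hlim : Tendsto (fun t : ℝ => Real.exp (-2 * g * t) *
      B (NormedSpace.exp (t • A) v) (NormedSpace.exp (t • A) v)) atTop (𝓝 0) := by
    have h1 : Continuous fun w : E => B w w := by fun_prop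
    have h2 := (h1.tendsto 0).comp hvd
    simp only [map_zero] at h2
    refine h2.congr fun t => ?_
    have : Real.exp (-2 * g * t) = Real.exp (-g * t) * Real.exp (-g * t) := by
      rw [← Real.exp_add]; ring_nf
    simp only [Function.comp, this, map_smul, smul_apply, smul_eq_mul]
    ring
  have h1 : Real.exp (-2 * g * 1) * B (NormedSpace.exp ((1 : ℝ) • A) v)
      (NormedSpace.exp ((1 : ℝ) • A) v) ≤ 0 := by
    refine ge_of_tendsto hlim ?_
    filter_upwards [eventually_ge_atTop 1] with t ht
    exact hmono.monotoneOn (mem_univ _) (mem_univ _) ht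
  have h0 := hmono (mem_univ (0 : ℝ)) (mem_univ (1 : ℝ)) one_pos
  simp only [mul_zero, Real.exp_zero, one_mul, linearFlow_zero] at h0
  linarith

theorem form_pos_of_mem_bwdDecay {B : E →L[ℝ] E →L[ℝ] ℝ} (hB : ∀ v w, B v w = B w v)
    {A : E →L[ℝ] E} {g c : ℝ} (hc : 0 < c) (h : IsLyapunov B A g c) {v : E} (hv : v ≠ 0)
    (hvd : v ∈ bwdDecay A g) : 0 < B v v := by
  have := form_neg_of_mem_fwdDecay (B := -B) (fun v w => by simp [hB v w]) hc h.neg hv hvd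
  simpa using this

omit [FiniteDimensional ℝ E] in
theorem coe_pow_apply {L : E →L[ℝ] E} {f : Module.End ℝ E} (h : ∀ v, L v = f v) (n : ℕ) (v : E) :
    (L ^ n) v = (f ^ n) v := by
  induction n with
  | zero => rfl
  | succ n ih => rw [pow_succ', pow_succ', mul_apply_eq_comp, Module.End.mul_apply, ih, h]

omit [FiniteDimensional ℝ E] in
theorem quadratic_pow_apply (A : E →L[ℝ] E) (i : ℝ × ℝ) (n : ℕ) (v : E) :
    (((A - i.1 • (1 : E →L[ℝ] E)) ^ 2 + i.2 • (1 : E →L[ℝ] E)) ^ n) v =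
      ((((A : Module.End ℝ E) - algebraMap ℝ (Module.End ℝ E) i.1) ^ 2 +
        algebraMap ℝ (Module.End ℝ E) i.2) ^ n) v := by
  apply coe_pow_apply
  intro v
  simp [pow_two, Module.algebraMap_end_apply]

/-- A slowly varying form on the generalized eigenspace replaces the explicit exponential of a
Jordan block: with the intermediate rate `γ = (s + g)/2`, the function `exp(-2γt) B` is
nonincreasing along the orbit. -/
theorem exponentSpace_le_fwdDecay (A : E →L[ℝ] E) {s g : ℝ} (h : s < g) :
    exponentSpace (A : Module.End ℝ E) s ≤ fwdDecay A g := by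
  refine iSup_le fun b v hv => ?_
  obtain ⟨n, hn⟩ := (Module.End.mem_maxGenEigenspace _ _ _).1 hv
  set J := A - s • (1 : E →L[ℝ] E) with hJ
  have hker : ((J ^ 2 + (b ^ 2) • (1 : E →L[ℝ] E)) ^ n) v = 0 := by
    have := quadratic_pow_apply A (s, b ^ 2) n v
    simp only at this
    rw [hJ, this, ← hn]
    congr 2
    rw [neg_smul, sub_neg_eq_add]
    rfl
  obtain ⟨B, hB, ⟨m, hm, hmle⟩, hest⟩ :=
    exists_block_form J (sq_nonneg b) n (ε := (g - s) / 2) (by linarith)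
  set y : ℝ → E := fun t => NormedSpace.exp (t • A) v with hy
  -- The estimate on `B` holds only on the kernel; this kernel is invariant under the linear flow
  -- because the operator commutes with `A`.
  have hyker : ∀ t, ((J ^ 2 + (b ^ 2) • (1 : E →L[ℝ] E)) ^ n) (y t) = 0 := by
    intro t
    set N := (J ^ 2 + (b ^ 2) • (1 : E →L[ℝ] E)) ^ n with hN
    have hc : Commute N A := by
      have : Commute J A := (Commute.refl A).sub_left ((Commute.one_left A).smul_left s)
      exact (((this.pow_left 2).add_left ((Commute.one_left A).smul_left _))).pow_left n
    have := linearFlow_intertwine (L := N) (A := A) (A' := A)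
      (fun w => congrArg (fun L : E →L[ℝ] E => L w) hc.eq) t v
    rw [hy]
    simp only
    rw [this, hker, map_zero]
  set γ := (s + g) / 2 with hγ
  have hd : ∀ t, HasDerivAt (fun t => Real.exp (-2 * γ * t) * B (y t) (y t))
      (2 * Real.exp (-2 * γ * t) * B (A (y t) - γ • y t) (y t)) t :=
    fun t => hasDerivAt_scaled_form hB γ (hasDerivAt_linearFlow A v t)
  have hanti : Antitone fun t => Real.exp (-2 * γ * t) * B (y t) (y t) := by
    refine antitone_of_deriv_nonpos (fun t => (hd t).differentiableAt) fun t => ?_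
    rw [(hd t).deriv]
    have h1 := (abs_le.1 (hest (y t) (hyker t))).2
    have h2 : B (A (y t) - γ • y t) (y t) = B (J (y t)) (y t) - (g - s) / 2 * B (y t) (y t) := by
      have : A (y t) - γ • y t = J (y t) - ((g - s) / 2) • y t := by
        rw [hJ, hγ]
        simp only [sub_apply, smul_apply, one_apply_eq_self]
        module
      rw [this, map_sub, map_smul, sub_apply, smul_apply, smul_eq_mul]
    have h3 : B (A (y t) - γ • y t) (y t) ≤ 0 := by rw [h2]; linarith
    exact mul_nonpos_of_nonneg_of_nonpos (by positivity) h3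
  rw [mem_fwdDecay]
  have hbound : ∀ t ≥ (0 : ℝ), ‖Real.exp (-g * t) • y t‖ ≤
      √(B v v / m) * Real.exp (-((g - s) / 2) * t) := by
    intro t ht
    have h1 : Real.exp (-2 * γ * t) * B (y t) (y t) ≤ B v v := by
      have := hanti ht
      simpa [hy] using this
    have h2 : Real.exp (-2 * γ * t) * (m * ‖y t‖ ^ 2) ≤ B v v := by
      refine le_trans ?_ h1
      gcongr
      exact hmle _
    have hBv : 0 ≤ B v v := le_trans (by positivity) (hmle v)
    have h3 : (Real.exp (-γ * t) * ‖y t‖) ^ 2 ≤ √(B v v / m) ^ 2 := by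
      rw [Real.sq_sqrt (by positivity), le_div_iff₀ hm, mul_pow, ← Real.exp_nat_mul]
      refine le_trans (le_of_eq ?_) h2
      push_cast
      ring_nf
    have h4 := le_of_sq_le_sq h3 (Real.sqrt_nonneg _)
    rw [norm_smul, Real.norm_of_nonneg (Real.exp_pos _).le]
    have h5 : Real.exp (-g * t) = Real.exp (-γ * t) * Real.exp (-((g - s) / 2) * t) := by
      rw [← Real.exp_add, hγ]; ring_nf
    rw [h5]
    calc Real.exp (-γ * t) * Real.exp (-((g - s) / 2) * t) * ‖y t‖
        = (Real.exp (-γ * t) * ‖y t‖) * Real.exp (-((g - s) / 2) * t) := by ring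
      _ ≤ _ := by gcongr
  refine squeeze_zero_norm' (eventually_atTop.2 ⟨0, hbound⟩) ?_
  have h6 : Tendsto (fun t : ℝ => Real.exp (-((g - s) / 2) * t)) atTop (𝓝 0) :=
    Real.tendsto_exp_atBot.comp (tendsto_id.const_mul_atTop_of_neg (by linarith))
  simpa using h6.const_mul (√(B v v / m))

theorem exponentSpace_neg {V : Type*} [AddCommGroup V] [Module ℝ V] (A : Module.End ℝ V) (r : ℝ) :
    exponentSpace (-A) (-r) = exponentSpace A r := by
  have : (-A - algebraMap ℝ (Module.End ℝ V) (-r)) ^ 2 =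
      (A - algebraMap ℝ (Module.End ℝ V) r) ^ 2 := by
    rw [map_neg, sub_neg_eq_add, ← neg_sq, neg_add, neg_neg, sub_eq_add_neg]
  rw [exponentSpace, exponentSpace, this]

theorem exponentSpace_le_bwdDecay (A : E →L[ℝ] E) {s g : ℝ} (h : g < s) :
    exponentSpace (A : Module.End ℝ E) s ≤ bwdDecay A g := by
  rw [← exponentSpace_neg]
  exact exponentSpace_le_fwdDecay (-A) (neg_lt_neg h)

theorem mem_exponentSpace_of_pow_eq_zero {V : Type*} [AddCommGroup V] [Module ℝ V]
    {A : Module.End ℝ V} {i : ℝ × ℝ} (hi : 0 ≤ i.2) {n : ℕ} {v : V}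
    (h : (((A - algebraMap ℝ (Module.End ℝ V) i.1) ^ 2 +
      algebraMap ℝ (Module.End ℝ V) i.2) ^ n) v = 0) : v ∈ exponentSpace A i.1 := by
  refine Submodule.mem_iSup_of_mem (√i.2) ?_
  refine (Module.End.mem_maxGenEigenspace _ _ _).2 ⟨n, ?_⟩
  rw [Real.sq_sqrt hi, neg_smul, sub_neg_eq_add, ← h]
  rfl

theorem iSup_exponentSpace {V : Type*} [AddCommGroup V] [Module ℝ V] [Module.Finite ℝ V]
    (A : Module.End ℝ V) : ⨆ r ∈ exponents A, exponentSpace A r = ⊤ := by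
  obtain ⟨s, n, p, hexp, hnn, -, hsum, hker⟩ := exists_spectral_decomposition A
  rw [eq_top_iff]
  intro v _
  have hv : v = ∑ i ∈ s, p i v := by
    rw [← LinearMap.sum_apply, hsum]; rfl
  rw [hv]
  refine Submodule.sum_mem _ fun i hi => ?_
  refine Submodule.mem_iSup_of_mem i.1 (Submodule.mem_iSup_of_mem (hexp i hi) ?_)
  exact mem_exponentSpace_of_pow_eq_zero (hnn i hi) (n := n i)
    (congrArg (fun L : Module.End ℝ V => L v) (hker i hi))

/-- The form of a single spectral component. -/
theorem exists_component_form (A : E →L[ℝ] E) {i : ℝ × ℝ} (hi : 0 ≤ i.2) (n : ℕ) {g₀ g₁ : ℝ}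
    (h01 : g₀ ≤ g₁) (h : i.1 ∉ Icc g₀ g₁) :
    ∃ B : E →L[ℝ] E →L[ℝ] ℝ, (∀ v w, B v w = B w v) ∧
      ∀ v, (((A - i.1 • (1 : E →L[ℝ] E)) ^ 2 + i.2 • (1 : E →L[ℝ] E)) ^ n) v = 0 →
        ‖v‖ ^ 2 ≤ B (A v - g₀ • v) v ∧ ‖v‖ ^ 2 ≤ B (A v - g₁ • v) v := by
  set J := A - i.1 • (1 : E →L[ℝ] E) with hJ
  have hAJ : ∀ g v, A v - g • v = J v + (i.1 - g) • v := by
    intro g v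
    simp only [hJ, sub_apply, smul_apply, one_apply_eq_self]
    module
  -- A component slower than both rates gets a negative form, a faster one a positive form. Dividing
  -- by `d` normalizes the lower bound to `‖v‖²`.
  rcases lt_or_ge i.1 g₀ with hlt | hge
  · obtain ⟨B, hB, ⟨m, hm, hmle⟩, hest⟩ :=
      exists_block_form J hi n (ε := (g₀ - i.1) / 2) (by linarith)
    set d := m * ((g₀ - i.1) / 2) with hd
    have hd0 : 0 < d := mul_pos hm (by linarith)
    refine ⟨-(d⁻¹ • B), fun v w => by simp [hB v w], fun v hv => ?_⟩
    have key : ∀ g, g₀ ≤ g → ‖v‖ ^ 2 ≤ (-(d⁻¹ • B)) (A v - g • v) v := by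
      intro g hg
      rw [hAJ]
      have h1 := (abs_le.1 (hest v hv)).2
      have h2 := hmle v
      have hBv : 0 ≤ B v v := le_trans (by positivity) h2
      simp only [neg_apply, smul_apply, smul_eq_mul, map_add, map_smul, add_apply]
      have h3 : d * ‖v‖ ^ 2 ≤ -(B (J v) v + (i.1 - g) * B v v) := by
        rw [hd]
        nlinarith
      have h4 := mul_le_mul_of_nonneg_left h3 (inv_pos.2 hd0).le
      rw [inv_mul_cancel_left₀ hd0.ne'] at h4
      linarith
    exact ⟨key _ le_rfl, key _ h01⟩
  · have hgt : g₁ < i.1 := by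
      by_contra hcon
      exact h ⟨hge, not_lt.1 hcon⟩
    obtain ⟨B, hB, ⟨m, hm, hmle⟩, hest⟩ :=
      exists_block_form J hi n (ε := (i.1 - g₁) / 2) (by linarith)
    set d := m * ((i.1 - g₁) / 2) with hd
    have hd0 : 0 < d := mul_pos hm (by linarith)
    refine ⟨d⁻¹ • B, fun v w => by simp [hB v w], fun v hv => ?_⟩
    have key : ∀ g, g ≤ g₁ → ‖v‖ ^ 2 ≤ (d⁻¹ • B) (A v - g • v) v := by
      intro g hg
      rw [hAJ]
      have h1 := (abs_le.1 (hest v hv)).1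
      have h2 := hmle v
      have hBv : 0 ≤ B v v := le_trans (by positivity) h2
      simp only [smul_apply, smul_eq_mul, map_add, map_smul, add_apply]
      have h3 : d * ‖v‖ ^ 2 ≤ B (J v) v + (i.1 - g) * B v v := by
        rw [hd]
        nlinarith
      have h4 := mul_le_mul_of_nonneg_left h3 (inv_pos.2 hd0).le
      rw [inv_mul_cancel_left₀ hd0.ne'] at h4
      linarith
    exact ⟨key _ h01, key _ le_rfl⟩

/-- The signed component forms are pulled back by the spectral maps and added. One form serves both
rates because no exponent lies between them, so every component has the same sign for both. -/
theorem exists_lyapunov (A : E →L[ℝ] E) {g₀ g₁ : ℝ} (h01 : g₀ ≤ g₁)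
    (h : ∀ r ∈ exponents (A : Module.End ℝ E), r ∉ Icc g₀ g₁) :
    ∃ B : E →L[ℝ] E →L[ℝ] ℝ, (∀ v w, B v w = B w v) ∧
      ∃ c > 0, IsLyapunov B A g₀ c ∧ IsLyapunov B A g₁ c := by
  obtain ⟨s, n, p, hexp, hnn, hcomm, hsum, hker⟩ :=
    exists_spectral_decomposition (A : Module.End ℝ E)
  have hforms : ∀ i : ℝ × ℝ, ∃ B : E →L[ℝ] E →L[ℝ] ℝ, i ∈ s → (∀ v w, B v w = B w v) ∧
      ∀ v, (((A - i.1 • (1 : E →L[ℝ] E)) ^ 2 + i.2 • (1 : E →L[ℝ] E)) ^ n i) v = 0 →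
        ‖v‖ ^ 2 ≤ B (A v - g₀ • v) v ∧ ‖v‖ ^ 2 ≤ B (A v - g₁ • v) v := by
    intro i
    by_cases hi : i ∈ s
    · obtain ⟨B, hB⟩ := exists_component_form A (hnn i hi) (n i) h01 (h _ (hexp i hi))
      exact ⟨B, fun _ => hB⟩
    · exact ⟨0, fun h => absurd h hi⟩
  choose B hB using hforms
  set P : ℝ × ℝ → E →L[ℝ] E := fun i => LinearMap.toContinuousLinearMap (p i) with hP
  have hPA : ∀ i v, P i (A v) = A (P i v) := fun i v =>
    congrArg (fun L : Module.End ℝ E => L v) (hcomm i).eq.symm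
  have hPs : ∀ v, ∑ i ∈ s, P i v = v := by
    intro v
    have := congrArg (fun L : Module.End ℝ E => L v) hsum
    simpa [hP] using this
  set T : E →L[ℝ] E →L[ℝ] ℝ := ∑ i ∈ s, (B i).bilinearComp (P i) (P i) with hT
  have hTa : ∀ v w, T v w = ∑ i ∈ s, B i (P i v) (P i w) := by
    intro v w
    simp [hT]
  -- The components sum to `v`, so Cauchy–Schwarz bounds `‖v‖²` by their squares; the added `1`
  -- covers an empty sum.
  have hle : ∀ v : E, ((s.card : ℝ) + 1)⁻¹ * ‖v‖ ^ 2 ≤ ∑ i ∈ s, ‖P i v‖ ^ 2 := by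
    intro v
    have h1 : ‖v‖ ≤ ∑ i ∈ s, ‖P i v‖ := by
      conv_lhs => rw [← hPs v]
      exact norm_sum_le _ _
    have h2 : ‖v‖ ^ 2 ≤ s.card * ∑ i ∈ s, ‖P i v‖ ^ 2 :=
      (pow_le_pow_left₀ (norm_nonneg v) h1 2).trans sq_sum_le_card_mul_sum_sq
    have h3 : 0 ≤ ∑ i ∈ s, ‖P i v‖ ^ 2 := Finset.sum_nonneg fun i _ => by positivity
    rw [inv_mul_le_iff₀ (by positivity)]
    linarith
  have hkerP : ∀ i ∈ s, ∀ v,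
      (((A - i.1 • (1 : E →L[ℝ] E)) ^ 2 + i.2 • (1 : E →L[ℝ] E)) ^ n i) (P i v) = 0 := by
    intro i hi v
    rw [quadratic_pow_apply]
    exact congrArg (fun L : Module.End ℝ E => L v) (hker i hi)
  refine ⟨T, fun v w => ?_, ((s.card : ℝ) + 1)⁻¹, by positivity, fun v => ?_, fun v => ?_⟩
  · rw [hTa, hTa]
    exact Finset.sum_congr rfl fun i hi => (hB i hi).1 _ _
  · refine (hle v).trans ?_
    rw [hTa]
    refine Finset.sum_le_sum fun i hi => ?_
    rw [map_sub, map_smul, hPA]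
    exact ((hB i hi).2 _ (hkerP i hi v)).1
  · refine (hle v).trans ?_
    rw [hTa]
    refine Finset.sum_le_sum fun i hi => ?_
    rw [map_sub, map_smul, hPA]
    exact ((hB i hi).2 _ (hkerP i hi v)).2

/-- The spectral maps are grouped by exponent below `g₀` or not; by the gap the second group has
exponents above `g₁`. -/
theorem exists_splitting (A : E →L[ℝ] E) {g₀ g₁ : ℝ}
    (h : ∀ r ∈ exponents (A : Module.End ℝ E), r ∉ Icc g₀ g₁) :
    ∃ P Q : E →L[ℝ] E, (∀ v, P (A v) = A (P v)) ∧ (∀ v, Q (A v) = A (Q v)) ∧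
      (∀ v, P v + Q v = v) ∧ (∀ v, P v ∈ fwdDecay A g₀) ∧ ∀ v, Q v ∈ bwdDecay A g₁ := by
  obtain ⟨s, n, p, hexp, hnn, hcomm, hsum, hker⟩ :=
    exists_spectral_decomposition (A : Module.End ℝ E)
  have hPA : ∀ i v, p i (A v) = A (p i v) := fun i v =>
    congrArg (fun L : Module.End ℝ E => L v) (hcomm i).eq.symm
  have hmem : ∀ i ∈ s, ∀ v, p i v ∈ exponentSpace (A : Module.End ℝ E) i.1 := fun i hi v =>
    mem_exponentSpace_of_pow_eq_zero (hnn i hi) (n := n i)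
      (congrArg (fun L : Module.End ℝ E => L v) (hker i hi))
  refine ⟨LinearMap.toContinuousLinearMap (∑ i ∈ s with i.1 < g₀, p i),
    LinearMap.toContinuousLinearMap (∑ i ∈ s with ¬ i.1 < g₀, p i), fun v => ?_, fun v => ?_,
    fun v => ?_, fun v => ?_, fun v => ?_⟩
  · simp [hPA]
  · simp [hPA]
  · have := congrArg (fun L : Module.End ℝ E => L v) hsum
    rw [← Finset.sum_filter_add_sum_filter_not s (fun i => i.1 < g₀)] at this
    simpa using this
  · simp only [LinearMap.coe_toContinuousLinearMap', LinearMap.sum_apply]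
    refine Submodule.sum_mem _ fun i hi => ?_
    rw [Finset.mem_filter] at hi
    exact exponentSpace_le_fwdDecay A hi.2 (hmem i hi.1 v)
  · simp only [LinearMap.coe_toContinuousLinearMap', LinearMap.sum_apply]
    refine Submodule.sum_mem _ fun i hi => ?_
    rw [Finset.mem_filter] at hi
    refine exponentSpace_le_bwdDecay A ?_ (hmem i hi.1 v)
    by_contra hcon
    exact h _ (hexp i hi.1) ⟨not_lt.1 hi.2, not_lt.1 hcon⟩

/-- A vector that is not backward decaying is separated from the space of these vectors by the cone
of a Lyapunov form. -/
theorem exists_lyapunov_neg (A : E →L[ℝ] E) {g₀ g₁ : ℝ} (h01 : g₀ ≤ g₁)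
    (h : ∀ r ∈ exponents (A : Module.End ℝ E), r ∉ Icc g₀ g₁) {u : E} (hu : u ∉ bwdDecay A g₁) :
    ∃ B : E →L[ℝ] E →L[ℝ] ℝ, (∀ v w, B v w = B w v) ∧ B u u < 0 ∧
      ∃ c > 0, IsLyapunov B A g₀ c ∧ IsLyapunov B A g₁ c := by
  obtain ⟨B, hB, c, hc, hB0, hB1⟩ := exists_lyapunov A h01 h
  obtain ⟨P, Q, hPA, hQA, hPQ, hP, hQ⟩ := exists_splitting A h
  have hPu : P u ≠ 0 := by
    intro h0
    apply hu
    have := hPQ u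
    rw [h0, zero_add] at this
    rw [← this]
    exact hQ u
  have hneg := form_neg_of_mem_fwdDecay hB hc hB0 hPu (hP u)
  -- `B` is negative on `P u`. Since `P` and `Q` commute with `A`, the two pieces of the form can be
  -- weighted separately, and a small weight `η` on the `Q`-piece makes the value at `u` negative.
  obtain ⟨η, hη0, hη1, hη⟩ : ∃ η > 0, η ≤ 1 ∧ η * B (Q u) (Q u) + B (P u) (P u) < 0 := by
    have h1 : Tendsto (fun η : ℝ => η * B (Q u) (Q u) + B (P u) (P u)) (𝓝[>] 0)
        (𝓝 (0 * B (Q u) (Q u) + B (P u) (P u))) :=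
      ((Continuous.tendsto (by fun_prop) 0)).mono_left nhdsWithin_le_nhds
    rw [zero_mul, zero_add] at h1
    obtain ⟨η, h4, h2, h3⟩ := ((h1.eventually_lt_const hneg).and
      (Ioc_mem_nhdsGT (zero_lt_one' ℝ))).exists
    exact ⟨η, h2, h3, h4⟩
  have key : ∀ g, IsLyapunov B A g c →
      IsLyapunov (η • B.bilinearComp Q Q + B.bilinearComp P P) A g (c * η / 2) := by
    intro g hg v
    have h1 := hg (Q v)
    have h2 := hg (P v)
    have h3 : ‖v‖ ^ 2 ≤ 2 * (‖Q v‖ ^ 2 + ‖P v‖ ^ 2) := by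
      have : ‖v‖ ≤ ‖P v‖ + ‖Q v‖ := by
        conv_lhs => rw [← hPQ v]
        exact norm_add_le _ _
      nlinarith [norm_nonneg v, sq_nonneg (‖P v‖ - ‖Q v‖)]
    have h7 : (η • B.bilinearComp Q Q + B.bilinearComp P P) (A v - g • v) v =
        η * B (A (Q v) - g • Q v) (Q v) + B (A (P v) - g • P v) (P v) := by
      have e1 : Q (A v - g • v) = A (Q v) - g • Q v := by rw [map_sub, map_smul, hQA]
      have e2 : P (A v - g • v) = A (P v) - g • P v := by rw [map_sub, map_smul, hPA]
      rw [← e1, ← e2]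
      rfl
    rw [h7]
    have h4 : c * η / 2 * ‖v‖ ^ 2 ≤ c * η / 2 * (2 * (‖Q v‖ ^ 2 + ‖P v‖ ^ 2)) := by gcongr
    have h5 := mul_le_mul_of_nonneg_left h1 hη0.le
    have h6 : c * η * ‖P v‖ ^ 2 ≤ c * 1 * ‖P v‖ ^ 2 := by gcongr
    linarith
  refine ⟨η • B.bilinearComp Q Q + B.bilinearComp P P, fun v w => ?_, ?_, c * η / 2,
    by positivity, key _ hB0, key _ hB1⟩
  · simp [hB (Q v) (Q w), hB (P v) (P w)]
  · simpa using hη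

/-- A Lyapunov form is negative on nonzero vectors of the first space and positive on those of the
second. -/
theorem disjoint_decay (A : E →L[ℝ] E) {g₀ g₁ : ℝ} (h01 : g₀ ≤ g₁)
    (h : ∀ r ∈ exponents (A : Module.End ℝ E), r ∉ Icc g₀ g₁) :
    Disjoint (fwdDecay A g₁) (bwdDecay A g₀) := by
  obtain ⟨B, hB, c, hc, hB0, hB1⟩ := exists_lyapunov A h01 h
  rw [Submodule.disjoint_def]
  intro v h1 h2
  by_contra hv
  have := form_neg_of_mem_fwdDecay hB hc hB1 hv h1
  have := form_pos_of_mem_bwdDecay hB hc hB0 hv h2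
  linarith

end Decay


variable {E M : Type*} [NormedAddCommGroup E] [NormedSpace ℝ E] [FiniteDimensional ℝ E]
  [TopologicalSpace M] [ChartedSpace E M] [IsManifold 𝓘(ℝ, E) ∞ M]

/-! ### Vector fields in charts -/

omit [FiniteDimensional ℝ E] in
theorem localRep_extChartAt (X : VField E M) {x₀ x : M} (hx : x ∈ (extChartAt 𝓘(ℝ, E) x₀).source) :
    localRep X x₀ (extChartAt 𝓘(ℝ, E) x₀ x) = tangentCoordChange 𝓘(ℝ, E) x x₀ x (X x) := by
  rw [localRep, (extChartAt 𝓘(ℝ, E) x₀).left_inv hx]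
  rfl

omit [FiniteDimensional ℝ E] in
theorem localRep_self (X : VField E M) (x : M) :
    localRep X x (extChartAt 𝓘(ℝ, E) x x) = X x := by
  rw [localRep_extChartAt X (mem_extChartAt_source x)]
  exact tangentCoordChange_self (mem_extChartAt_source x)

omit [FiniteDimensional ℝ E] in
theorem tangentCoordChange_injective {x y z : M}
    (h : z ∈ (extChartAt 𝓘(ℝ, E) x).source ∩ (extChartAt 𝓘(ℝ, E) y).source) :
    Function.Injective (tangentCoordChange 𝓘(ℝ, E) x y z) := by
  intro v w hvw
  have := congrArg (tangentCoordChange 𝓘(ℝ, E) y x z) hvw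
  rwa [tangentCoordChange_comp ⟨h, h.1⟩, tangentCoordChange_comp ⟨h, h.1⟩,
    tangentCoordChange_self h.1, tangentCoordChange_self h.1] at this

omit [FiniteDimensional ℝ E] in
theorem localRep_extChartAt_eq_zero_iff (X : VField E M) {x₀ x : M}
    (hx : x ∈ (extChartAt 𝓘(ℝ, E) x₀).source) :
    localRep X x₀ (extChartAt 𝓘(ℝ, E) x₀ x) = 0 ↔ X x = 0 := by
  rw [localRep_extChartAt X hx]
  constructor
  · intro h
    exact tangentCoordChange_injective ⟨mem_extChartAt_source x, hx⟩ (h.trans (map_zero _).symm)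
  · intro h
    rw [h]
    exact map_zero (tangentCoordChange 𝓘(ℝ, E) x x₀ x)

omit [FiniteDimensional ℝ E] in
theorem contDiffOn_localRep (X : VField E M) (x₀ : M) :
    ContDiffOn ℝ 1 (localRep X x₀) (extChartAt 𝓘(ℝ, E) x₀).target := by
  have h1 : ContMDiffOn 𝓘(ℝ, E) 𝓘(ℝ, E) 1
      (fun x => (trivializationAt E (TangentSpace 𝓘(ℝ, E)) x₀ ⟨x, X x⟩).2)
      (extChartAt 𝓘(ℝ, E) x₀).source := by
    have := ((trivializationAt E (TangentSpace 𝓘(ℝ, E) : M → Type _)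
      x₀).contMDiffOn_section_baseSet_iff (IB := 𝓘(ℝ, E)) (n := 1) (s := fun x => X x)).1
      X.contMDiff.contMDiffOn
    rwa [extChartAt_source]
  have h2 : ContMDiffOn 𝓘(ℝ, E) 𝓘(ℝ, E) 1 (extChartAt 𝓘(ℝ, E) x₀).symm
      (extChartAt 𝓘(ℝ, E) x₀).target := contMDiffOn_extChartAt_symm x₀
  have h3 := h1.comp h2 (fun z hz => (extChartAt 𝓘(ℝ, E) x₀).map_target hz)
  exact contMDiffOn_iff_contDiffOn.1 h3

omit [FiniteDimensional ℝ E] [IsManifold 𝓘(ℝ, E) ∞ M] in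
theorem isOpen_chart_target (x₀ : M) : IsOpen (extChartAt 𝓘(ℝ, E) x₀).target :=
  isOpen_extChartAt_target x₀

omit [FiniteDimensional ℝ E] in
theorem contDiffAt_localRep (X : VField E M) {x₀ : M} {z : E}
    (hz : z ∈ (extChartAt 𝓘(ℝ, E) x₀).target) : ContDiffAt ℝ 1 (localRep X x₀) z :=
  (contDiffOn_localRep X x₀).contDiffAt ((isOpen_chart_target x₀).mem_nhds hz)

omit [FiniteDimensional ℝ E] in
theorem continuousOn_fderiv_localRep (X : VField E M) (x₀ : M) :
    ContinuousOn (fderiv ℝ (localRep X x₀)) (extChartAt 𝓘(ℝ, E) x₀).target :=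
  (contDiffOn_localRep X x₀).continuousOn_fderiv_of_isOpen (isOpen_chart_target x₀) le_rfl

omit [FiniteDimensional ℝ E] in
theorem localRep_neg (X : VField E M) (x₀ : M) {z : E}
    (hz : z ∈ (extChartAt 𝓘(ℝ, E) x₀).target) : localRep (-X) x₀ z = -localRep X x₀ z := by
  have hs := (extChartAt 𝓘(ℝ, E) x₀).map_target hz
  have h1 := localRep_extChartAt X hs
  have h2 := localRep_extChartAt (-X) hs
  rw [(extChartAt 𝓘(ℝ, E) x₀).right_inv hz] at h1 h2
  rw [h1, h2, ContMDiffSection.coe_neg, Pi.neg_apply]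
  exact map_neg (tangentCoordChange 𝓘(ℝ, E) _ x₀ _) _

omit [FiniteDimensional ℝ E] in
theorem fderiv_localRep_neg (X : VField E M) (x₀ : M) {z : E}
    (hz : z ∈ (extChartAt 𝓘(ℝ, E) x₀).target) :
    fderiv ℝ (localRep (-X) x₀) z = -fderiv ℝ (localRep X x₀) z := by
  have : localRep (-X) x₀ =ᶠ[𝓝 z] -localRep X x₀ := by
    filter_upwards [(isOpen_chart_target x₀).mem_nhds hz] with w hw
    exact localRep_neg X x₀ hw
  rw [this.fderiv_eq, fderiv_neg]

omit [FiniteDimensional ℝ E] in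
theorem hasDerivAt_chart_comp {γ : ℝ → M} {t : ℝ} {v : TangentSpace 𝓘(ℝ, E) (γ t)}
    (hγ : HasMFDerivAt 𝓘(ℝ, ℝ) 𝓘(ℝ, E) γ t ((1 : ℝ →L[ℝ] ℝ).smulRight v)) {x₀ : M}
    (h : γ t ∈ (extChartAt 𝓘(ℝ, E) x₀).source) :
    HasDerivAt (fun s => extChartAt 𝓘(ℝ, E) x₀ (γ s))
      (tangentCoordChange 𝓘(ℝ, E) (γ t) x₀ (γ t) v) t := by
  rw [extChartAt_source] at h
  have h1 := HasMFDerivAt.comp t (hasMFDerivAt_extChartAt (I := 𝓘(ℝ, E)) h) hγ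
  rw [mfderiv_chartAt_eq_tangentCoordChange h] at h1
  have h2 : HasFDerivAt (fun s => extChartAt 𝓘(ℝ, E) x₀ (γ s))
      ((tangentCoordChange 𝓘(ℝ, E) (γ t) x₀ (γ t)).comp
        ((1 : ℝ →L[ℝ] ℝ).smulRight (v : E))) t := hasMFDerivAt_iff_hasFDerivAt.1 h1
  refine h2.hasDerivAt.congr_deriv ?_
  exact congrArg (tangentCoordChange 𝓘(ℝ, E) (γ t) x₀ (γ t)) (one_smul ℝ (show E from v))

/-! ### The `C¹` topology -/

omit [FiniteDimensional ℝ E] in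
theorem eventually_localRep_close (X : VField E M) (x₀ : M) {K : Set E} (hK : IsCompact K)
    (hKt : K ⊆ (extChartAt 𝓘(ℝ, E) x₀).target) {ε : ℝ} (hε : 0 < ε) :
    ∀ᶠ Y in 𝓝 X, ∀ z ∈ K, ‖localRep Y x₀ z - localRep X x₀ z‖ < ε ∧
      ‖fderiv ℝ (localRep Y x₀) z - fderiv ℝ (localRep X x₀) z‖ < ε := by
  have hc : Continuous (fun X : VField E M =>
      ((UniformOnFun.ofFun (chartCompacts E x₀) (localRep X x₀) : E →ᵤ[chartCompacts E x₀] E),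
       (UniformOnFun.ofFun (chartCompacts E x₀) (fderiv ℝ (localRep X x₀)) :
          E →ᵤ[chartCompacts E x₀] (E →L[ℝ] E)))) :=
    continuous_iff_le_induced.2 (iInf_le _ x₀)
  have hmem : K ∈ chartCompacts E x₀ := ⟨hK, hKt⟩
  have h1 := (hc.fst.tendsto X) (UniformOnFun.gen_mem_nhds _ _ _ hmem
    (Metric.dist_mem_uniformity hε))
  have h2 := (hc.snd.tendsto X) (UniformOnFun.gen_mem_nhds _ _ _ hmem
    (Metric.dist_mem_uniformity hε))
  filter_upwards [h1, h2] with Y hY1 hY2 z hz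
  have e1 := hY1 z hz
  have e2 := hY2 z hz
  simp only [UniformOnFun.toFun_ofFun] at e1 e2
  rw [dist_comm, dist_eq_norm] at e1 e2
  exact ⟨e1, e2⟩

omit [FiniteDimensional ℝ E] in
-- Needed for time reversal: statements on unstable directions and negative times for fields near
-- `X` are obtained from fields near `-X`.
theorem continuous_neg_vField : Continuous fun X : VField E M => -X := by
  refine continuous_iInf_rng.2 fun x₀ => continuous_induced_rng.2 ?_
  refine continuous_iff_continuousAt.2 fun X => ?_
  refine ContinuousAt.prodMk ?_ ?_
  · rw [ContinuousAt, UniformOnFun.tendsto_iff_tendstoUniformlyOn]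
    rintro K ⟨hK, hKt⟩
    rw [Metric.tendstoUniformlyOn_iff]
    intro ε hε
    filter_upwards [eventually_localRep_close X x₀ hK hKt hε] with Y hY z hz
    simp only [Function.comp, UniformOnFun.toFun_ofFun]
    rw [localRep_neg X x₀ (hKt hz), localRep_neg Y x₀ (hKt hz), dist_neg_neg, dist_comm,
      dist_eq_norm]
    exact (hY z hz).1
  · rw [ContinuousAt, UniformOnFun.tendsto_iff_tendstoUniformlyOn]
    rintro K ⟨hK, hKt⟩
    rw [Metric.tendstoUniformlyOn_iff]
    intro ε hε
    filter_upwards [eventually_localRep_close X x₀ hK hKt hε] with Y hY z hz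
    simp only [Function.comp, UniformOnFun.toFun_ofFun]
    rw [fderiv_localRep_neg X x₀ (hKt hz), fderiv_localRep_neg Y x₀ (hKt hz), dist_neg_neg,
      dist_comm, dist_eq_norm]
    exact (hY z hz).2

/-- The chart expression of a vector field depends continuously on the field and on the point. -/
theorem continuousAt_localRep (X : VField E M) (x₀ : M) {z : E}
    (hz : z ∈ (extChartAt 𝓘(ℝ, E) x₀).target) :
    ContinuousAt (fun p : VField E M × E => localRep p.1 x₀ p.2) (X, z) := by
  have : ProperSpace E := FiniteDimensional.proper_real E
  obtain ⟨ρ, hρ, hball⟩ := Metric.nhds_basis_closedBall.mem_iff.1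
    ((isOpen_chart_target x₀).mem_nhds hz)
  rw [Metric.continuousAt_iff']
  intro ε hε
  have h1 := eventually_localRep_close X x₀ (isCompact_closedBall z ρ) hball (half_pos hε)
  have h2 : ∀ᶠ w in 𝓝 z, dist (localRep X x₀ w) (localRep X x₀ z) < ε / 2 :=
    Metric.continuousAt_iff'.1 (contDiffAt_localRep X hz).continuousAt _ (half_pos hε)
  filter_upwards [h1.prod_nhds (h2.and (Metric.closedBall_mem_nhds z hρ))] with p hp
  have h3 := (hp.1 p.2 hp.2.2).1
  rw [← dist_eq_norm] at h3
  calc dist (localRep p.1 x₀ p.2) (localRep X x₀ z)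
      ≤ dist (localRep p.1 x₀ p.2) (localRep X x₀ p.2) +
        dist (localRep X x₀ p.2) (localRep X x₀ z) := dist_triangle _ _ _
    _ < ε := by linarith [hp.2.1]

/-! ### The flow -/

section Flow

variable [CompactSpace M] [T2Space M]

theorem continuous_flow_time (X : VField E M) (x : M) : Continuous fun t => flow X t x :=
  (isMIntegralCurve_flow X x).continuous

theorem eq_flow_of_isMIntegralCurve (X : VField E M) {γ : ℝ → M}
    (hγ : IsMIntegralCurve (I := 𝓘(ℝ, E)) γ (fun y => X y)) (t : ℝ) : γ t = flow X t (γ 0) := by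
  have : CompleteSpace E := FiniteDimensional.complete ℝ E
  exact congrFun (isMIntegralCurve_Ioo_eq_of_contMDiff_boundaryless (t₀ := 0) X.contMDiff hγ
    (isMIntegralCurve_flow X (γ 0)) (flow_zero X _).symm) t

theorem flow_add (X : VField E M) (s t : ℝ) (x : M) :
    flow X (s + t) x = flow X s (flow X t x) := by
  have := eq_flow_of_isMIntegralCurve X ((isMIntegralCurve_flow X x).comp_add t) s
  simpa using this

theorem flow_neg_flow (X : VField E M) (t : ℝ) (x : M) : flow X (-t) (flow X t x) = x := by
  rw [← flow_add, neg_add_cancel, flow_zero]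

theorem flow_flow_neg (X : VField E M) (t : ℝ) (x : M) : flow X t (flow X (-t) x) = x := by
  rw [← flow_add, add_neg_cancel, flow_zero]

theorem flow_neg_vField (X : VField E M) (t : ℝ) (x : M) : flow (-X) t x = flow X (-t) x := by
  have h := (isMIntegralCurve_flow X x).comp_mul (-1)
  have h' : IsMIntegralCurve (I := 𝓘(ℝ, E)) ((fun t => flow X t x) ∘ (· * (-1)))
      (fun y => (-X) y) := by
    convert h using 1
    ext y
    simp
  have := eq_flow_of_isMIntegralCurve (-X) h' t
  simpa [flow_zero] using this.symm

theorem flow_of_eq_zero (X : VField E M) {x : M} (hx : X x = 0) (t : ℝ) : flow X t x = x :=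
  (eq_flow_of_isMIntegralCurve X (isMIntegralCurve_const (I := 𝓘(ℝ, E)) (v := fun y => X y) hx)
    t).symm

theorem flow_ne_zero (X : VField E M) {x : M} (hx : X x ≠ 0) (t : ℝ) : X (flow X t x) ≠ 0 := by
  intro h
  have h1 := flow_of_eq_zero X h (-t)
  rw [flow_neg_flow] at h1
  rw [← h1] at h
  exact hx h

theorem mem_maximalInvariantSet {X : VField E M} {U : Set M} {x : M} :
    x ∈ maximalInvariantSet X U ↔ ∀ t, flow X t x ∈ U := by
  simp only [maximalInvariantSet, mem_iInter, mem_image]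
  constructor
  · intro h t
    obtain ⟨y, hy, rfl⟩ := h (-t)
    rwa [flow_flow_neg]
  · intro h t
    exact ⟨flow X (-t) x, h _, flow_flow_neg X t x⟩

theorem flow_mem_maximalInvariantSet {X : VField E M} {U : Set M} {x : M}
    (h : x ∈ maximalInvariantSet X U) (s : ℝ) : flow X s x ∈ maximalInvariantSet X U := by
  rw [mem_maximalInvariantSet] at *
  intro t
  rw [← flow_add]
  exact h _

theorem maximalInvariantSet_neg (X : VField E M) (U : Set M) :
    maximalInvariantSet (-X) U = maximalInvariantSet X U := by
  ext x
  simp only [mem_maximalInvariantSet, flow_neg_vField]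
  exact ⟨fun h t => by simpa using h (-t), fun h t => h _⟩

theorem sing_mem_maximalInvariantSet {X : VField E M} {U : Set M} {x : M} (hx : X x = 0)
    (hU : x ∈ U) : x ∈ maximalInvariantSet X U :=
  mem_maximalInvariantSet.2 fun t => by rwa [flow_of_eq_zero X hx]

/-- In a chart the orbits are solutions of the differential equation of the chart expression. -/
theorem hasDerivAt_chart_flow (X : VField E M) {x₀ x : M} {t : ℝ}
    (h : flow X t x ∈ (extChartAt 𝓘(ℝ, E) x₀).source) :
    HasDerivAt (fun s => extChartAt 𝓘(ℝ, E) x₀ (flow X s x))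
      (localRep X x₀ (extChartAt 𝓘(ℝ, E) x₀ (flow X t x))) t := by
  rw [localRep_extChartAt X h]
  exact hasDerivAt_chart_comp (isMIntegralCurve_flow X x t) h

/-- Along an orbit in a chart, the vector field solves the variational equation. -/
theorem hasDerivAt_localRep_flow (X : VField E M) {x₀ x : M} {t : ℝ}
    (h : flow X t x ∈ (extChartAt 𝓘(ℝ, E) x₀).source) :
    HasDerivAt (fun s => localRep X x₀ (extChartAt 𝓘(ℝ, E) x₀ (flow X s x)))
      (fderiv ℝ (localRep X x₀) (extChartAt 𝓘(ℝ, E) x₀ (flow X t x))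
        (localRep X x₀ (extChartAt 𝓘(ℝ, E) x₀ (flow X t x)))) t := by
  have h1 := (contDiffAt_localRep X ((extChartAt 𝓘(ℝ, E) x₀).map_source h)).differentiableAt
    one_ne_zero
  exact h1.hasFDerivAt.comp_hasDerivAt t (hasDerivAt_chart_flow X h)

end Flow


variable {E M : Type*} [NormedAddCommGroup E] [NormedSpace ℝ E] [FiniteDimensional ℝ E]
  [TopologicalSpace M] [ChartedSpace E M] [IsManifold 𝓘(ℝ, E) ∞ M]

/-! ### Balls in charts -/

section ChartBall

variable (E) in
/-- The open ball of radius `ρ` in the chart at `x₀`. -/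
def chartBall (x₀ : M) (ρ : ℝ) : Set M :=
  {x | x ∈ (extChartAt 𝓘(ℝ, E) x₀).source ∧
    extChartAt 𝓘(ℝ, E) x₀ x ∈ Metric.ball (extChartAt 𝓘(ℝ, E) x₀ x₀) ρ}

variable (E) in
/-- The closed ball of radius `ρ` in the chart at `x₀`. -/
def chartClosedBall (x₀ : M) (ρ : ℝ) : Set M :=
  {x | x ∈ (extChartAt 𝓘(ℝ, E) x₀).source ∧
    extChartAt 𝓘(ℝ, E) x₀ x ∈ Metric.closedBall (extChartAt 𝓘(ℝ, E) x₀ x₀) ρ}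

variable (E) in
/-- The sphere of radius `ρ` in the chart at `x₀`. -/
def chartSphere (x₀ : M) (ρ : ℝ) : Set M :=
  {x | x ∈ (extChartAt 𝓘(ℝ, E) x₀).source ∧
    extChartAt 𝓘(ℝ, E) x₀ x ∈ Metric.sphere (extChartAt 𝓘(ℝ, E) x₀ x₀) ρ}

omit [FiniteDimensional ℝ E] [IsManifold 𝓘(ℝ, E) ∞ M] in
theorem chartBall_subset_closedBall (x₀ : M) (ρ : ℝ) : chartBall E x₀ ρ ⊆ chartClosedBall E x₀ ρ :=
  fun _ hx => ⟨hx.1, Metric.ball_subset_closedBall hx.2⟩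

omit [FiniteDimensional ℝ E] [IsManifold 𝓘(ℝ, E) ∞ M] in
theorem chartBall_mono (x₀ : M) {ρ ρ' : ℝ} (h : ρ ≤ ρ') : chartBall E x₀ ρ ⊆ chartBall E x₀ ρ' :=
  fun _ hx => ⟨hx.1, Metric.ball_subset_ball h hx.2⟩

omit [FiniteDimensional ℝ E] [IsManifold 𝓘(ℝ, E) ∞ M] in
theorem isOpen_chartBall (x₀ : M) (ρ : ℝ) : IsOpen (chartBall E x₀ ρ) :=
  (continuousOn_extChartAt x₀).isOpen_inter_preimage (isOpen_extChartAt_source x₀)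
    Metric.isOpen_ball

omit [FiniteDimensional ℝ E] [IsManifold 𝓘(ℝ, E) ∞ M] in
theorem mem_chartBall_self (x₀ : M) {ρ : ℝ} (h : 0 < ρ) : x₀ ∈ chartBall E x₀ ρ :=
  ⟨mem_extChartAt_source x₀, Metric.mem_ball_self h⟩

omit [FiniteDimensional ℝ E] [IsManifold 𝓘(ℝ, E) ∞ M] in
theorem isCompact_setOf_chart_mem {x₀ : M} {K : Set E} (hK : IsCompact K)
    (hKt : K ⊆ (extChartAt 𝓘(ℝ, E) x₀).target) :
    IsCompact {x | x ∈ (extChartAt 𝓘(ℝ, E) x₀).source ∧ extChartAt 𝓘(ℝ, E) x₀ x ∈ K} := by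
  have : {x | x ∈ (extChartAt 𝓘(ℝ, E) x₀).source ∧ extChartAt 𝓘(ℝ, E) x₀ x ∈ K} =
      (extChartAt 𝓘(ℝ, E) x₀).symm '' K := by
    ext x
    constructor
    · rintro ⟨h1, h2⟩
      exact ⟨_, h2, (extChartAt 𝓘(ℝ, E) x₀).left_inv h1⟩
    · rintro ⟨z, hz, rfl⟩
      refine ⟨(extChartAt 𝓘(ℝ, E) x₀).map_target (hKt hz), ?_⟩
      rwa [(extChartAt 𝓘(ℝ, E) x₀).right_inv (hKt hz)]
  rw [this]
  exact hK.image_of_continuousOn ((continuousOn_extChartAt_symm x₀).mono hKt)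

omit [FiniteDimensional ℝ E] [IsManifold 𝓘(ℝ, E) ∞ M] in
theorem exists_chart_radius (x₀ : M) :
    ∃ ρ > 0, Metric.closedBall (extChartAt 𝓘(ℝ, E) x₀ x₀) ρ ⊆ (extChartAt 𝓘(ℝ, E) x₀).target :=
  Metric.nhds_basis_closedBall.mem_iff.1
    ((isOpen_extChartAt_target x₀).mem_nhds (mem_extChartAt_target x₀))

omit [FiniteDimensional ℝ E] [IsManifold 𝓘(ℝ, E) ∞ M] in
theorem exists_chartBall_subset (x₀ : M) {W : Set M} (hW : W ∈ 𝓝 x₀) :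
    ∃ ρ > 0, Metric.closedBall (extChartAt 𝓘(ℝ, E) x₀ x₀) ρ ⊆ (extChartAt 𝓘(ℝ, E) x₀).target ∧
      chartBall E x₀ ρ ⊆ W := by
  obtain ⟨ρ₁, hρ₁, h1⟩ := exists_chart_radius (E := E) x₀
  have h2 : (extChartAt 𝓘(ℝ, E) x₀).symm ⁻¹' W ∈ 𝓝 (extChartAt 𝓘(ℝ, E) x₀ x₀) := by
    have := continuousAt_extChartAt_symm (I := 𝓘(ℝ, E)) x₀
    refine this ?_
    rwa [(extChartAt 𝓘(ℝ, E) x₀).left_inv (mem_extChartAt_source x₀)]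
  obtain ⟨ρ₂, hρ₂, h3⟩ := Metric.mem_nhds_iff.1 h2
  refine ⟨min ρ₁ ρ₂, lt_min hρ₁ hρ₂, (Metric.closedBall_subset_closedBall (min_le_left _ _)).trans
    h1, fun x hx => ?_⟩
  have := h3 (Metric.ball_subset_ball (min_le_right _ _) hx.2)
  rwa [mem_preimage, (extChartAt 𝓘(ℝ, E) x₀).left_inv hx.1] at this

omit [IsManifold 𝓘(ℝ, E) ∞ M] in
/-- A curve that leaves a chart ball crosses the chart sphere, and stays inside until then. -/
theorem exists_first_exit [T2Space M] {x₀ : M} {ρ : ℝ}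
    (hρ : Metric.closedBall (extChartAt 𝓘(ℝ, E) x₀ x₀) ρ ⊆ (extChartAt 𝓘(ℝ, E) x₀).target)
    {γ : ℝ → M} (hγ : Continuous γ) (h0 : γ 0 ∈ chartBall E x₀ ρ) {t : ℝ} (ht : 0 ≤ t)
    (hout : γ t ∉ chartBall E x₀ ρ) :
    ∃ T, 0 < T ∧ T ≤ t ∧ γ T ∈ chartSphere E x₀ ρ ∧
      ∀ s ∈ Icc 0 T, γ s ∈ chartClosedBall E x₀ ρ := by
  have : ProperSpace E := FiniteDimensional.proper_real E
  set S := Ici (0 : ℝ) ∩ γ ⁻¹' (chartBall E x₀ ρ)ᶜ with hS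
  have hSc : IsClosed S := isClosed_Ici.inter ((isOpen_chartBall x₀ ρ).isClosed_compl.preimage hγ)
  have hSne : S.Nonempty := ⟨t, ht, hout⟩
  have hSb : BddBelow S := ⟨0, fun s hs => hs.1⟩
  have hT := hSc.csInf_mem hSne hSb
  set T := sInf S with hTdef
  have hT0 : 0 < T := by
    refine lt_of_le_of_ne hT.1 fun h => hT.2 ?_
    rw [← h]; exact h0
  have hin : ∀ s, 0 ≤ s → s < T → γ s ∈ chartBall E x₀ ρ := by
    intro s hs hsT
    by_contra hcon
    exact absurd (csInf_le hSb (show s ∈ S from ⟨hs, hcon⟩)) (not_le.2 hsT)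
  have hcl : IsClosed (chartClosedBall E x₀ ρ) :=
    (isCompact_setOf_chart_mem (isCompact_closedBall _ ρ) hρ).isClosed
  have hTcl : γ T ∈ chartClosedBall E x₀ ρ := by
    have h1 : T ∈ closure (Ico 0 T) := by
      rw [closure_Ico hT0.ne]; exact right_mem_Icc.2 hT0.le
    have h2 := map_mem_closure hγ h1 (t := chartClosedBall E x₀ ρ)
      (fun s hs => chartBall_subset_closedBall x₀ ρ (hin s hs.1 hs.2))
    rwa [hcl.closure_eq] at h2
  refine ⟨T, hT0, csInf_le hSb ⟨ht, hout⟩, ⟨hTcl.1, ?_⟩, fun s hs => ?_⟩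
  · rw [Metric.mem_sphere]
    refine le_antisymm hTcl.2 (not_lt.1 fun h => hT.2 ⟨hTcl.1, h⟩)
  · rcases hs.2.eq_or_lt with h | h
    · rw [h]; exact hTcl
    · exact chartBall_subset_closedBall x₀ ρ (hin s hs.1 h)

end ChartBall

/-! ### Continuity of the flow -/

section Flow

variable [CompactSpace M] [T2Space M]

/-- The speed in the chart is at most `C`, so going from radius less than `ρ/2` to radius `ρ` takes
time more than `ρ/(2C)`. -/
theorem flow_mem_chartBall_of_nonneg (Y : VField E M) {x₀ : M} {ρ C : ℝ}
    (hρ : Metric.closedBall (extChartAt 𝓘(ℝ, E) x₀ x₀) ρ ⊆ (extChartAt 𝓘(ℝ, E) x₀).target)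
    (hC : ∀ z ∈ Metric.closedBall (extChartAt 𝓘(ℝ, E) x₀ x₀) ρ, ‖localRep Y x₀ z‖ ≤ C)
    {y : M} (hy : y ∈ chartBall E x₀ (ρ / 2)) {t : ℝ} (ht : 0 ≤ t) (htC : t * C < ρ / 2) :
    flow Y t y ∈ chartBall E x₀ ρ := by
  by_contra hout
  have hρ0 : 0 < ρ := by
    have := dist_nonneg.trans_lt (Metric.mem_ball.1 hy.2)
    linarith
  have hy0 : flow Y 0 y ∈ chartBall E x₀ ρ := by
    rw [flow_zero]; exact chartBall_mono x₀ (by linarith) hy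
  obtain ⟨T, hT0, hTt, hTs, hTc⟩ := exists_first_exit hρ (continuous_flow_time Y y) hy0 ht hout
  have hC0 : 0 ≤ C := (norm_nonneg _).trans (hC _ (hTc 0 ⟨le_rfl, hT0.le⟩).2)
  have h1 : ‖extChartAt 𝓘(ℝ, E) x₀ (flow Y T y) - extChartAt 𝓘(ℝ, E) x₀ (flow Y 0 y)‖ ≤
      C * (T - 0) := by
    refine norm_image_sub_le_of_norm_deriv_le_segment' (f := fun s =>
      extChartAt 𝓘(ℝ, E) x₀ (flow Y s y)) (a := 0) (b := T)
      (fun s hs => (hasDerivAt_chart_flow Y (hTc s hs).1).hasDerivWithinAt)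
      (fun s hs => hC _ (hTc s (Ico_subset_Icc_self hs)).2) T ⟨hT0.le, le_rfl⟩
  rw [flow_zero, ← dist_eq_norm] at h1
  have h2 := Metric.mem_sphere.1 hTs.2
  have h3 := Metric.mem_ball.1 hy.2
  have h4 := dist_triangle (extChartAt 𝓘(ℝ, E) x₀ (flow Y T y)) (extChartAt 𝓘(ℝ, E) x₀ y)
    (extChartAt 𝓘(ℝ, E) x₀ x₀)
  have h5 : C * (T - 0) ≤ t * C := by nlinarith
  linarith

theorem flow_mem_chartBall (Y : VField E M) {x₀ : M} {ρ C : ℝ}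
    (hρ : Metric.closedBall (extChartAt 𝓘(ℝ, E) x₀ x₀) ρ ⊆ (extChartAt 𝓘(ℝ, E) x₀).target)
    (hC : ∀ z ∈ Metric.closedBall (extChartAt 𝓘(ℝ, E) x₀ x₀) ρ, ‖localRep Y x₀ z‖ ≤ C)
    {y : M} (hy : y ∈ chartBall E x₀ (ρ / 2)) {t : ℝ} (htC : |t| * C < ρ / 2) :
    flow Y t y ∈ chartBall E x₀ ρ := by
  rcases le_total 0 t with ht | ht
  · rw [abs_of_nonneg ht] at htC
    exact flow_mem_chartBall_of_nonneg Y hρ hC hy ht htC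
  · rw [abs_of_nonpos ht] at htC
    have := flow_mem_chartBall_of_nonneg (-Y) (t := -t) hρ (fun z hz => by
      rw [localRep_neg Y x₀ (hρ hz), norm_neg]; exact hC z hz) hy (by linarith) htC
    rwa [flow_neg_vField, neg_neg] at this

omit [FiniteDimensional ℝ E] [CompactSpace M] [T2Space M] in
theorem exists_localRep_bound (X : VField E M) {x₀ : M} {K : Set E} (hK : IsCompact K)
    (hKt : K ⊆ (extChartAt 𝓘(ℝ, E) x₀).target) :
    ∃ C > 0, (∀ z ∈ K, ‖localRep X x₀ z‖ ≤ C ∧ ‖fderiv ℝ (localRep X x₀) z‖ ≤ C) ∧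
      ∀ᶠ Y in 𝓝 X, ∀ z ∈ K, ‖localRep Y x₀ z‖ ≤ C := by
  obtain ⟨C₁, hC₁⟩ := hK.exists_bound_of_continuousOn
    ((contDiffOn_localRep X x₀).continuousOn.mono hKt)
  obtain ⟨C₂, hC₂⟩ := hK.exists_bound_of_continuousOn
    ((continuousOn_fderiv_localRep X x₀).mono hKt)
  refine ⟨|C₁| + |C₂| + 1, by positivity, fun z hz => ⟨?_, ?_⟩, ?_⟩
  · linarith [hC₁ z hz, le_abs_self C₁, abs_nonneg C₂]
  · linarith [hC₂ z hz, le_abs_self C₂, abs_nonneg C₁]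
  · filter_upwards [eventually_localRep_close X x₀ hK hKt one_pos] with Y hY z hz
    have h1 := (hY z hz).1
    have h2 := norm_le_insert' (localRep Y x₀ z) (localRep X x₀ z)
    linarith [hC₁ z hz, le_abs_self C₁, abs_nonneg C₂]

theorem eventually_flow_mem_of_nhds (X : VField E M) (x₀ : M) {W : Set M} (hW : W ∈ 𝓝 x₀) :
    ∀ᶠ p : VField E M × ℝ × M in 𝓝 (X, 0, x₀), flow p.1 p.2.1 p.2.2 ∈ W := by
  have : ProperSpace E := FiniteDimensional.proper_real E
  obtain ⟨ρ, hρ0, hρ, hsub⟩ := exists_chartBall_subset (E := E) x₀ hW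
  obtain ⟨C, hC0, -, hC⟩ := exists_localRep_bound X (isCompact_closedBall _ ρ) hρ
  have h1 : ∀ᶠ t : ℝ in 𝓝 0, |t| * C < ρ / 2 := by
    have : Tendsto (fun t : ℝ => |t| * C) (𝓝 0) (𝓝 (|0| * C)) :=
      Continuous.tendsto (by fun_prop) 0
    rw [abs_zero, zero_mul] at this
    exact this.eventually_lt_const (by positivity)
  have h2 : ∀ᶠ y in 𝓝 x₀, y ∈ chartBall E x₀ (ρ / 2) :=
    (isOpen_chartBall x₀ _).mem_nhds (mem_chartBall_self x₀ (by positivity))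
  filter_upwards [hC.prod_nhds (h1.prod_nhds h2)] with p hp
  exact hsub (flow_mem_chartBall p.1 hρ hp.1 hp.2.2 hp.2.1)

omit [FiniteDimensional ℝ E] [CompactSpace M] [T2Space M] in
theorem lipschitzOnWith_localRep (X : VField E M) {x₀ : M} {ρ C : ℝ} (hC0 : 0 ≤ C)
    (hρ : Metric.closedBall (extChartAt 𝓘(ℝ, E) x₀ x₀) ρ ⊆ (extChartAt 𝓘(ℝ, E) x₀).target)
    (hC : ∀ z ∈ Metric.closedBall (extChartAt 𝓘(ℝ, E) x₀ x₀) ρ,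
      ‖fderiv ℝ (localRep X x₀) z‖ ≤ C) :
    LipschitzOnWith C.toNNReal (localRep X x₀)
      (Metric.closedBall (extChartAt 𝓘(ℝ, E) x₀ x₀) ρ) := by
  refine (convex_closedBall _ _).lipschitzOnWith_of_nnnorm_fderiv_le
    (fun z hz => (contDiffAt_localRep X (hρ hz)).differentiableAt one_ne_zero) fun z hz => ?_
  rw [← NNReal.coe_le_coe, Real.coe_toNNReal _ hC0]
  exact hC z hz

theorem gronwallBound_diag {K : ℝ} (hK : K ≠ 0) (η t : ℝ) :
    gronwallBound η K η t = η * gronwallBound 1 K 1 t := by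
  rw [gronwallBound_of_K_ne_0 hK, gronwallBound_of_K_ne_0 hK]
  ring

/-- Grönwall in a single chart: an orbit of `Y` is an approximate orbit of `X`. Only `X` needs a
Lipschitz constant; `Y` enters through its distance to `X` and a speed bound that keeps its orbits
in the chart. -/
theorem continuousAt_flow_short_of_nonneg (X : VField E M) {x₀ : M} {ρ C : ℝ} (hC0 : 0 < C)
    (hρ : Metric.closedBall (extChartAt 𝓘(ℝ, E) x₀ x₀) ρ ⊆ (extChartAt 𝓘(ℝ, E) x₀).target)
    (hC : ∀ z ∈ Metric.closedBall (extChartAt 𝓘(ℝ, E) x₀ x₀) ρ,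
      ‖localRep X x₀ z‖ ≤ C ∧ ‖fderiv ℝ (localRep X x₀) z‖ ≤ C)
    (hCY : ∀ᶠ Y in 𝓝 X, ∀ z ∈ Metric.closedBall (extChartAt 𝓘(ℝ, E) x₀ x₀) ρ,
      ‖localRep Y x₀ z‖ ≤ C)
    {x : M} (hx : x ∈ chartBall E x₀ (ρ / 2)) {t : ℝ} (ht : 0 ≤ t) (htC : t * C < ρ / 2) :
    ContinuousAt (fun p : VField E M × M => flow p.1 t p.2) (X, x) := by
  have : ProperSpace E := FiniteDimensional.proper_real E
  have hstay : ∀ Y : VField E M, (∀ z ∈ Metric.closedBall (extChartAt 𝓘(ℝ, E) x₀ x₀) ρ,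
      ‖localRep Y x₀ z‖ ≤ C) → ∀ y ∈ chartBall E x₀ (ρ / 2), ∀ s ∈ Icc 0 t,
      flow Y s y ∈ chartClosedBall E x₀ ρ := by
    intro Y hY y hy s hs
    refine chartBall_subset_closedBall x₀ ρ (flow_mem_chartBall_of_nonneg Y hρ hY hy hs.1 ?_)
    have : s * C ≤ t * C := by gcongr; exact hs.2
    linarith
  have hXs := hstay X (fun z hz => (hC z hz).1) x hx
  have hlim : Tendsto (fun p : VField E M × M => extChartAt 𝓘(ℝ, E) x₀ (flow p.1 t p.2))
      (𝓝 (X, x)) (𝓝 (extChartAt 𝓘(ℝ, E) x₀ (flow X t x))) := by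
    rw [Metric.tendsto_nhds]
    intro ε hε
    set c := gronwallBound 1 C 1 t with hc
    have hc0 : 0 ≤ c := by
      have := gronwallBound_mono (δ := 1) (ε := 1) zero_le_one zero_le_one hC0.le ht
      rw [gronwallBound_x0] at this
      linarith
    -- `η` bounds both the initial error and the error of the field, and the Grönwall bound is then
    -- `η c < ε`.
    set η := ε / (2 * (c + 1)) with hη
    have hη0 : 0 < η := by positivity
    have h1 : ∀ᶠ y in 𝓝 x, dist (extChartAt 𝓘(ℝ, E) x₀ y) (extChartAt 𝓘(ℝ, E) x₀ x) < η :=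
      Metric.tendsto_nhds.1 (continuousAt_extChartAt' hx.1) η hη0
    have h2 : ∀ᶠ y in 𝓝 x, y ∈ chartBall E x₀ (ρ / 2) := (isOpen_chartBall x₀ _).mem_nhds hx
    have h3 := eventually_localRep_close X x₀ (isCompact_closedBall _ ρ) hρ hη0
    filter_upwards [(hCY.and h3).prod_nhds (h1.and h2)] with p ⟨⟨hp1, hp2⟩, hp3, hp4⟩
    have hYs := hstay p.1 hp1 p.2 hp4
    have hg := dist_le_of_approx_trajectories_ODE_of_mem
      (v := fun _ => localRep X x₀) (K := C.toNNReal)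
      (s := fun _ => Metric.closedBall (extChartAt 𝓘(ℝ, E) x₀ x₀) ρ)
      (f := fun s => extChartAt 𝓘(ℝ, E) x₀ (flow p.1 s p.2))
      (g := fun s => extChartAt 𝓘(ℝ, E) x₀ (flow X s x)) (a := 0) (b := t)
      (εf := η) (εg := 0) (δ := η)
      (fun _ _ => lipschitzOnWith_localRep X hC0.le hρ fun z hz => (hC z hz).2)
      (fun s hs => (hasDerivAt_chart_flow p.1 (hYs s hs).1).continuousAt.continuousWithinAt)
      (fun s hs => (hasDerivAt_chart_flow p.1
        (hYs s (Ico_subset_Icc_self hs)).1).hasDerivWithinAt)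
      (fun s hs => by
        rw [dist_eq_norm]
        exact (hp2 _ (hYs s (Ico_subset_Icc_self hs)).2).1.le)
      (fun s hs => (hYs s (Ico_subset_Icc_self hs)).2)
      (fun s hs => (hasDerivAt_chart_flow X (hXs s hs).1).continuousAt.continuousWithinAt)
      (fun s hs => (hasDerivAt_chart_flow X
        (hXs s (Ico_subset_Icc_self hs)).1).hasDerivWithinAt)
      (fun s hs => by rw [dist_self])
      (fun s hs => (hXs s (Ico_subset_Icc_self hs)).2)
      (by simpa only [flow_zero] using hp3.le) t ⟨ht, le_rfl⟩
    rw [add_zero, sub_zero, Real.coe_toNNReal _ hC0.le, gronwallBound_diag hC0.ne', ← hc] at hg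
    refine hg.trans_lt ?_
    rw [hη, div_mul_eq_mul_div, div_lt_iff₀ (by positivity)]
    nlinarith
  have hXt := hXs t ⟨ht, le_rfl⟩
  have h4 : Tendsto (fun p : VField E M × M => (extChartAt 𝓘(ℝ, E) x₀).symm
      (extChartAt 𝓘(ℝ, E) x₀ (flow p.1 t p.2))) (𝓝 (X, x)) (𝓝 (flow X t x)) := by
    have := (continuousAt_extChartAt_symm' (I := 𝓘(ℝ, E)) hXt.1).tendsto.comp hlim
    rwa [(extChartAt 𝓘(ℝ, E) x₀).left_inv hXt.1] at this
  refine h4.congr' ?_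
  filter_upwards [hCY.prod_nhds ((isOpen_chartBall x₀ (ρ / 2)).mem_nhds hx)] with p hp
  exact (extChartAt 𝓘(ℝ, E) x₀).left_inv (hstay p.1 hp.1 p.2 hp.2 t ⟨ht, le_rfl⟩).1

theorem exists_continuousAt_flow_short (X : VField E M) :
    ∃ ε > 0, ∀ x ∈ (univ : Set M), ∀ t : ℝ, |t| < ε →
      ContinuousAt (fun p : VField E M × M => flow p.1 t p.2) (X, x) := by
  have : ProperSpace E := FiniteDimensional.proper_real E
  refine isCompact_univ.induction_on (p := fun s : Set M => ∃ ε > 0, ∀ x ∈ s, ∀ t : ℝ, |t| < ε →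
      ContinuousAt (fun p : VField E M × M => flow p.1 t p.2) (X, x)) ⟨1, one_pos, by simp⟩ ?_ ?_ ?_
  · rintro s t hst ⟨ε, hε, h⟩
    exact ⟨ε, hε, fun x hx => h x (hst hx)⟩
  · rintro s t ⟨ε, hε, h⟩ ⟨δ, hδ, k⟩
    refine ⟨min ε δ, lt_min hε hδ, fun x hx r hr => ?_⟩
    rcases hx with hx | hx
    · exact h x hx r (hr.trans_le (min_le_left _ _))
    · exact k x hx r (hr.trans_le (min_le_right _ _))
  · intro x₀ _
    obtain ⟨ρ, hρ0, hρ⟩ := exists_chart_radius (E := E) x₀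
    obtain ⟨C, hC0, hC, hCY⟩ := exists_localRep_bound X (isCompact_closedBall _ ρ) hρ
    refine ⟨chartBall E x₀ (ρ / 2), mem_nhdsWithin_of_mem_nhds
      ((isOpen_chartBall x₀ _).mem_nhds (mem_chartBall_self x₀ (by positivity))),
      ρ / 2 / C, by positivity, fun x hx t ht => ?_⟩
    rw [lt_div_iff₀ hC0] at ht
    rcases le_total 0 t with h0 | h0
    · rw [abs_of_nonneg h0] at ht
      exact continuousAt_flow_short_of_nonneg X hC0 hρ hC hCY hx h0 ht
    · rw [abs_of_nonpos h0] at ht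
      have h1 : ContinuousAt (fun p : VField E M × M => flow p.1 (-t) p.2) (-X, x) := by
        refine continuousAt_flow_short_of_nonneg (-X) hC0 hρ (fun z hz => ?_) ?_ hx
          (by linarith) ht
        · rw [localRep_neg X x₀ (hρ hz), fderiv_localRep_neg X x₀ (hρ hz), norm_neg, norm_neg]
          exact hC z hz
        · have h2 : Tendsto (fun Y : VField E M => -Y) (𝓝 (-X)) (𝓝 X) := by
            have := (continuous_neg_vField (E := E) (M := M)).tendsto (-X)
            rwa [neg_neg] at this
          filter_upwards [h2.eventually hCY] with Y hY z hz
          have := hY z hz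
          rwa [localRep_neg Y x₀ (hρ hz), norm_neg] at this
      have h3 : ContinuousAt (fun p : VField E M × M => ((-p.1 : VField E M), p.2)) (X, x) :=
        ((continuous_neg_vField.comp continuous_fst).prodMk continuous_snd).continuousAt
      have h4 := ContinuousAt.comp (f := fun p : VField E M × M => ((-p.1 : VField E M), p.2))
        (x := (X, x)) h1 h3
      refine h4.congr (Eventually.of_forall fun p => ?_)
      simp [flow_neg_vField]

theorem continuousAt_flow_fixed_time (X : VField E M) (t : ℝ) (x : M) :
    ContinuousAt (fun p : VField E M × M => flow p.1 t p.2) (X, x) := by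
  obtain ⟨ε, hε, h⟩ := exists_continuousAt_flow_short X
  obtain ⟨n, hn⟩ := exists_nat_gt (|t| / ε)
  have hn0 : (0 : ℝ) < n := (by positivity : (0 : ℝ) ≤ |t| / ε).trans_lt hn
  set s := t / n with hs
  have hsε : |s| < ε := by
    rw [hs, abs_div, abs_of_pos hn0, div_lt_iff₀ hn0]
    rwa [div_lt_iff₀ hε, mul_comm] at hn
  -- The time is cut into `n` short steps. Every step is taken at the same field `X`, so the uniform
  -- `ε` of `X` serves throughout.
  have key : ∀ k : ℕ, ContinuousAt (fun p : VField E M × M => flow p.1 (k * s) p.2) (X, x) := by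
    intro k
    induction k with
    | zero => simpa [flow_zero] using continuousAt_snd
    | succ k ih =>
      have h1 : ContinuousAt (fun p : VField E M × M => (p.1, flow p.1 (k * s) p.2)) (X, x) :=
        continuousAt_fst.prodMk ih
      have h2 := ContinuousAt.comp (f := fun p : VField E M × M => (p.1, flow p.1 (k * s) p.2))
        (x := (X, x)) (h (flow X (k * s) x) (mem_univ _) s hsε) h1
      refine h2.congr (Eventually.of_forall fun p => ?_)
      have : ((k + 1 : ℕ) : ℝ) * s = s + k * s := by push_cast; ring
      simp only [Function.comp]
      rw [this, flow_add]
  have := key n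
  rwa [hs, mul_div_cancel₀ _ hn0.ne'] at this

/-- The flow is jointly continuous in the vector field, the time and the point. -/
theorem continuousAt_flow (X : VField E M) (t : ℝ) (x : M) :
    ContinuousAt (fun p : VField E M × ℝ × M => flow p.1 p.2.1 p.2.2) (X, t, x) := by
  intro W hW
  -- The flow up to a time near `t` is the flow up to `t`, followed by a flow for a time near `0`.
  have h1 := eventually_flow_mem_of_nhds X (flow X t x) hW
  have h2 : Tendsto (fun p : VField E M × ℝ × M => (p.1, p.2.1 - t, flow p.1 t p.2.2))
      (𝓝 (X, t, x)) (𝓝 (X, 0, flow X t x)) := by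
    refine continuousAt_fst.tendsto.prodMk_nhds (Tendsto.prodMk_nhds ?_ ?_)
    · have : ContinuousAt (fun p : VField E M × ℝ × M => p.2.1 - t) (X, t, x) := by fun_prop
      simpa [ContinuousAt] using this
    · have h3 : ContinuousAt (fun p : VField E M × ℝ × M => (p.1, p.2.2)) (X, t, x) := by fun_prop
      exact ContinuousAt.comp (f := fun p : VField E M × ℝ × M => (p.1, p.2.2)) (x := (X, t, x))
        (continuousAt_flow_fixed_time X t x) h3
  refine (h2.eventually h1).mono fun p hp => ?_
  rwa [← flow_add, sub_add_cancel] at hp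

theorem continuous_flow_point (X : VField E M) (t : ℝ) : Continuous (flow X t) :=
  continuous_iff_continuousAt.2 fun x =>
    ContinuousAt.comp (f := fun y : M => (X, y)) (x := x) (continuousAt_flow_fixed_time X t x)
      (Continuous.continuousAt (by fun_prop))

end Flow


/-! ### Differentiability of the flow -/

section ODE

variable {E : Type*} [NormedAddCommGroup E] [NormedSpace ℝ E] [FiniteDimensional ℝ E]

omit [FiniteDimensional ℝ E] in
/-- A family of solutions of a `C¹` differential equation is differentiable with respect to the
initial value, and the derivative is the solution of the variational equation. -/
theorem hasFDerivAt_of_variational {F : E → E} {S : Set E} (hS : IsCompact S) (hconv : Convex ℝ S)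
    (hF : ∀ z ∈ S, DifferentiableAt ℝ F z) (hF' : ContinuousOn (fderiv ℝ F) S) {T : ℝ}
    (hT : 0 ≤ T) {Φ : E → ℝ → E} {w₀ : E}
    (hΦ : ∀ᶠ w in 𝓝 w₀, Φ w 0 = w ∧ ∀ t ∈ Icc 0 T, HasDerivAt (Φ w) (F (Φ w t)) t ∧ Φ w t ∈ S)
    {D : ℝ → E →L[ℝ] E} (hD0 : D 0 = 1)
    (hD : ∀ t ∈ Icc 0 T, HasDerivWithinAt D (fderiv ℝ F (Φ w₀ t) * D t) (Icc 0 T) t) :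
    HasFDerivAt (fun w => Φ w T) (D T) w₀ := by
  obtain ⟨hw₀, hΦ₀⟩ := hΦ.self_of_nhds
  obtain ⟨C, hC⟩ := hS.exists_bound_of_continuousOn hF'
  set K := |C| + 1 with hK
  have hK0 : 0 < K := by positivity
  have hCK : ∀ z ∈ S, ‖fderiv ℝ F z‖ ≤ K := fun z hz => by
    linarith [hC z hz, le_abs_self C]
  have hLip : LipschitzOnWith K.toNNReal F S := by
    refine hconv.lipschitzOnWith_of_nnnorm_fderiv_le hF fun z hz => ?_
    rw [← NNReal.coe_le_coe, Real.coe_toNNReal _ hK0.le]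
    exact hCK z hz
  set L := Real.exp (K * T) with hL
  have hL0 : 0 < L := Real.exp_pos _
  have hdist : ∀ᶠ w in 𝓝 w₀, ∀ t ∈ Icc 0 T, ‖Φ w t - Φ w₀ t‖ ≤ L * ‖w - w₀‖ := by
    filter_upwards [hΦ] with w hw t ht
    have := dist_le_of_trajectories_ODE_of_mem (v := fun _ => F) (K := K.toNNReal)
      (s := fun _ => S) (f := Φ w) (g := Φ w₀) (a := 0) (b := T) (δ := ‖w - w₀‖)
      (fun _ _ => hLip)
      (fun s hs => (hw.2 s hs).1.continuousAt.continuousWithinAt)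
      (fun s hs => (hw.2 s (Ico_subset_Icc_self hs)).1.hasDerivWithinAt)
      (fun s hs => (hw.2 s (Ico_subset_Icc_self hs)).2)
      (fun s hs => (hΦ₀ s hs).1.continuousAt.continuousWithinAt)
      (fun s hs => (hΦ₀ s (Ico_subset_Icc_self hs)).1.hasDerivWithinAt)
      (fun s hs => (hΦ₀ s (Ico_subset_Icc_self hs)).2)
      (by rw [hw.1, hw₀, dist_eq_norm]) t ht
    rw [dist_eq_norm, Real.coe_toNNReal _ hK0.le, mul_comm] at this
    refine this.trans ?_
    rw [hL]
    gcongr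
    linarith [ht.2]
  have huc := hS.uniformContinuousOn_of_continuous hF'
  rw [hasFDerivAt_iff_isLittleO, isLittleO_iff]
  intro ε hε
  set c := gronwallBound 0 K 1 T with hc
  have hgc : ∀ η, gronwallBound 0 K η T = η * c := by
    intro η
    rw [hc, gronwallBound_of_K_ne_0 hK0.ne', gronwallBound_of_K_ne_0 hK0.ne']
    ring
  have hc0 : 0 ≤ c := by
    have := gronwallBound_mono (δ := 0) (ε := 1) le_rfl zero_le_one hK0.le hT
    rwa [gronwallBound_x0] at this
  -- `η` is the relative Taylor error allowed for `F`; solutions separate by at most the factor `L`,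
  -- and Grönwall multiplies by `c`, so the final error is at most `ε ‖w - w₀‖`.
  set η := ε / (L * (c + 1)) with hη
  have hη0 : 0 < η := by positivity
  obtain ⟨δ, hδ0, hδ⟩ := Metric.uniformContinuousOn_iff.1 huc η hη0
  have htaylor : ∀ a ∈ S, ∀ b ∈ S, ‖a - b‖ < δ →
      ‖F a - F b - fderiv ℝ F b (a - b)‖ ≤ η * ‖a - b‖ := by
    intro a ha b hb hab
    refine (hconv.inter (convex_ball b δ)).norm_image_sub_le_of_norm_fderiv_le'
      (fun z hz => hF z hz.1) (fun z hz => ?_) ⟨hb, Metric.mem_ball_self hδ0⟩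
      ⟨ha, by rwa [Metric.mem_ball, dist_eq_norm]⟩
    rw [← dist_eq_norm]
    exact (hδ z hz.1 b hb hz.2).le
  have hsmall : ∀ᶠ w in 𝓝 w₀, L * ‖w - w₀‖ < δ := by
    have : Tendsto (fun w => L * ‖w - w₀‖) (𝓝 w₀) (𝓝 (L * ‖w₀ - w₀‖)) :=
      Continuous.tendsto (by fun_prop) w₀
    rw [sub_self, norm_zero, mul_zero] at this
    exact this.eventually_lt_const hδ0
  filter_upwards [hΦ, hdist, hsmall] with w hw hwd hws
  -- Grönwall is applied to the remainder `Φ w - Φ w₀ - D (w - w₀)`. It solves the variational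
  -- equation at `Φ w₀` up to the Taylor error of `F`, and vanishes at time `0`.
  have hg := norm_le_gronwallBound_of_norm_deriv_right_le
    (f := fun t => Φ w t - Φ w₀ t - D t (w - w₀))
    (f' := fun t => F (Φ w t) - F (Φ w₀ t) - (fderiv ℝ F (Φ w₀ t) * D t) (w - w₀))
    (δ := 0) (K := K) (ε := η * (L * ‖w - w₀‖)) (a := 0) (b := T)
    (fun t ht => ((hw.2 t ht).1.continuousAt.continuousWithinAt.sub
      (hΦ₀ t ht).1.continuousAt.continuousWithinAt).sub
      ((hD t ht).continuousWithinAt.clm_apply continuousWithinAt_const))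
    (fun t ht => by
      have h1 := (hD t (Ico_subset_Icc_self ht)).mono_of_mem_nhdsWithin (Icc_mem_nhdsGE_of_mem ht)
      have h2 := h1.clm_apply (hasDerivWithinAt_const t (Ici t) (w - w₀))
      simp only [map_zero, add_zero] at h2
      exact ((hw.2 t (Ico_subset_Icc_self ht)).1.hasDerivWithinAt.sub
        (hΦ₀ t (Ico_subset_Icc_self ht)).1.hasDerivWithinAt).sub h2)
    (by simp [hD0, hw.1, hw₀])
    (fun t ht => by
      have ht' := Ico_subset_Icc_self ht
      have h1 := htaylor _ (hw.2 t ht').2 _ (hΦ₀ t ht').2 ((hwd t ht').trans_lt hws)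
      have h2 : F (Φ w t) - F (Φ w₀ t) - (fderiv ℝ F (Φ w₀ t) * D t) (w - w₀) =
          fderiv ℝ F (Φ w₀ t) (Φ w t - Φ w₀ t - D t (w - w₀)) +
          (F (Φ w t) - F (Φ w₀ t) - fderiv ℝ F (Φ w₀ t) (Φ w t - Φ w₀ t)) := by
        rw [mul_apply_eq_comp, map_sub (fderiv ℝ F (Φ w₀ t)) (Φ w t - Φ w₀ t)]
        abel
      rw [h2]
      refine (norm_add_le _ _).trans (add_le_add ?_ (h1.trans ?_))
      · exact (fderiv ℝ F (Φ w₀ t)).le_of_opNorm_le (hCK _ (hΦ₀ t ht').2) _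
      · gcongr
        exact hwd t ht')
    T ⟨hT, le_rfl⟩
  rw [sub_zero, hgc] at hg
  refine hg.trans ?_
  have : η * (L * ‖w - w₀‖) * c = ε * (c / (c + 1)) * ‖w - w₀‖ := by
    have := hL0.ne'
    rw [hη]; field_simp
  rw [this]
  have h1 : c / (c + 1) ≤ 1 := by rw [div_le_one (by positivity)]; linarith
  have h2 : ε * (c / (c + 1)) ≤ ε * 1 := by gcongr
  gcongr
  linarith

/-- Linear differential equations have solutions for short times. -/
theorem exists_variational_solution {a : ℝ → E →L[ℝ] E} {T K : ℝ} (hT : 0 ≤ T)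
    (ha : ContinuousOn a (Icc 0 T)) (hK : ∀ t ∈ Icc 0 T, ‖a t‖ ≤ K) (hK0 : 0 ≤ K)
    (hTK : 2 * K * T ≤ 1) :
    ∃ D : ℝ → E →L[ℝ] E, D 0 = 1 ∧
      ∀ t ∈ Icc 0 T, HasDerivWithinAt D (a t * D t) (Icc 0 T) t := by
  have : CompleteSpace E := FiniteDimensional.complete ℝ E
  -- On the ball of radius `1` around the identity `‖D‖ ≤ 2`, so the speed is at most `2K`; the
  -- hypothesis `2 * K * T ≤ 1` keeps the solution in this ball.
  have hpl : IsPicardLindelof (fun t (D : E →L[ℝ] E) => a t * D) (tmin := 0) (tmax := T)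
      ⟨0, le_rfl, hT⟩ (1 : E →L[ℝ] E) 1 0 (2 * K).toNNReal K.toNNReal := by
    refine ⟨fun t ht => ?_, fun D _ => ha.mul continuousOn_const, fun t ht D hD => ?_, ?_⟩
    · refine LipschitzWith.lipschitzOnWith (LipschitzWith.of_dist_le_mul fun x y => ?_)
      rw [dist_eq_norm, dist_eq_norm, ← mul_sub, Real.coe_toNNReal _ hK0]
      exact (norm_mul_le _ _).trans (by gcongr; exact hK t ht)
    · rw [Real.coe_toNNReal _ (by positivity)]
      have h1 : ‖D‖ ≤ 2 := by
        rw [Metric.mem_closedBall, dist_eq_norm] at hD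
        have h2 : ‖(1 : E →L[ℝ] E)‖ ≤ 1 := ContinuousLinearMap.norm_id_le
        have h3 := norm_le_insert' D 1
        simp only [NNReal.coe_one] at hD
        linarith
      calc ‖a t * D‖ ≤ ‖a t‖ * ‖D‖ := norm_mul_le _ _
        _ ≤ K * 2 := by gcongr; exact hK t ht
        _ = 2 * K := by ring
    · rw [Real.coe_toNNReal _ (by positivity)]
      simp only [NNReal.coe_one, NNReal.coe_zero, sub_zero, sub_self, max_eq_left hT]
      exact hTK
  obtain ⟨D, hD0, hD⟩ := hpl.exists_eq_forall_mem_Icc_hasDerivWithinAt₀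
  exact ⟨D, hD0, hD⟩

end ODE

/-! ### The differential of the flow on the manifold -/

section Flow

variable {E M : Type*} [NormedAddCommGroup E] [NormedSpace ℝ E] [FiniteDimensional ℝ E]
  [TopologicalSpace M] [ChartedSpace E M] [IsManifold 𝓘(ℝ, E) ∞ M] [CompactSpace M] [T2Space M]

theorem hasFDerivAt_chart_flow (X : VField E M) {x₀ : M} {ρ C : ℝ}
    (hρ : Metric.closedBall (extChartAt 𝓘(ℝ, E) x₀ x₀) ρ ⊆ (extChartAt 𝓘(ℝ, E) x₀).target)
    (hC : ∀ z ∈ Metric.closedBall (extChartAt 𝓘(ℝ, E) x₀ x₀) ρ, ‖localRep X x₀ z‖ ≤ C)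
    {x : M} (hx : x ∈ chartBall E x₀ (ρ / 2)) {t : ℝ} (ht : 0 ≤ t) (htC : t * C < ρ / 2)
    {D : ℝ → E →L[ℝ] E} (hD0 : D 0 = 1)
    (hD : ∀ s ∈ Icc 0 t, HasDerivWithinAt D (fderiv ℝ (localRep X x₀)
      (extChartAt 𝓘(ℝ, E) x₀ (flow X s x)) * D s) (Icc 0 t) s) :
    HasFDerivAt (fun w => extChartAt 𝓘(ℝ, E) x₀ (flow X t ((extChartAt 𝓘(ℝ, E) x₀).symm w))) (D t)
      (extChartAt 𝓘(ℝ, E) x₀ x) := by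
  have : ProperSpace E := FiniteDimensional.proper_real E
  have hρ0 : 0 < ρ := by
    have := dist_nonneg.trans_lt (Metric.mem_ball.1 hx.2)
    linarith
  have hC0 : 0 ≤ C := (norm_nonneg _).trans (hC _ (Metric.mem_closedBall_self hρ0.le))
  refine hasFDerivAt_of_variational (F := localRep X x₀) (isCompact_closedBall _ ρ)
    (convex_closedBall _ _)
    (fun z hz => (contDiffAt_localRep X (hρ hz)).differentiableAt one_ne_zero)
    ((continuousOn_fderiv_localRep X x₀).mono hρ) ht
    (Φ := fun w s => extChartAt 𝓘(ℝ, E) x₀ (flow X s ((extChartAt 𝓘(ℝ, E) x₀).symm w))) ?_ hD0 ?_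
  · filter_upwards [Metric.isOpen_ball.mem_nhds hx.2] with w hw
    have hwt : w ∈ (extChartAt 𝓘(ℝ, E) x₀).target :=
      hρ (Metric.closedBall_subset_closedBall (by linarith) (Metric.ball_subset_closedBall hw))
    have hwb : (extChartAt 𝓘(ℝ, E) x₀).symm w ∈ chartBall E x₀ (ρ / 2) := by
      refine ⟨(extChartAt 𝓘(ℝ, E) x₀).map_target hwt, ?_⟩
      rwa [(extChartAt 𝓘(ℝ, E) x₀).right_inv hwt]
    refine ⟨by rw [flow_zero, (extChartAt 𝓘(ℝ, E) x₀).right_inv hwt], fun s hs => ?_⟩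
    have hsC : s * C < ρ / 2 := by
      have : s * C ≤ t * C := by gcongr; exact hs.2
      linarith
    have hmem := flow_mem_chartBall_of_nonneg X hρ hC hwb hs.1 hsC
    exact ⟨hasDerivAt_chart_flow X hmem.1, Metric.ball_subset_closedBall hmem.2⟩
  · simpa only [(extChartAt 𝓘(ℝ, E) x₀).left_inv hx.1] using hD

theorem mdifferentiableAt_flow_of_chart (X : VField E M) {x₀ x : M} {t : ℝ}
    (hx : x ∈ (extChartAt 𝓘(ℝ, E) x₀).source)
    (hxt : flow X t x ∈ (extChartAt 𝓘(ℝ, E) x₀).source)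
    (h : DifferentiableAt ℝ (fun w => extChartAt 𝓘(ℝ, E) x₀
      (flow X t ((extChartAt 𝓘(ℝ, E) x₀).symm w))) (extChartAt 𝓘(ℝ, E) x₀ x)) :
    MDifferentiableAt 𝓘(ℝ, E) 𝓘(ℝ, E) (flow X t) x := by
  have h1 : MDifferentiableAt 𝓘(ℝ, E) 𝓘(ℝ, E) (extChartAt 𝓘(ℝ, E) x₀) x :=
    mdifferentiableAt_extChartAt (by rwa [extChartAt_source] at hx)
  have h2 := MDifferentiableAt.comp x h.mdifferentiableAt h1
  have h3 : MDifferentiableAt 𝓘(ℝ, E) 𝓘(ℝ, E) (extChartAt 𝓘(ℝ, E) x₀).symm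
      (extChartAt 𝓘(ℝ, E) x₀ (flow X t x)) :=
    (mdifferentiableOn_extChartAt_symm _
      ((extChartAt 𝓘(ℝ, E) x₀).map_source hxt)).mdifferentiableAt
      ((isOpen_chart_target x₀).mem_nhds ((extChartAt 𝓘(ℝ, E) x₀).map_source hxt))
  rw [← (extChartAt 𝓘(ℝ, E) x₀).left_inv hx] at h3
  have h4 := MDifferentiableAt.comp x h3 h2
  refine h4.congr_of_eventuallyEq ?_
  have hc : ContinuousAt (flow X t) x := (continuous_flow_point X t).continuousAt
  filter_upwards [(isOpen_extChartAt_source x₀).mem_nhds hx,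
    hc ((isOpen_extChartAt_source x₀).mem_nhds hxt)] with y hy hyt
  simp only [Function.comp]
  rw [(extChartAt 𝓘(ℝ, E) x₀).left_inv hy, (extChartAt 𝓘(ℝ, E) x₀).left_inv hyt]

theorem mdifferentiableAt_flow_short_of_nonneg (X : VField E M) {x₀ : M} {ρ C : ℝ} (hC0 : 0 ≤ C)
    (hρ : Metric.closedBall (extChartAt 𝓘(ℝ, E) x₀ x₀) ρ ⊆ (extChartAt 𝓘(ℝ, E) x₀).target)
    (hC : ∀ z ∈ Metric.closedBall (extChartAt 𝓘(ℝ, E) x₀ x₀) ρ,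
      ‖localRep X x₀ z‖ ≤ C ∧ ‖fderiv ℝ (localRep X x₀) z‖ ≤ C)
    {x : M} (hx : x ∈ chartBall E x₀ (ρ / 2)) {t : ℝ} (ht : 0 ≤ t) (htC : t * C < ρ / 2)
    (htC' : 2 * C * t ≤ 1) :
    MDifferentiableAt 𝓘(ℝ, E) 𝓘(ℝ, E) (flow X t) x := by
  have hstay : ∀ s ∈ Icc 0 t, flow X s x ∈ chartBall E x₀ ρ := fun s hs =>
    flow_mem_chartBall_of_nonneg X hρ (fun z hz => (hC z hz).1) hx hs.1 (by
      have : s * C ≤ t * C := by gcongr; exact hs.2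
      linarith)
  have hcb := fun s hs => chartBall_subset_closedBall x₀ ρ (hstay s hs)
  obtain ⟨D, hD0, hD⟩ := exists_variational_solution
    (a := fun s => fderiv ℝ (localRep X x₀) (extChartAt 𝓘(ℝ, E) x₀ (flow X s x))) ht
    ((continuousOn_fderiv_localRep X x₀).comp
      (fun s hs => (hasDerivAt_chart_flow X (hstay s hs).1).continuousAt.continuousWithinAt)
      fun s hs => hρ (hcb s hs).2) (fun s hs => (hC _ (hcb s hs).2).2) hC0 htC'
  exact mdifferentiableAt_flow_of_chart X hx.1 (hstay t ⟨ht, le_rfl⟩).1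
    (hasFDerivAt_chart_flow X hρ (fun z hz => (hC z hz).1) hx ht htC hD0 hD).differentiableAt

theorem exists_mdifferentiableAt_flow_short (X : VField E M) :
    ∃ ε > 0, ∀ x ∈ (univ : Set M), ∀ t : ℝ, |t| < ε →
      MDifferentiableAt 𝓘(ℝ, E) 𝓘(ℝ, E) (flow X t) x := by
  have : ProperSpace E := FiniteDimensional.proper_real E
  refine isCompact_univ.induction_on (p := fun s : Set M => ∃ ε > 0, ∀ x ∈ s, ∀ t : ℝ, |t| < ε →
      MDifferentiableAt 𝓘(ℝ, E) 𝓘(ℝ, E) (flow X t) x) ⟨1, one_pos, by simp⟩ ?_ ?_ ?_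
  · rintro s t hst ⟨ε, hε, h⟩
    exact ⟨ε, hε, fun x hx => h x (hst hx)⟩
  · rintro s t ⟨ε, hε, h⟩ ⟨δ, hδ, k⟩
    refine ⟨min ε δ, lt_min hε hδ, fun x hx r hr => ?_⟩
    rcases hx with hx | hx
    · exact h x hx r (hr.trans_le (min_le_left _ _))
    · exact k x hx r (hr.trans_le (min_le_right _ _))
  · intro x₀ _
    obtain ⟨ρ, hρ0, hρ⟩ := exists_chart_radius (E := E) x₀
    obtain ⟨C, hC0, hC, -⟩ := exists_localRep_bound X (isCompact_closedBall _ ρ) hρ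
    refine ⟨chartBall E x₀ (ρ / 2), mem_nhdsWithin_of_mem_nhds
      ((isOpen_chartBall x₀ _).mem_nhds (mem_chartBall_self x₀ (by positivity))),
      min (ρ / 2 / C) (1 / (2 * C)), by positivity, fun x hx t ht => ?_⟩
    have ht1 := ht.trans_le (min_le_left _ _)
    have ht2 := ht.trans_le (min_le_right _ _)
    rw [lt_div_iff₀ hC0] at ht1
    rw [lt_div_iff₀ (by positivity), mul_comm] at ht2
    rcases le_total 0 t with h0 | h0
    · rw [abs_of_nonneg h0] at ht1 ht2
      exact mdifferentiableAt_flow_short_of_nonneg X hC0.le hρ hC hx h0 ht1 ht2.le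
    · rw [abs_of_nonpos h0] at ht1 ht2
      have h1 : MDifferentiableAt 𝓘(ℝ, E) 𝓘(ℝ, E) (flow (-X) (-t)) x := by
        refine mdifferentiableAt_flow_short_of_nonneg (-X) hC0.le hρ (fun z hz => ?_) hx
          (by linarith) ht1 ht2.le
        rw [localRep_neg X x₀ (hρ hz), fderiv_localRep_neg X x₀ (hρ hz), norm_neg, norm_neg]
        exact hC z hz
      have h2 : flow (-X) (-t) = flow X t := by
        ext y
        rw [flow_neg_vField, neg_neg]
      rwa [h2] at h1

/-- The flow of a `C¹` vector field is differentiable. -/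
theorem mdifferentiable_flow (X : VField E M) (t : ℝ) :
    MDifferentiable 𝓘(ℝ, E) 𝓘(ℝ, E) (flow X t) := by
  obtain ⟨ε, hε, h⟩ := exists_mdifferentiableAt_flow_short X
  obtain ⟨n, hn⟩ := exists_nat_gt (|t| / ε)
  have hn0 : (0 : ℝ) < n := (by positivity : (0 : ℝ) ≤ |t| / ε).trans_lt hn
  set s := t / n with hs
  have hsε : |s| < ε := by
    rw [hs, abs_div, abs_of_pos hn0, div_lt_iff₀ hn0]
    rwa [div_lt_iff₀ hε, mul_comm] at hn
  have key : ∀ k : ℕ, MDifferentiable 𝓘(ℝ, E) 𝓘(ℝ, E) (flow X (k * s)) := by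
    intro k
    induction k with
    | zero =>
      have : flow X ((0 : ℕ) * s) = id := by
        ext y
        simp [flow_zero]
      rw [this]
      exact mdifferentiable_id
    | succ k ih =>
      have : flow X ((k + 1 : ℕ) * s) = flow X s ∘ flow X (k * s) := by
        ext y
        have : ((k + 1 : ℕ) : ℝ) * s = s + k * s := by push_cast; ring
        rw [this, flow_add]
        rfl
      rw [this]
      exact MDifferentiable.comp (fun x => h x (mem_univ _) s hsε) ih
  have := key n
  rwa [hs, mul_div_cancel₀ _ hn0.ne'] at this

theorem mfderiv_flow_add_apply (X : VField E M) (s t : ℝ) (x : M) (v : TangentSpace 𝓘(ℝ, E) x) :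
    mfderiv 𝓘(ℝ, E) 𝓘(ℝ, E) (flow X (s + t)) x v =
      mfderiv 𝓘(ℝ, E) 𝓘(ℝ, E) (flow X s) (flow X t x)
        (mfderiv 𝓘(ℝ, E) 𝓘(ℝ, E) (flow X t) x v) := by
  have h : flow X (s + t) = flow X s ∘ flow X t := funext fun y => flow_add X s t y
  rw [h, mfderiv_comp x (mdifferentiable_flow X s _) (mdifferentiable_flow X t x)]
  rfl

theorem mfderiv_flow_zero_apply (X : VField E M) (x : M) (v : TangentSpace 𝓘(ℝ, E) x) :
    (mfderiv 𝓘(ℝ, E) 𝓘(ℝ, E) (flow X 0) x v : E) = v := by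
  have h : flow X 0 = id := funext fun y => flow_zero X y
  rw [h, mfderiv_id]
  rfl

theorem bijective_mfderiv_flow (X : VField E M) (t : ℝ) (x : M) :
    Function.Bijective (mfderiv 𝓘(ℝ, E) 𝓘(ℝ, E) (flow X t) x) := by
  have hinj : Function.Injective (mfderiv 𝓘(ℝ, E) 𝓘(ℝ, E) (flow X t) x) := by
    intro v w hvw
    have h1 := mfderiv_flow_add_apply X (-t) t x v
    have h2 := mfderiv_flow_add_apply X (-t) t x w
    rw [hvw, ← h2] at h1
    rw [neg_add_cancel] at h1
    exact (mfderiv_flow_zero_apply X x v).symm.trans (h1.trans (mfderiv_flow_zero_apply X x w))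
  have : FiniteDimensional ℝ (TangentSpace 𝓘(ℝ, E) x) := inferInstanceAs (FiniteDimensional ℝ E)
  let f : E →ₗ[ℝ] E := (mfderiv 𝓘(ℝ, E) 𝓘(ℝ, E) (flow X t) x).toLinearMap
  have hf : Function.Injective f := hinj
  exact ⟨hinj, (LinearMap.injective_iff_surjective (f := f)).1 hf⟩

/-- The vector field is invariant under its flow. -/
theorem mfderiv_flow_apply_self (X : VField E M) (t : ℝ) (x : M) :
    mfderiv 𝓘(ℝ, E) 𝓘(ℝ, E) (flow X t) x (X x) = X (flow X t x) := by
  have h1 : HasMFDerivAt 𝓘(ℝ, ℝ) 𝓘(ℝ, E) (fun s => flow X s x) 0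
      ((1 : ℝ →L[ℝ] ℝ).smulRight (X (flow X 0 x))) := isMIntegralCurve_flow X x 0
  have h2 : HasMFDerivAt 𝓘(ℝ, ℝ) 𝓘(ℝ, E) (fun s => flow X s (flow X t x)) 0
      ((1 : ℝ →L[ℝ] ℝ).smulRight (X (flow X 0 (flow X t x)))) := isMIntegralCurve_flow X _ 0
  have h3 := HasMFDerivAt.comp (f := fun s => flow X s x) (0 : ℝ)
    (mdifferentiable_flow X t (flow X 0 x)).hasMFDerivAt h1
  -- The identity `φ^t ∘ φ^s = φ^s ∘ φ^t` is differentiated at `s = 0`.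
  have h4 : flow X t ∘ (fun s => flow X s x) = fun s => flow X s (flow X t x) := by
    ext s
    simp only [Function.comp]
    rw [← flow_add, ← flow_add, add_comm]
  rw [h4] at h3
  have h5 : ((1 : ℝ) • mfderiv 𝓘(ℝ, E) 𝓘(ℝ, E) (flow X t) (flow X 0 x) (X (flow X 0 x)) : E) =
      ((1 : ℝ) • X (flow X 0 (flow X t x)) : E) := by
    have h6 := congrArg (fun L : ℝ →L[ℝ] E => L 1) (hasMFDerivAt_unique h3 h2)
    refine Eq.trans ?_ h6
    exact ((mfderiv 𝓘(ℝ, E) 𝓘(ℝ, E) (flow X t) (flow X 0 x)).map_smul (1 : ℝ)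
      (X (flow X 0 x))).symm
  rw [one_smul, one_smul, flow_zero] at h5
  have h7 : ∀ y y' : M, y = y' → (X y : E) = (X y' : E) := by
    rintro y _ rfl
    rfl
  exact h5.trans (h7 _ _ (flow_zero X _))

/-- The orbit of a singular point is constant, so its variational equation has constant coefficients
and the exponential solves it. -/
theorem exists_hasMFDerivAt_flow_sing_of_nonneg (X : VField E M) {σ : M} (hσ : X σ = 0) :
    ∃ ε > 0, ∀ t : ℝ, 0 ≤ t → t < ε → HasMFDerivAt 𝓘(ℝ, E) 𝓘(ℝ, E) (flow X t) σ
      (NormedSpace.exp (t • fderiv ℝ (localRep X σ) (extChartAt 𝓘(ℝ, E) σ σ)) : E →L[ℝ] E) := by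
  have : ProperSpace E := FiniteDimensional.proper_real E
  have : CompleteSpace E := FiniteDimensional.complete ℝ E
  obtain ⟨ρ, hρ0, hρ⟩ := exists_chart_radius (E := E) σ
  obtain ⟨C, hC0, hC, -⟩ := exists_localRep_bound X (isCompact_closedBall _ ρ) hρ
  refine ⟨ρ / 2 / C, by positivity, fun t ht htε => ?_⟩
  rw [lt_div_iff₀ hC0] at htε
  have h := hasFDerivAt_chart_flow X hρ (fun z hz => (hC z hz).1)
    (mem_chartBall_self σ (by positivity)) ht htε
    (D := fun s => NormedSpace.exp (s • fderiv ℝ (localRep X σ) (extChartAt 𝓘(ℝ, E) σ σ)))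
    (by simp) (fun s _ => by
      rw [flow_of_eq_zero X hσ s]
      exact (hasDerivAt_exp_smul_const' (𝕂 := ℝ) (𝔸 := E →L[ℝ] E) _ s).hasDerivWithinAt)
  refine ⟨(continuous_flow_point X t).continuousAt, ?_⟩
  rw [writtenInExtChartAt, flow_of_eq_zero X hσ t]
  exact h.hasFDerivWithinAt

theorem exists_mfderiv_flow_sing (X : VField E M) {σ : M} (hσ : X σ = 0) :
    ∃ ε > 0, ∀ t : ℝ, |t| < ε → (mfderiv 𝓘(ℝ, E) 𝓘(ℝ, E) (flow X t) σ : E →L[ℝ] E) =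
      NormedSpace.exp (t • fderiv ℝ (localRep X σ) (extChartAt 𝓘(ℝ, E) σ σ)) := by
  have hσ' : (-X) σ = 0 := by
    change -(X σ) = 0
    rw [hσ, neg_zero]
  obtain ⟨ε, hε, h⟩ := exists_hasMFDerivAt_flow_sing_of_nonneg X hσ
  obtain ⟨δ, hδ, k⟩ := exists_hasMFDerivAt_flow_sing_of_nonneg (-X) hσ'
  refine ⟨min ε δ, lt_min hε hδ, fun t ht => ?_⟩
  rcases le_total 0 t with h0 | h0
  · rw [abs_of_nonneg h0] at ht
    exact (h t h0 (ht.trans_le (min_le_left _ _))).mfderiv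
  · rw [abs_of_nonpos h0] at ht
    have h1 := k (-t) (by linarith) (ht.trans_le (min_le_right _ _))
    have h2 : flow (-X) (-t) = flow X t := by
      ext y
      rw [flow_neg_vField, neg_neg]
    rw [h2, fderiv_localRep_neg X σ (mem_extChartAt_target σ), neg_smul_neg] at h1
    exact h1.mfderiv

/-- At a singular point the flow is tangent to the linear flow. -/
theorem mfderiv_flow_sing (X : VField E M) {σ : M} (hσ : X σ = 0) (t : ℝ) :
    (mfderiv 𝓘(ℝ, E) 𝓘(ℝ, E) (flow X t) σ : E →L[ℝ] E) =
      NormedSpace.exp (t • fderiv ℝ (localRep X σ) (extChartAt 𝓘(ℝ, E) σ σ)) := by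
  have : CompleteSpace E := FiniteDimensional.complete ℝ E
  obtain ⟨ε, hε, h⟩ := exists_mfderiv_flow_sing X hσ
  set A := fderiv ℝ (localRep X σ) (extChartAt 𝓘(ℝ, E) σ σ) with hA
  obtain ⟨n, hn⟩ := exists_nat_gt (|t| / ε)
  have hn0 : (0 : ℝ) < n := (by positivity : (0 : ℝ) ≤ |t| / ε).trans_lt hn
  set s := t / n with hs
  have hsε : |s| < ε := by
    rw [hs, abs_div, abs_of_pos hn0, div_lt_iff₀ hn0]
    rwa [div_lt_iff₀ hε, mul_comm] at hn
  -- The base point is generalized because `flow X (k * s) σ` equals `σ` only propositionally, while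
  -- the type of the derivative depends on it.
  have hpt : ∀ y : M, y = σ → (mfderiv 𝓘(ℝ, E) 𝓘(ℝ, E) (flow X s) y : E →L[ℝ] E) =
      NormedSpace.exp (s • A) := by
    rintro y rfl
    exact h s hsε
  have key : ∀ k : ℕ, (mfderiv 𝓘(ℝ, E) 𝓘(ℝ, E) (flow X (k * s)) σ : E →L[ℝ] E) =
      NormedSpace.exp ((k * s) • A) := by
    intro k
    induction k with
    | zero => exact h _ (by simpa using hε)
    | succ k ih =>
      have h1 : ((k + 1 : ℕ) : ℝ) * s = s + k * s := by push_cast; ring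
      have h2 : NormedSpace.exp ((s + k * s) • A) =
          NormedSpace.exp (s • A) * NormedSpace.exp ((k * s) • A) := by
        rw [add_smul]
        have : NormedAlgebra ℚ (E →L[ℝ] E) := NormedAlgebra.restrictScalars ℚ ℝ _
        exact NormedSpace.exp_add_of_commute
          (((Commute.refl A).smul_left _).smul_right _)
      rw [h1, h2]
      refine ContinuousLinearMap.ext fun v => ?_
      refine (mfderiv_flow_add_apply X s (k * s) σ v).trans ?_
      refine (DFunLike.congr_fun (hpt _ (flow_of_eq_zero X hσ _)) _).trans ?_
      exact congrArg (NormedSpace.exp (s • A) : E →L[ℝ] E) (DFunLike.congr_fun ih v)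
  have := key n
  rwa [hs, mul_div_cancel₀ _ hn0.ne'] at this

end Flow

/-! ### Invariant subspaces of the linear flow -/

section Invariance

variable {E : Type*} [NormedAddCommGroup E] [NormedSpace ℝ E] [FiniteDimensional ℝ E]

theorem linearFlow_mem_of_invariant (A : E →L[ℝ] E) {p : Submodule ℝ E} (hp : ∀ v ∈ p, A v ∈ p)
    (t : ℝ) {v : E} (hv : v ∈ p) : NormedSpace.exp (t • A) v ∈ p := by
  let A' : p →L[ℝ] p := ((A.toLinearMap).restrict hp).toContinuousLinearMap
  have h := linearFlow_intertwine (A := A') (A' := A) (L := p.subtypeL) (fun _ => rfl) t ⟨v, hv⟩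
  refine Set.mem_of_eq_of_mem (s := (p : Set E)) h.symm ?_
  exact Subtype.property _

end Invariance


/-! ### Strong stable manifolds and quadratic forms -/

section Escape

variable {E M : Type*} [NormedAddCommGroup E] [NormedSpace ℝ E] [FiniteDimensional ℝ E]
  [TopologicalSpace M] [ChartedSpace E M] [IsManifold 𝓘(ℝ, E) ∞ M]

theorem exists_radius_fderiv_close (X : VField E M) (σ : M) {W : Set M} (hW : W ∈ 𝓝 σ) {ε : ℝ}
    (hε : 0 < ε) :
    ∃ ρ > 0, Metric.closedBall (extChartAt 𝓘(ℝ, E) σ σ) ρ ⊆ (extChartAt 𝓘(ℝ, E) σ).target ∧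
      chartClosedBall E σ ρ ⊆ W ∧
      ∀ᶠ Y in 𝓝 X, ∀ z ∈ Metric.closedBall (extChartAt 𝓘(ℝ, E) σ σ) ρ,
        ‖fderiv ℝ (localRep Y σ) z - fderiv ℝ (localRep X σ) (extChartAt 𝓘(ℝ, E) σ σ)‖ ≤ ε := by
  have : ProperSpace E := FiniteDimensional.proper_real E
  obtain ⟨ρ₁, hρ₁, h1, h1W⟩ := exists_chartBall_subset (E := E) σ hW
  have hc : ContinuousAt (fderiv ℝ (localRep X σ)) (extChartAt 𝓘(ℝ, E) σ σ) :=
    (continuousOn_fderiv_localRep X σ).continuousAt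
      ((isOpen_chart_target σ).mem_nhds (mem_extChartAt_target σ))
  obtain ⟨ρ₂, hρ₂, h2⟩ := Metric.continuousAt_iff.1 hc (ε / 2) (half_pos hε)
  have hρ : 0 < min ρ₁ ρ₂ := lt_min hρ₁ hρ₂
  have ht : Metric.closedBall (extChartAt 𝓘(ℝ, E) σ σ) (min ρ₁ ρ₂ / 2) ⊆
      (extChartAt 𝓘(ℝ, E) σ).target :=
    (Metric.closedBall_subset_closedBall ((half_le_self hρ.le).trans (min_le_left _ _))).trans h1
  refine ⟨min ρ₁ ρ₂ / 2, half_pos hρ, ht, fun x hx => h1W ⟨hx.1, ?_⟩, ?_⟩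
  · exact Metric.closedBall_subset_ball ((half_lt_self hρ).trans_le (min_le_left _ _)) hx.2
  filter_upwards [eventually_localRep_close X σ (isCompact_closedBall _ _) ht (half_pos hε)]
    with Y hY z hz
  have h3 := (hY z hz).2
  have h4 := h2 (lt_of_le_of_lt (Metric.mem_closedBall.1 hz)
    ((half_lt_self hρ).trans_le (min_le_right _ _)))
  rw [dist_eq_norm] at h4
  have h5 := norm_add_le (fderiv ℝ (localRep Y σ) z - fderiv ℝ (localRep X σ) z)
    (fderiv ℝ (localRep X σ) z - fderiv ℝ (localRep X σ) (extChartAt 𝓘(ℝ, E) σ σ))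
  rw [sub_add_sub_cancel] at h5
  linarith

/-- Lyapunov forms at a singular point persist near the singular point. -/
theorem exists_radius_isLyapunov (X : VField E M) (σ : M) {W : Set M} (hW : W ∈ 𝓝 σ)
    (B : E →L[ℝ] E →L[ℝ] ℝ) {c : ℝ} (hc : 0 < c) :
    ∃ ρ > 0, Metric.closedBall (extChartAt 𝓘(ℝ, E) σ σ) ρ ⊆ (extChartAt 𝓘(ℝ, E) σ).target ∧
      chartClosedBall E σ ρ ⊆ W ∧
      ∀ᶠ Y in 𝓝 X, ∀ z ∈ Metric.closedBall (extChartAt 𝓘(ℝ, E) σ σ) ρ, ∀ g,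
        IsLyapunov B (fderiv ℝ (localRep X σ) (extChartAt 𝓘(ℝ, E) σ σ)) g c →
          IsLyapunov B (fderiv ℝ (localRep Y σ) z) g (c / 2) := by
  obtain ⟨ρ, hρ, ht, hρW, h⟩ := exists_radius_fderiv_close X σ hW
    (ε := c / 2 / (‖B‖ + 1)) (by positivity)
  refine ⟨ρ, hρ, ht, hρW, h.mono fun Y hY z hz g hg => hg.perturb ?_⟩
  calc _ ≤ ‖B‖ * (c / 2 / (‖B‖ + 1)) := by gcongr; exact hY z hz
    _ ≤ (‖B‖ + 1) * (c / 2 / (‖B‖ + 1)) := by gcongr; linarith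
    _ = c / 2 := by field_simp

/-- A hyperbolic linear map is bounded below. -/
theorem exists_lower_bound_of_hyperbolic (A : E →L[ℝ] E)
    (h : (0 : ℝ) ∉ exponents (A : Module.End ℝ E)) : ∃ κ > 0, ∀ v, κ * ‖v‖ ≤ ‖A v‖ := by
  -- Hyperbolicity says that the degenerate interval `[0, 0]` is a gap; the form for the rate `0`
  -- gives `c‖v‖² ≤ B(Av, v)`.
  obtain ⟨B, -, c, hc, hB, -⟩ := exists_lyapunov A (le_refl (0 : ℝ)) (fun r hr hr' => by
    rw [Icc_self, mem_singleton_iff] at hr'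
    exact h (hr' ▸ hr))
  refine ⟨c / (‖B‖ + 1), by positivity, fun v => ?_⟩
  rcases eq_or_ne v 0 with rfl | hv
  · simp
  have h1 := hB v
  rw [zero_smul, sub_zero] at h1
  have h2 : B (A v) v ≤ ‖B‖ * ‖A v‖ * ‖v‖ := (le_abs_self _).trans (B.le_opNorm₂ _ _)
  have h3 : c * ‖v‖ ≤ ‖B‖ * ‖A v‖ := by
    refine le_of_mul_le_mul_right ?_ (norm_pos_iff.2 hv)
    calc c * ‖v‖ * ‖v‖ = c * ‖v‖ ^ 2 := by ring
      _ ≤ _ := h1.trans h2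
  rw [div_mul_eq_mul_div, div_le_iff₀ (by positivity)]
  nlinarith [norm_nonneg (A v)]

/-- The derivative at `σ` is bounded below and dominates the Taylor remainder. Thus decay of the
field along an orbit becomes decay of the distance to `σ`, which is what the strong stable manifold
is defined by. -/
theorem eventually_norm_localRep_ge (X : VField E M) {σ : M} (hσ : X σ = 0)
    (h : (0 : ℝ) ∉ exponents
      (fderiv ℝ (localRep X σ) (extChartAt 𝓘(ℝ, E) σ σ) : Module.End ℝ E)) :
    ∃ κ > 0, ∀ᶠ x in 𝓝 σ, κ * ‖extChartAt 𝓘(ℝ, E) σ x - extChartAt 𝓘(ℝ, E) σ σ‖ ≤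
      ‖localRep X σ (extChartAt 𝓘(ℝ, E) σ x)‖ := by
  obtain ⟨κ, hκ, hA⟩ := exists_lower_bound_of_hyperbolic _ h
  refine ⟨κ / 2, half_pos hκ, ?_⟩
  have hd := ((contDiffAt_localRep X (mem_extChartAt_target σ)).differentiableAt
    one_ne_zero).hasFDerivAt.isLittleO
  have h1 := hd.def (half_pos hκ)
  refine ((continuousAt_extChartAt (I := 𝓘(ℝ, E)) σ).eventually h1).mono fun x hx => ?_
  rw [(localRep_extChartAt_eq_zero_iff X (mem_extChartAt_source σ)).2 hσ, sub_zero] at hx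
  have h2 := hA (extChartAt 𝓘(ℝ, E) σ x - extChartAt 𝓘(ℝ, E) σ σ)
  have h3 := norm_sub_norm_le (fderiv ℝ (localRep X σ) (extChartAt 𝓘(ℝ, E) σ σ)
    (extChartAt 𝓘(ℝ, E) σ x - extChartAt 𝓘(ℝ, E) σ σ)) (localRep X σ (extChartAt 𝓘(ℝ, E) σ x))
  rw [norm_sub_rev] at h3
  linarith

variable [CompactSpace M] [T2Space M]

theorem continuousAt_localRep_flow (X : VField E M) {σ x : M} {s : ℝ}
    (h : flow X s x ∈ (extChartAt 𝓘(ℝ, E) σ).source) :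
    ContinuousAt (fun p : VField E M × M =>
      localRep p.1 σ (extChartAt 𝓘(ℝ, E) σ (flow p.1 s p.2))) (X, x) := by
  have h1 : ContinuousAt (fun p : VField E M × M => (p.1, extChartAt 𝓘(ℝ, E) σ (flow p.1 s p.2)))
      (X, x) :=
    continuousAt_fst.prodMk
      (ContinuousAt.comp (f := fun p : VField E M × M => flow p.1 s p.2)
        (continuousAt_extChartAt' h) (continuousAt_flow_fixed_time X s x))
  exact ContinuousAt.comp (f := fun p : VField E M × M =>
    (p.1, extChartAt 𝓘(ℝ, E) σ (flow p.1 s p.2))) (x := (X, x))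
    (continuousAt_localRep X σ ((extChartAt 𝓘(ℝ, E) σ).map_source h)) h1

omit [FiniteDimensional ℝ E] [IsManifold 𝓘(ℝ, E) ∞ M] [CompactSpace M] [T2Space M] in
theorem tendsto_of_tendsto_chart {σ : M} {γ : ℝ → M} {l : Filter ℝ}
    (h : ∀ᶠ t in l, γ t ∈ (extChartAt 𝓘(ℝ, E) σ).source)
    (ht : Tendsto (fun t => extChartAt 𝓘(ℝ, E) σ (γ t)) l (𝓝 (extChartAt 𝓘(ℝ, E) σ σ))) :
    Tendsto γ l (𝓝 σ) := by
  have h1 := (continuousAt_extChartAt_symm (I := 𝓘(ℝ, E)) σ).tendsto.comp ht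
  rw [extChartAt_to_inv] at h1
  refine h1.congr' (h.mono fun t ht => ?_)
  exact (extChartAt 𝓘(ℝ, E) σ).left_inv ht

/-- A positive orbit near `σ` along which the form stays nonpositive lies in the strong stable
manifold. -/
theorem mem_strongStableManifold_of_nonpos (X : VField E M) {σ : M} {r g₀ g₁ : ℝ}
    (h01 : g₀ < g₁) (h1 : g₁ < 0)
    (hgap : ∀ s ∈ exponents
      (fderiv ℝ (localRep X σ) (extChartAt 𝓘(ℝ, E) σ σ) : Module.End ℝ E), s ≤ r ∨ g₁ < s)
    {B : E →L[ℝ] E →L[ℝ] ℝ} (hB : ∀ v w, B v w = B w v) {c ρ κ : ℝ} (hc : 0 < c) (hκ : 0 < κ)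
    (hρt : Metric.closedBall (extChartAt 𝓘(ℝ, E) σ σ) ρ ⊆ (extChartAt 𝓘(ℝ, E) σ).target)
    (hL : ∀ z ∈ Metric.closedBall (extChartAt 𝓘(ℝ, E) σ σ) ρ,
      IsLyapunov B (fderiv ℝ (localRep X σ) z) g₀ c)
    (hlow : ∀ x ∈ chartClosedBall E σ ρ,
      κ * ‖extChartAt 𝓘(ℝ, E) σ x - extChartAt 𝓘(ℝ, E) σ σ‖ ≤
        ‖localRep X σ (extChartAt 𝓘(ℝ, E) σ x)‖) {y : M}
    (hy : ∀ t ≥ 0, flow X t y ∈ chartClosedBall E σ ρ ∧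
      B (localRep X σ (extChartAt 𝓘(ℝ, E) σ (flow X t y)))
        (localRep X σ (extChartAt 𝓘(ℝ, E) σ (flow X t y))) ≤ 0) :
    y ∈ strongStableManifold X σ r := by
  have : ProperSpace E := FiniteDimensional.proper_real E
  obtain ⟨K, hK0, hK, -⟩ := exists_localRep_bound X (isCompact_closedBall _ ρ) hρt
  set z₀ := extChartAt 𝓘(ℝ, E) σ σ with hz₀
  set v : ℝ → E := fun t => localRep X σ (extChartAt 𝓘(ℝ, E) σ (flow X t y)) with hv
  set a : ℝ → E →L[ℝ] E := fun t =>
    fderiv ℝ (localRep X σ) (extChartAt 𝓘(ℝ, E) σ (flow X t y)) with ha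
  have hva : ∀ t ≥ 0, HasDerivAt v (a t (v t)) t := fun t ht =>
    hasDerivAt_localRep_flow X (hy t ht).1.1
  obtain ⟨C, hC⟩ := exists_bound_of_nonpos hB hc hva (fun t ht => hL _ (hy t ht).1.2)
    (fun t ht => (hK _ (hy t ht).1.2).2) (fun t ht => (hy t ht).2)
  have hOO : ∀ {g : ℝ}, v =O[atTop] (fun t => Real.exp (g * t)) →
      (fun t => extChartAt 𝓘(ℝ, E) σ (flow X t y) - z₀) =O[atTop] fun t => Real.exp (g * t) := by
    intro g hg
    refine IsBigO.trans (IsBigO.of_bound κ⁻¹ ?_) hg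
    filter_upwards [eventually_ge_atTop 0] with t ht
    rw [← div_eq_inv_mul, le_div_iff₀ hκ, mul_comm]
    exact hlow _ (hy t ht).1
  have hv0 : v =O[atTop] (fun t => Real.exp (g₀ * t)) := by
    refine IsBigO.of_bound C ?_
    filter_upwards [eventually_ge_atTop 0] with t ht
    rw [Real.norm_of_nonneg (Real.exp_pos _).le]
    exact hC t ht
  have hexp : ∀ {g g' : ℝ}, g ≤ g' →
      (fun t => Real.exp (g * t)) =O[atTop] fun t => Real.exp (g' * t) := by
    intro g g' hg
    refine IsBigO.of_bound 1 ?_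
    filter_upwards [eventually_ge_atTop 0] with t ht
    rw [one_mul, Real.norm_of_nonneg (Real.exp_pos _).le, Real.norm_of_nonneg (Real.exp_pos _).le]
    gcongr
  have hlim : Tendsto (fun t => flow X t y) atTop (𝓝 σ) := by
    refine tendsto_of_tendsto_chart (E := E)
      ((eventually_ge_atTop 0).mono fun t ht => (hy t ht).1.1) ?_
    rw [tendsto_iff_norm_sub_tendsto_zero]
    refine ((hOO hv0).trans_tendsto ?_).norm.trans (by simp)
    have : Tendsto (fun t : ℝ => g₀ * t) atTop atBot :=
      tendsto_id.const_mul_atTop_of_neg (h01.trans h1)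
    exact Real.tendsto_exp_atBot.comp this
  refine ⟨hlim, fun c' hc' => hOO ?_⟩
  -- The form `B` gives only the rate `g₀`. For `c'` between `r` and `g₀` the rate is improved by a
  -- second form, for the larger gap `[c', g₁]`, which is available close to `σ` since the orbit has
  -- already been shown to converge.
  rcases le_or_gt g₀ c' with hgc | hgc
  · exact hv0.trans (hexp hgc)
  obtain ⟨B₂, hB₂, c₂, hc₂, hL₂, hL₂'⟩ := exists_lyapunov
    (fderiv ℝ (localRep X σ) z₀) (hgc.le.trans h01.le) (fun s hs hs' => by
      rcases hgap s hs with h | h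
      · exact absurd hs'.1 (by linarith)
      · exact absurd hs'.2 (by linarith))
  obtain ⟨ρ₂, hρ₂, hρ₂t, -, hev⟩ := exists_radius_isLyapunov X σ univ_mem B₂ hc₂
  have hev' := hev.self_of_nhds
  obtain ⟨t₁, ht₁⟩ := eventually_atTop.1 ((hlim.eventually
    ((isOpen_chartBall (E := E) σ ρ₂).mem_nhds (mem_chartBall_self σ hρ₂))).and
      (eventually_ge_atTop 0))
  have hz : ∀ t ≥ t₁, extChartAt 𝓘(ℝ, E) σ (flow X t y) ∈ Metric.closedBall z₀ ρ₂ := fun t ht =>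
    (chartBall_subset_closedBall σ ρ₂ (ht₁ t ht).1).2
  by_cases hpos : ∀ t ≥ t₁, B₂ (v t) (v t) ≤ 0
  · obtain ⟨C', hC'⟩ := exists_bound_of_nonpos hB₂ (half_pos hc₂)
      (fun t ht => hva t (ht₁ t ht).2) (fun t ht => hev' _ (hz t ht) _ hL₂)
      (fun t ht => (hK _ (hy t (ht₁ t ht).2).1.2).2) hpos
    refine IsBigO.of_bound C' ?_
    filter_upwards [eventually_ge_atTop t₁] with t ht
    rw [Real.norm_of_nonneg (Real.exp_pos _).le]
    exact hC' t ht
  -- A positive value of the second form would force growth at rate `g₁`, against the decay at rate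
  -- `g₀ < g₁`.
  · push Not at hpos
    obtain ⟨t₂, ht₂, hpos⟩ := hpos
    obtain ⟨κ', hκ', hgr⟩ := exists_growth_of_pos hB₂ (half_pos hc₂).le
      (fun t ht => hva t (ht₁ t (ht₂.trans ht)).2)
      (fun t ht => hev' _ (hz t (ht₂.trans ht)) _ hL₂') hpos
    exact absurd hv0 (not_isBigO_of_growth h01 hκ' hgr)

end Escape


/-! ### Positivity of the form along the maximal invariant set -/

section KeyLemma

variable {E M : Type*} [NormedAddCommGroup E] [NormedSpace ℝ E] [FiniteDimensional ℝ E]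
  [TopologicalSpace M] [ChartedSpace E M] [IsManifold 𝓘(ℝ, E) ∞ M] [CompactSpace M] [T2Space M]

/-- Being outside the closed ball, having a positive form inside its chart, and leaving `U` at a
given time are open conditions on the pair `(Y, y)`, so compactness of `S` gives a common time bound
and a common neighbourhood of `X`. The implication in the conclusion encodes "outside the ball or
positive". -/
theorem exists_escape_time (X : VField E M) {U : Set M} (hU : IsClosed U) {σ : M} {ρ : ℝ}
    {B : E →L[ℝ] E →L[ℝ] ℝ} {S : Set M} (hS : IsCompact S)
    (hρt : Metric.closedBall (extChartAt 𝓘(ℝ, E) σ σ) ρ ⊆ (extChartAt 𝓘(ℝ, E) σ).target)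
    (h : ∀ y ∈ S, y ∈ maximalInvariantSet X U → ∃ t ≥ 0, flow X t y ∈ chartClosedBall E σ ρ →
      0 < B (localRep X σ (extChartAt 𝓘(ℝ, E) σ (flow X t y)))
        (localRep X σ (extChartAt 𝓘(ℝ, E) σ (flow X t y)))) :
    ∃ T : ℝ, ∀ᶠ Y in 𝓝 X, ∀ y ∈ S, y ∈ maximalInvariantSet Y U →
      ∃ t ≥ 0, t ≤ T ∧ (flow Y t y ∈ chartClosedBall E σ ρ →
        0 < B (localRep Y σ (extChartAt 𝓘(ℝ, E) σ (flow Y t y)))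
          (localRep Y σ (extChartAt 𝓘(ℝ, E) σ (flow Y t y)))) := by
  have : ProperSpace E := FiniteDimensional.proper_real E
  refine hS.induction_on (p := fun S => ∃ T : ℝ, ∀ᶠ Y in 𝓝 X, ∀ y ∈ S,
      y ∈ maximalInvariantSet Y U → ∃ t ≥ 0, t ≤ T ∧ (flow Y t y ∈ chartClosedBall E σ ρ →
        0 < B (localRep Y σ (extChartAt 𝓘(ℝ, E) σ (flow Y t y)))
          (localRep Y σ (extChartAt 𝓘(ℝ, E) σ (flow Y t y))))) ⟨0, by simp⟩ ?_ ?_ ?_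
  · rintro s t hst ⟨T, hT⟩
    exact ⟨T, hT.mono fun Y hY y hy => hY y (hst hy)⟩
  · rintro s t ⟨T, hT⟩ ⟨T', hT'⟩
    refine ⟨max T T', ?_⟩
    filter_upwards [hT, hT'] with Y hY hY' y hy hyU
    rcases hy with hy | hy
    · obtain ⟨t, h0, h1, h2⟩ := hY y hy hyU
      exact ⟨t, h0, h1.trans (le_max_left _ _), h2⟩
    · obtain ⟨t, h0, h1, h2⟩ := hY' y hy hyU
      exact ⟨t, h0, h1.trans (le_max_right _ _), h2⟩
  · intro y hy
    suffices hev : ∃ T : ℝ, ∀ᶠ p : VField E M × M in 𝓝 (X, y), p.2 ∈ maximalInvariantSet p.1 U →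
        ∃ t ≥ 0, t ≤ T ∧ (flow p.1 t p.2 ∈ chartClosedBall E σ ρ →
          0 < B (localRep p.1 σ (extChartAt 𝓘(ℝ, E) σ (flow p.1 t p.2)))
            (localRep p.1 σ (extChartAt 𝓘(ℝ, E) σ (flow p.1 t p.2)))) by
      obtain ⟨T, hT⟩ := hev
      rw [nhds_prod_eq] at hT
      obtain ⟨P, hP, Q, hQ, hPQ⟩ := eventually_prod_iff.1 hT
      exact ⟨{y | Q y}, mem_nhdsWithin_of_mem_nhds hQ, T, hP.mono fun Y hY y hy => hPQ hY hy⟩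
    by_cases hyU : y ∈ maximalInvariantSet X U
    · obtain ⟨t, ht, h1⟩ := h y hy hyU
      refine ⟨t, ?_⟩
      by_cases hb : flow X t y ∈ chartClosedBall E σ ρ
      · have hc := continuousAt_localRep_flow X hb.1
        have hB : ContinuousAt (fun p : VField E M × M =>
            B (localRep p.1 σ (extChartAt 𝓘(ℝ, E) σ (flow p.1 t p.2)))
              (localRep p.1 σ (extChartAt 𝓘(ℝ, E) σ (flow p.1 t p.2)))) (X, y) :=
          (B.continuous.continuousAt.comp hc).clm_apply hc
        filter_upwards [hB.eventually (lt_mem_nhds (h1 hb))] with p hp _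
        exact ⟨t, ht, le_rfl, fun _ => hp⟩
      · have hcl : IsClosed (chartClosedBall E σ ρ) :=
          (isCompact_setOf_chart_mem (isCompact_closedBall _ ρ) hρt).isClosed
        filter_upwards [(continuousAt_flow_fixed_time X t y).eventually
          (hcl.isOpen_compl.mem_nhds hb)] with p hp _
        exact ⟨t, ht, le_rfl, fun h => absurd h hp⟩
    · rw [mem_maximalInvariantSet] at hyU
      push Not at hyU
      obtain ⟨t, ht⟩ := hyU
      -- Points near `y` are outside the maximal invariant set of nearby fields, so the value of the
      -- time bound is irrelevant here.
      refine ⟨0, ?_⟩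
      filter_upwards [(continuousAt_flow_fixed_time X t y).eventually
          (hU.isOpen_compl.mem_nhds ht)] with p hp hpU
      exact absurd (mem_maximalInvariantSet.1 hpU t) hp

/-- A negative orbit along which a Lyapunov form with negative rate is nonpositive leaves the
domain of the form. -/
theorem exists_backward_exit (Y : VField E M) {σ : M} {ρ g c C : ℝ} (hg : g < 0) (hc : 0 < c)
    {B : E →L[ℝ] E →L[ℝ] ℝ} (hB : ∀ v w, B v w = B w v)
    (hL : ∀ z ∈ Metric.closedBall (extChartAt 𝓘(ℝ, E) σ σ) ρ,
      IsLyapunov B (fderiv ℝ (localRep Y σ) z) g c)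
    (hC : ∀ z ∈ Metric.closedBall (extChartAt 𝓘(ℝ, E) σ σ) ρ, ‖localRep Y σ z‖ ≤ C)
    {x : M} (hx : Y x ≠ 0)
    (hQ : B (localRep Y σ (extChartAt 𝓘(ℝ, E) σ x)) (localRep Y σ (extChartAt 𝓘(ℝ, E) σ x)) ≤ 0) :
    ∃ t ≥ 0, flow Y (-t) x ∉ chartBall E σ ρ := by
  by_contra! hstay
  set v : ℝ → E := fun t => localRep Y σ (extChartAt 𝓘(ℝ, E) σ (flow Y t x)) with hv
  have hst : ∀ t ∈ Iic (0 : ℝ), flow Y t x ∈ chartClosedBall E σ ρ := fun t ht => by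
    have := hstay (-t) (by simpa using ht)
    rw [neg_neg] at this
    exact chartBall_subset_closedBall σ ρ this
  have hmono := strictMonoOn_scaled_form (g := g) hB hc (convex_Iic (0 : ℝ))
    (v := v) (a := fun t => fderiv ℝ (localRep Y σ) (extChartAt 𝓘(ℝ, E) σ (flow Y t x)))
    (fun t ht => hasDerivAt_localRep_flow Y (hst t ht).1) (fun t ht => hL _ (hst t ht).2)
    (fun t ht h0 => flow_ne_zero Y hx t
      ((localRep_extChartAt_eq_zero_iff Y (hst t ht).1).1 h0))
  have hv0 : B (v 0) (v 0) ≤ 0 := by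
    simp only [hv, flow_zero]
    exact hQ
  -- The form may vanish at time `0`; strict monotonicity makes it negative one unit of time
  -- earlier.
  set q := Real.exp (-2 * g * (-1)) * B (v (-1)) (v (-1)) with hq
  have hq0 : q < 0 := by
    have h1 := hmono (a := -1) (b := 0) (by simp) (by simp) (by norm_num)
    simp only [mul_zero, Real.exp_zero, one_mul] at h1
    exact h1.trans_le hv0
  have hlow : ∀ t ≤ -1, -(‖B‖ * C ^ 2) * Real.exp (-2 * g * t) ≤ q := by
    intro t ht
    have ht0 : t ∈ Iic (0 : ℝ) := by simp only [mem_Iic]; linarith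
    have h1 := hmono.monotoneOn ht0 (b := -1) (by simp) ht
    have h2 : -(‖B‖ * C ^ 2) ≤ B (v t) (v t) := by
      have h3 : |B (v t) (v t)| ≤ ‖B‖ * ‖v t‖ * ‖v t‖ := B.le_opNorm₂ _ _
      have h4 := hC _ (hst t ht0).2
      have hC0 : 0 ≤ C := (norm_nonneg _).trans h4
      have h5 : ‖B‖ * ‖v t‖ * ‖v t‖ ≤ ‖B‖ * C ^ 2 := by
        rw [mul_assoc, sq]
        gcongr
      exact (neg_le_neg (h3.trans h5)).trans (neg_abs_le _)
    refine le_trans ?_ h1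
    rw [mul_comm]
    gcongr
  -- Since `g < 0`, the weight tends to `0` in the past. A bounded field would force the scaled form
  -- to have nonnegative limit, but monotonicity keeps it below `q < 0`.
  have hlim : Tendsto (fun t : ℝ => -(‖B‖ * C ^ 2) * Real.exp (-2 * g * t)) atBot (𝓝 0) := by
    have h1 : Tendsto (fun t : ℝ => -2 * g * t) atBot atBot :=
      tendsto_id.const_mul_atBot (by linarith)
    simpa using (Real.tendsto_exp_atBot.comp h1).const_mul (-(‖B‖ * C ^ 2))
  exact absurd (le_of_tendsto hlim ((eventually_le_atBot (-1)).mono hlow)) (not_le.2 hq0)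

/-- Near a singular point with escaping strong stable manifold, the Lyapunov form is positive on
the vector field along the maximal invariant set, also for perturbed vector fields. -/
theorem eventually_form_pos (X : VField E M) {U : Set M} (hU : IsClosed U) {σ : M} (hσ : X σ = 0)
    (hyp : (0 : ℝ) ∉ exponents
      (fderiv ℝ (localRep X σ) (extChartAt 𝓘(ℝ, E) σ σ) : Module.End ℝ E))
    {r g₀ g₁ : ℝ} (h01 : g₀ < g₁) (h1 : g₁ < 0)
    (hgap : ∀ s ∈ exponents
      (fderiv ℝ (localRep X σ) (extChartAt 𝓘(ℝ, E) σ σ) : Module.End ℝ E), s ≤ r ∨ g₁ < s)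
    (hesc : maximalInvariantSet X U ∩ strongStableManifold X σ r = {σ})
    {B : E →L[ℝ] E →L[ℝ] ℝ} (hB : ∀ v w, B v w = B w v) {c : ℝ} (hc : 0 < c)
    (hL : IsLyapunov B (fderiv ℝ (localRep X σ) (extChartAt 𝓘(ℝ, E) σ σ)) g₀ c) :
    ∀ᶠ p : VField E M × M in 𝓝 (X, σ), p.2 ∈ maximalInvariantSet p.1 U → p.1 p.2 ≠ 0 →
      0 < B (localRep p.1 σ (extChartAt 𝓘(ℝ, E) σ p.2))
        (localRep p.1 σ (extChartAt 𝓘(ℝ, E) σ p.2)) := by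
  have : ProperSpace E := FiniteDimensional.proper_real E
  obtain ⟨κ, hκ, hlow⟩ := eventually_norm_localRep_ge X hσ hyp
  obtain ⟨ρ, hρ, hρt, hρW, hLY⟩ := exists_radius_isLyapunov X σ hlow B hc
  obtain ⟨C, hC0, -, hCY⟩ := exists_localRep_bound X (isCompact_closedBall _ ρ) hρt
  have hS : IsCompact (chartSphere E σ ρ) :=
    isCompact_setOf_chart_mem (isCompact_sphere _ ρ) (Metric.sphere_subset_closedBall.trans hρt)
  -- Were there no such time for `X`, the point of the sphere would lie in the escaping strong
  -- stable manifold and in `Λ_{X,U}`, so it would be `σ`.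
  obtain ⟨T₀, hT₀⟩ := exists_escape_time X hU (B := B) hS hρt (fun y hy hyU => by
    by_contra! hcon
    have hmem := mem_strongStableManifold_of_nonpos X h01 h1 hgap hB (half_pos hc) hκ hρt
      (fun z hz => hLY.self_of_nhds z hz _ hL) (fun x hx => hρW hx) hcon
    have hyσ : y = σ := by
      have : y ∈ maximalInvariantSet X U ∩ strongStableManifold X σ r := ⟨hyU, hmem⟩
      rwa [hesc] at this
    have := hy.2
    rw [hyσ, Metric.mem_sphere, dist_self] at this
    exact hρ.ne this)
  -- `σ` is fixed by the flow of `X`, so backward orbits of nearby fields from nearby points stay in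
  -- the ball up to the time `T₀`, chosen beforehand. Hence the time `T` of the last entry through
  -- the sphere exceeds `T₀`.
  have hstay : ∀ᶠ p : VField E M × M in 𝓝 (X, σ), ∀ t ∈ Icc 0 T₀,
      flow p.1 (-t) p.2 ∈ chartBall E σ ρ := by
    refine isCompact_Icc.eventually_forall_of_forall_eventually fun t ht => ?_
    have hcont : ContinuousAt (fun q : (VField E M × M) × ℝ => flow q.1.1 (-q.2) q.1.2)
        ((X, σ), t) :=
      ContinuousAt.comp (f := fun q : (VField E M × M) × ℝ => (q.1.1, -q.2, q.1.2))
        (g := fun p : VField E M × ℝ × M => flow p.1 p.2.1 p.2.2) (x := ((X, σ), t))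
        (continuousAt_flow X (-t) σ) (by fun_prop)
    refine hcont.eventually ((isOpen_chartBall σ ρ).mem_nhds ?_)
    simp only
    rw [flow_of_eq_zero X hσ]
    exact mem_chartBall_self σ hρ
  have hball : ∀ᶠ p : VField E M × M in 𝓝 (X, σ), p.2 ∈ chartBall E σ ρ :=
    continuousAt_snd.eventually ((isOpen_chartBall σ ρ).mem_nhds (mem_chartBall_self σ hρ))
  filter_upwards [hstay, hball, continuousAt_fst.eventually hLY, continuousAt_fst.eventually hCY,
    continuousAt_fst.eventually hT₀] with p hp hpb hpL hpC hpT hpU hp0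
  by_contra! hQ
  obtain ⟨Y, x⟩ := p
  simp only at hp hpb hpL hpC hpT hpU hp0 hQ
  obtain ⟨t, ht0, ht⟩ := exists_backward_exit Y (h01.trans h1) (half_pos hc) hB
    (fun z hz => hpL z hz _ hL) hpC hp0 hQ
  obtain ⟨T, hT0, -, hTs, hTb⟩ := exists_first_exit hρt (γ := fun t => flow Y (-t) x)
    ((continuous_flow_time Y x).comp continuous_neg) (by simpa [flow_zero] using hpb) ht0 ht
  have hTT : T₀ < T := by
    by_contra! hTT
    have h2 := (hp T ⟨hT0.le, hTT⟩).2
    have h3 := hTs.2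
    rw [Metric.mem_sphere] at h3
    rw [Metric.mem_ball, h3] at h2
    exact lt_irrefl _ h2
  -- Restarting at the entry point on the sphere, the form becomes positive within time `T₀ < T`,
  -- while the orbit is still in the ball; monotonicity carries positivity to time `0`.
  obtain ⟨s, hs0, hsT, hs⟩ := hpT _ hTs (flow_mem_maximalInvariantSet hpU _)
  have hst : flow Y s (flow Y (-T) x) = flow Y (-(T - s)) x := by
    rw [← flow_add]
    congr 1
    ring
  rw [hst] at hs
  have hs' := hs (hTb (T - s) ⟨by linarith, by linarith⟩)
  have hst' : ∀ t ∈ Icc (-T) 0, flow Y t x ∈ chartClosedBall E σ ρ := fun t ht => by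
    have := hTb (-t) ⟨by linarith [ht.2], by linarith [ht.1]⟩
    simpa using this
  have hmono := monotoneOn_scaled_form (g := g₀) hB (half_pos hc).le (convex_Icc (-T) 0)
    (v := fun t => localRep Y σ (extChartAt 𝓘(ℝ, E) σ (flow Y t x)))
    (a := fun t => fderiv ℝ (localRep Y σ) (extChartAt 𝓘(ℝ, E) σ (flow Y t x)))
    (fun t ht => hasDerivAt_localRep_flow Y (hst' t ht).1)
    (fun t ht => hpL _ (hst' t ht).2 _ hL)
  have h5 := hmono (a := -(T - s)) (b := 0) ⟨by linarith, by linarith⟩ ⟨by linarith, le_rfl⟩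
    (by linarith)
  simp only [mul_zero, Real.exp_zero, one_mul, flow_zero] at h5
  exact absurd (h5.trans hQ) (not_le.2 (mul_pos (Real.exp_pos _) hs'))

end KeyLemma


/-! ### Singular points of perturbed vector fields -/

section Perturb

variable {E M : Type*} [NormedAddCommGroup E] [NormedSpace ℝ E] [FiniteDimensional ℝ E]
  [TopologicalSpace M] [ChartedSpace E M] [IsManifold 𝓘(ℝ, E) ∞ M]

omit [FiniteDimensional ℝ E] in
-- At a zero of `F` the product rule needs only continuity of `Ψ`: the missing term would be the
-- derivative of `Ψ` applied to `F w = 0`.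
theorem hasFDerivAt_clm_apply_of_eq_zero {Ψ : E → E →L[ℝ] E} {F : E → E} {A : E →L[ℝ] E} {w : E}
    (hΨ : ContinuousAt Ψ w) (hF : HasFDerivAt F A w) (h0 : F w = 0) :
    HasFDerivAt (fun z => Ψ z (F z)) ((Ψ w).comp A) w := by
  rw [hasFDerivAt_iff_isLittleO]
  have h1 : (fun z => Ψ z - Ψ w) =o[𝓝 w] fun _ => (1 : ℝ) := by
    rw [isLittleO_one_iff]
    exact tendsto_sub_nhds_zero_iff.2 hΨ
  have h2 : F =O[𝓝 w] fun z => z - w := by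
    simpa [h0] using hF.isBigO_sub
  have h3 : (fun z => (Ψ z - Ψ w) (F z)) =o[𝓝 w] fun z => z - w := by
    have h4 : (fun z => (Ψ z - Ψ w) (F z)) =O[𝓝 w] fun z => ‖Ψ z - Ψ w‖ * ‖F z‖ :=
      IsBigO.of_bound 1 (Eventually.of_forall fun z => by
        rw [one_mul, Real.norm_of_nonneg (by positivity)]
        exact (Ψ z - Ψ w).le_opNorm _)
    refine h4.trans_isLittleO ?_
    have h5 := h1.norm_left.mul_isBigO h2.norm_norm
    simp only [one_mul] at h5
    exact h5.of_norm_right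
  have h6 : (fun z => Ψ w (F z - F w - A (z - w))) =o[𝓝 w] fun z => z - w :=
    ((Ψ w).isBigO_comp _ _).trans_isLittleO hF.isLittleO
  refine (h3.add h6).congr_left fun z => ?_
  simp only [h0, sub_zero, map_sub, map_zero, sub_apply, ContinuousLinearMap.comp_apply]
  abel

omit [FiniteDimensional ℝ E] in
theorem localRep_coordChange (Y : VField E M) {x σ z : M}
    (hx : z ∈ (extChartAt 𝓘(ℝ, E) x).source) (hσ : z ∈ (extChartAt 𝓘(ℝ, E) σ).source) :
    localRep Y σ (extChartAt 𝓘(ℝ, E) σ z) =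
      tangentCoordChange 𝓘(ℝ, E) x σ z (localRep Y x (extChartAt 𝓘(ℝ, E) x z)) := by
  rw [localRep_extChartAt Y hσ, localRep_extChartAt Y hx]
  exact (tangentCoordChange_comp ⟨⟨mem_extChartAt_source z, hx⟩, hσ⟩).symm

omit [FiniteDimensional ℝ E] in
theorem hasFDerivAt_coordChange {x σ : M} (hs : x ∈ (extChartAt 𝓘(ℝ, E) σ).source) :
    HasFDerivAt (extChartAt 𝓘(ℝ, E) σ ∘ (extChartAt 𝓘(ℝ, E) x).symm)
      (tangentCoordChange 𝓘(ℝ, E) x σ x) (extChartAt 𝓘(ℝ, E) x x) := by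
  have h := hasFDerivWithinAt_tangentCoordChange (I := 𝓘(ℝ, E)) (x := x) (y := σ) (z := x)
    ⟨mem_extChartAt_source x, hs⟩
  simpa using h

omit [FiniteDimensional ℝ E] in
/-- The coordinate change conjugates the linear parts of a vector field at a singular point. -/
theorem tangentCoordChange_fderiv_localRep (Y : VField E M) {x σ : M} (h0 : Y x = 0)
    (hs : x ∈ (extChartAt 𝓘(ℝ, E) σ).source) (v : E) :
    tangentCoordChange 𝓘(ℝ, E) x σ x (fderiv ℝ (localRep Y x) (extChartAt 𝓘(ℝ, E) x x) v) =
      fderiv ℝ (localRep Y σ) (extChartAt 𝓘(ℝ, E) σ x) (tangentCoordChange 𝓘(ℝ, E) x σ x v) := by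
  set w := extChartAt 𝓘(ℝ, E) x x with hw
  have hsymm : (extChartAt 𝓘(ℝ, E) x).symm w = x := extChartAt_to_inv x
  have hF : HasFDerivAt (localRep Y x) (fderiv ℝ (localRep Y x) w) w :=
    ((contDiffAt_localRep Y (mem_extChartAt_target x)).differentiableAt one_ne_zero).hasFDerivAt
  have hx : x ∈ (extChartAt 𝓘(ℝ, E) x).source := mem_extChartAt_source x
  have hcs : ContinuousAt (extChartAt 𝓘(ℝ, E) x).symm w := continuousAt_extChartAt_symm x
  have hΨ : ContinuousAt (fun z => tangentCoordChange 𝓘(ℝ, E) x σ ((extChartAt 𝓘(ℝ, E) x).symm z))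
      w := by
    have h1 : ContinuousAt (tangentCoordChange 𝓘(ℝ, E) x σ) ((extChartAt 𝓘(ℝ, E) x).symm w) := by
      rw [hsymm]
      exact (continuousOn_tangentCoordChange x σ).continuousAt (inter_mem
        (extChartAt_source_mem_nhds x) ((isOpen_extChartAt_source σ).mem_nhds hs))
    exact h1.comp hcs
  have hl := hasFDerivAt_clm_apply_of_eq_zero hΨ hF
    ((localRep_extChartAt_eq_zero_iff Y hx).2 h0)
  have hφ := hasFDerivAt_coordChange (E := E) hs
  have hG : HasFDerivAt (localRep Y σ) (fderiv ℝ (localRep Y σ) (extChartAt 𝓘(ℝ, E) σ x))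
      ((extChartAt 𝓘(ℝ, E) σ ∘ (extChartAt 𝓘(ℝ, E) x).symm) w) := by
    simp only [Function.comp, hsymm]
    exact ((contDiffAt_localRep Y ((extChartAt 𝓘(ℝ, E) σ).map_source hs)).differentiableAt
      one_ne_zero).hasFDerivAt
  have hr := hG.comp w hφ
  have heq : (localRep Y σ ∘ extChartAt 𝓘(ℝ, E) σ ∘ (extChartAt 𝓘(ℝ, E) x).symm) =ᶠ[𝓝 w]
      fun z => tangentCoordChange 𝓘(ℝ, E) x σ ((extChartAt 𝓘(ℝ, E) x).symm z)
        (localRep Y x z) := by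
    have hsn : ∀ᶠ z in 𝓝 w, (extChartAt 𝓘(ℝ, E) x).symm z ∈ (extChartAt 𝓘(ℝ, E) σ).source :=
      hcs.eventually (by
        rw [hsymm]
        exact (isOpen_extChartAt_source σ).mem_nhds hs)
    filter_upwards [hsn, (isOpen_chart_target x).mem_nhds (mem_extChartAt_target x)] with z hz hzt
    have h1 := localRep_coordChange Y ((extChartAt 𝓘(ℝ, E) x).map_target hzt) hz
    rwa [(extChartAt 𝓘(ℝ, E) x).right_inv hzt] at h1
  have h2 := (hr.congr_of_eventuallyEq heq.symm).unique hl
  have h3 := DFunLike.congr_fun h2 v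
  simp only [ContinuousLinearMap.comp_apply, hsymm] at h3
  exact h3.symm

omit [FiniteDimensional ℝ E] in
theorem localRep_isBigO (Y : VField E M) {x σ : M} (h0 : Y x = 0)
    (hs : x ∈ (extChartAt 𝓘(ℝ, E) σ).source) :
    (fun y => localRep Y σ (extChartAt 𝓘(ℝ, E) σ y)) =O[𝓝 x]
      fun y => extChartAt 𝓘(ℝ, E) x y - extChartAt 𝓘(ℝ, E) x x := by
  have hφ := hasFDerivAt_coordChange (E := E) hs
  have hG : HasFDerivAt (localRep Y σ) (fderiv ℝ (localRep Y σ) (extChartAt 𝓘(ℝ, E) σ x))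
      ((extChartAt 𝓘(ℝ, E) σ ∘ (extChartAt 𝓘(ℝ, E) x).symm) (extChartAt 𝓘(ℝ, E) x x)) := by
    simp only [Function.comp, extChartAt_to_inv]
    exact ((contDiffAt_localRep Y ((extChartAt 𝓘(ℝ, E) σ).map_source hs)).differentiableAt
      one_ne_zero).hasFDerivAt
  have hr := (hG.comp _ hφ).isBigO_sub
  have h1 := hr.comp_tendsto (continuousAt_extChartAt (I := 𝓘(ℝ, E)) x)
  refine h1.congr' ?_ EventuallyEq.rfl
  filter_upwards [extChartAt_source_mem_nhds (I := 𝓘(ℝ, E)) x] with y hy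
  simp only [Function.comp, extChartAt_to_inv, (extChartAt 𝓘(ℝ, E) x).left_inv hy,
    (localRep_extChartAt_eq_zero_iff Y hs).2 h0, sub_zero]

variable [CompactSpace M] [T2Space M]

/-- A regular point of `Λ_{Y,U}` whose orbit converges to `x` eventually has positive form, so the
field grows at least like `exp(gt)` along its orbit. But the field is bounded by the distance to
`x`, which decays at any rate above `r`. -/
theorem escaping_of_form_pos (Y : VField E M) {U : Set M} {x σ : M} (h0 : Y x = 0) (hxU : x ∈ U)
    {B : E →L[ℝ] E →L[ℝ] ℝ} (hB : ∀ v w, B v w = B w v) {c g : ℝ} (hc : 0 < c)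
    (hs : ∀ᶠ y in 𝓝 x, y ∈ (extChartAt 𝓘(ℝ, E) σ).source)
    (hL : ∀ᶠ y in 𝓝 x, IsLyapunov B (fderiv ℝ (localRep Y σ) (extChartAt 𝓘(ℝ, E) σ y)) g c)
    (hpos : ∀ᶠ y in 𝓝 x, y ∈ maximalInvariantSet Y U → Y y ≠ 0 →
      0 < B (localRep Y σ (extChartAt 𝓘(ℝ, E) σ y)) (localRep Y σ (extChartAt 𝓘(ℝ, E) σ y)))
    {r : ℝ} (hr : r < g) :
    maximalInvariantSet Y U ∩ strongStableManifold Y x r = {x} := by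
  refine Subset.antisymm ?_ ?_
  · rintro y ⟨hyU, hy, hyr⟩
    rw [mem_singleton_iff]
    have hy0 : Y y = 0 := by
      by_contra hy0
      obtain ⟨t₀, ht₀⟩ := eventually_atTop.1 (hy.eventually (hs.and (hL.and hpos)))
      obtain ⟨κ, hκ, hgr⟩ := exists_growth_of_pos hB hc.le
        (v := fun t => localRep Y σ (extChartAt 𝓘(ℝ, E) σ (flow Y t y)))
        (fun t ht => hasDerivAt_localRep_flow Y (ht₀ t ht).1) (fun t ht => (ht₀ t ht).2.1)
        ((ht₀ t₀ le_rfl).2.2 (flow_mem_maximalInvariantSet hyU _) (flow_ne_zero Y hy0 _))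
      -- The rate must lie strictly between `r` and `g`, because membership in the strong stable
      -- manifold gives only rates above `r`.
      refine not_isBigO_of_growth (c := (r + g) / 2) (by linarith) hκ hgr ?_
      exact ((localRep_isBigO Y h0 hs.self_of_nhds).comp_tendsto hy).trans
        (hyr ((r + g) / 2) (by linarith))
    have h1 : (fun t => flow Y t y) = fun _ => y := funext fun t => flow_of_eq_zero Y hy0 t
    rw [h1] at hy
    exact tendsto_nhds_unique tendsto_const_nhds hy
  · rintro y rfl
    refine ⟨sing_mem_maximalInvariantSet h0 hxU, ?_, fun c' _ => ?_⟩
    · simp only [flow_of_eq_zero Y h0]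
      exact tendsto_const_nhds
    · simp only [flow_of_eq_zero Y h0, sub_self]
      exact isBigO_zero _ _

/-- Every exponent below `g₁` has its space inside the escaping stable space, so central exponents
are at least `g₁`. The second rate `g₀ < g₁` makes this strict, as backward decay requires. -/
theorem centralSpace_le_bwdDecay (Y : VField E M) {U : Set M} {x : M} {g₀ g₁ : ℝ} (h01 : g₀ < g₁)
    (h1 : g₁ < 0)
    (hesc : ∀ r < g₁, maximalInvariantSet Y U ∩ strongStableManifold Y x r = {x}) {w : E}
    (hw : w ∈ centralSpace Y U x) :
    w ∈ bwdDecay (fderiv ℝ (localRep Y x) (extChartAt 𝓘(ℝ, E) x x)) g₀ := by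
  have hle : LE.le (α := Submodule ℝ E) (centralSpace Y U x)
      (bwdDecay (fderiv ℝ (localRep Y x) (extChartAt 𝓘(ℝ, E) x x)) g₀) := by
    refine iSup₂_le fun r hr => ?_
    have hr1 : g₁ ≤ r := by
      by_contra! hlt
      refine hr.2.1 ?_
      refine le_trans ?_ (le_iSup₂_of_le r ⟨hr.1, hlt.trans h1, hesc r hlt⟩ le_rfl)
      exact le_iSup₂_of_le r le_rfl le_rfl
    exact exponentSpace_le_bwdDecay (fderiv ℝ (localRep Y x) (extChartAt 𝓘(ℝ, E) x x)) (h01.trans_le hr1)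
  exact hle hw

/-- Near a singular point with escaping strong stable manifold, the Lyapunov form is positive on
the central spaces of the singular points of the perturbed vector fields. -/
theorem eventually_form_pos_centralSpace (X : VField E M) {U : Set M} (hU : IsClosed U) {σ : M}
    (hσ : X σ = 0)
    (hyp : (0 : ℝ) ∉ exponents
      (fderiv ℝ (localRep X σ) (extChartAt 𝓘(ℝ, E) σ σ) : Module.End ℝ E))
    {r g₀ g₁ : ℝ} (h01 : g₀ < g₁) (h1 : g₁ < 0)
    (hgap : ∀ s ∈ exponents
      (fderiv ℝ (localRep X σ) (extChartAt 𝓘(ℝ, E) σ σ) : Module.End ℝ E), s ≤ r ∨ g₁ < s)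
    (hesc : maximalInvariantSet X U ∩ strongStableManifold X σ r = {σ})
    {B : E →L[ℝ] E →L[ℝ] ℝ} (hB : ∀ v w, B v w = B w v) {c : ℝ} (hc : 0 < c)
    (hL₀ : IsLyapunov B (fderiv ℝ (localRep X σ) (extChartAt 𝓘(ℝ, E) σ σ)) g₀ c)
    (hL₁ : IsLyapunov B (fderiv ℝ (localRep X σ) (extChartAt 𝓘(ℝ, E) σ σ)) g₁ c) :
    ∀ᶠ p : VField E M × M in 𝓝 (X, σ), p.2 ∈ U → p.1 p.2 = 0 →
      ∀ w ∈ centralSpace p.1 U p.2, w ≠ 0 →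
        0 < B (tangentCoordChange 𝓘(ℝ, E) p.2 σ p.2 w)
          (tangentCoordChange 𝓘(ℝ, E) p.2 σ p.2 w) := by
  have hK := eventually_form_pos X hU hσ hyp h01 h1 hgap hesc hB hc hL₀
  obtain ⟨ρ, hρ, hρt, -, hLY⟩ := exists_radius_isLyapunov X σ univ_mem B hc
  have hball : ∀ᶠ p : VField E M × M in 𝓝 (X, σ), p.2 ∈ chartBall E σ ρ :=
    continuousAt_snd.eventually ((isOpen_chartBall σ ρ).mem_nhds (mem_chartBall_self σ hρ))
  -- For a fixed `Y` and singular point `x`, positivity is needed on a whole neighbourhood of `x`,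
  -- hence the iterated neighbourhood filter.
  filter_upwards [eventually_eventually_nhds.2 hK, continuousAt_fst.eventually hLY, hball]
    with p hpK hpL hpb hpU hp0 w hw hw0
  obtain ⟨Y, x⟩ := p
  simp only at hpL hpb hpU hp0 hw ⊢
  have hnear : ∀ᶠ y in 𝓝 x, y ∈ chartClosedBall E σ ρ :=
    mem_of_superset ((isOpen_chartBall σ ρ).mem_nhds hpb) (chartBall_subset_closedBall σ ρ)
  have hpos : ∀ᶠ y in 𝓝 x, y ∈ maximalInvariantSet Y U → Y y ≠ 0 →
      0 < B (localRep Y σ (extChartAt 𝓘(ℝ, E) σ y)) (localRep Y σ (extChartAt 𝓘(ℝ, E) σ y)) :=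
    ((Continuous.prodMk_right Y).tendsto x).eventually hpK
  have hesc' : ∀ r < g₁, maximalInvariantSet Y U ∩ strongStableManifold Y x r = {x} := fun r hr =>
    escaping_of_form_pos Y hp0 hpU hB (half_pos hc) (hnear.mono fun y hy => hy.1)
      (hnear.mono fun y hy => hpL _ hy.2 _ hL₁) hpos hr
  have hwd := centralSpace_le_bwdDecay Y h01 h1 hesc' hw
  -- The central space at `x` lives in the chart at `x` and the form in the chart at `σ`; the
  -- coordinate change conjugates the two linear parts.
  have hτ := map_mem_bwdDecay (L := tangentCoordChange 𝓘(ℝ, E) x σ x)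
    (fun v => tangentCoordChange_fderiv_localRep Y hp0 hpb.1 v) hwd
  refine form_pos_of_mem_bwdDecay hB (half_pos hc)
    (hpL _ (chartBall_subset_closedBall σ ρ hpb).2 _ hL₀) (fun h => hw0 ?_) hτ
  exact tangentCoordChange_injective ⟨mem_extChartAt_source x, hpb.1⟩ (h.trans (map_zero _).symm)

end Perturb


/-! ### Time reversal -/

section Reversal

theorem neg_mem_exponents_neg {V : Type*} [AddCommGroup V] [Module ℝ V] [Module.Finite ℝ V]
    {A : Module.End ℝ V} {r : ℝ} (h : r ∈ exponents A) : -r ∈ exponents (-A) := by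
  obtain ⟨z, hz, rfl⟩ := h
  refine ⟨-z, ?_, Complex.neg_re z⟩
  let b := Module.Free.chooseBasis ℝ V
  rw [← LinearMap.charpoly_toMatrix _ b, ← Matrix.charpoly_map, Polynomial.IsRoot.def,
    Matrix.eval_charpoly] at hz ⊢
  have h1 : Matrix.scalar _ (-z) - (LinearMap.toMatrix b b (-A)).map (algebraMap ℝ ℂ) =
      -(Matrix.scalar _ z - (LinearMap.toMatrix b b A).map (algebraMap ℝ ℂ)) := by
    rw [map_neg, map_neg, neg_sub, sub_eq_add_neg, sub_eq_add_neg]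
    ext i j
    simp [add_comm]
  have hz' := hz
  rw [h1, Matrix.det_neg, hz', mul_zero]

theorem finite_exponents {V : Type*} [AddCommGroup V] [Module ℝ V] [Module.Finite ℝ V]
    (A : Module.End ℝ V) : (exponents A).Finite := by
  have h : (A.charpoly.map (algebraMap ℝ ℂ)) ≠ 0 := (A.charpoly_monic.map _).ne_zero
  refine ((Polynomial.finite_setOfPred_isRoot h).image Complex.re).subset ?_
  rintro r ⟨z, hz, rfl⟩
  exact ⟨z, hz, rfl⟩

variable {E M : Type*} [NormedAddCommGroup E] [NormedSpace ℝ E] [FiniteDimensional ℝ E]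
  [TopologicalSpace M] [ChartedSpace E M] [IsManifold 𝓘(ℝ, E) ∞ M]

omit [FiniteDimensional ℝ E] in
theorem linearPart_neg (X : VField E M) (σ : M) : linearPart (-X) σ = -linearPart X σ :=
  LinearMap.ext fun v => DFunLike.congr_fun (fderiv_localRep_neg X σ (mem_extChartAt_target σ)) v

variable [CompactSpace M] [T2Space M]

theorem strongStableManifold_neg (X : VField E M) (σ : M) (r : ℝ) :
    strongStableManifold (-X) σ r = strongUnstableManifold X σ (-r) := by
  ext x
  constructor
  · rintro ⟨h1, h2⟩
    simp only [flow_neg_vField] at h1 h2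
    refine ⟨by simpa [Function.comp_def] using h1.comp tendsto_neg_atBot_atTop, fun c hc => ?_⟩
    simpa [Function.comp_def] using
      (h2 (-c) (by simp only [gt_iff_lt]; linarith)).comp_tendsto tendsto_neg_atBot_atTop
  · rintro ⟨h1, h2⟩
    refine ⟨?_, fun c hc => ?_⟩
    · simpa [Function.comp_def, flow_neg_vField] using h1.comp tendsto_neg_atTop_atBot
    · simpa [Function.comp_def, flow_neg_vField] using
        (h2 (-c) (by simp only [gt_iff_lt] at hc; linarith)).comp_tendsto tendsto_neg_atTop_atBot

theorem escapingStableSpace_neg (X : VField E M) (U : Set M) (σ : M) :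
    escapingStableSpace (-X) U σ = escapingUnstableSpace X U σ := by
  apply le_antisymm
  · refine iSup₂_le fun r hr => iSup₂_le fun s hs => ?_
    obtain ⟨h1, h2, h3⟩ := hr
    rw [linearPart_neg] at h1 ⊢
    rw [maximalInvariantSet_neg, strongStableManifold_neg] at h3
    have h4 := neg_mem_exponents_neg h1
    rw [neg_neg] at h4
    refine le_iSup₂_of_le (-r) ⟨h4, by linarith, h3⟩ (le_iSup₂_of_le (-s) (neg_le_neg hs) ?_)
    rw [← exponentSpace_neg, neg_neg]
  · refine iSup₂_le fun r hr => iSup₂_le fun s hs => ?_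
    obtain ⟨h1, h2, h3⟩ := hr
    refine le_iSup₂_of_le (-r) ⟨?_, by linarith, ?_⟩ (le_iSup₂_of_le (-s) (neg_le_neg hs) ?_)
    · rw [linearPart_neg]
      exact neg_mem_exponents_neg h1
    · rwa [maximalInvariantSet_neg, strongStableManifold_neg, neg_neg]
    · rw [linearPart_neg, exponentSpace_neg]

theorem escapingUnstableSpace_neg (X : VField E M) (U : Set M) (σ : M) :
    escapingUnstableSpace (-X) U σ = escapingStableSpace X U σ := by
  rw [← escapingStableSpace_neg, neg_neg]

theorem centralSpace_neg_le (X : VField E M) (U : Set M) (σ : M) :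
    centralSpace (-X) U σ ≤ centralSpace X U σ := by
  refine iSup₂_le fun r hr => ?_
  obtain ⟨h1, h2, h3⟩ := hr
  rw [linearPart_neg] at h1 h2 h3 ⊢
  rw [escapingStableSpace_neg] at h2
  rw [escapingUnstableSpace_neg] at h3
  have h4 := neg_mem_exponents_neg h1
  have h5 : exponentSpace (-linearPart X σ) r = exponentSpace (linearPart X σ) (-r) := by
    rw [← exponentSpace_neg (linearPart X σ), neg_neg]
  rw [neg_neg] at h4
  rw [h5] at h2 h3 ⊢
  exact le_iSup₂_of_le (-r) ⟨h4, h3, h2⟩ le_rfl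

theorem centralSpace_neg (X : VField E M) (U : Set M) (σ : M) :
    centralSpace (-X) U σ = centralSpace X U σ := by
  refine le_antisymm (centralSpace_neg_le X U σ) ?_
  have h := centralSpace_neg_le (-X) U σ
  rwa [neg_neg] at h

end Reversal

/-! ### Separation of a vector from the central space -/

section Separation

variable {E M : Type*} [NormedAddCommGroup E] [NormedSpace ℝ E] [FiniteDimensional ℝ E]
  [TopologicalSpace M] [ChartedSpace E M] [IsManifold 𝓘(ℝ, E) ∞ M] [CompactSpace M] [T2Space M]

/-- `g` plays the role of a cut between escaping stable exponents and the rest: `fwdDecay A g`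
stands for `E^ss` and `bwdDecay A g` for `E^c ⊕ E^uu`. -/
theorem exists_stable_gap (X : VField E M) (U : Set M) (σ : M) {A : E →L[ℝ] E}
    (hA : A = fderiv ℝ (localRep X σ) (extChartAt 𝓘(ℝ, E) σ σ)) (u : E) :
    ∃ g < 0, (∀ r ∈ exponents (A : Module.End ℝ E), r ≠ g) ∧
      LE.le (α := Submodule ℝ E) (escapingStableSpace X U σ) (fwdDecay A g) ∧
      (u ∉ bwdDecay A g → ∃ r g₀, g₀ < g ∧
        (∀ s ∈ exponents (A : Module.End ℝ E), s ≤ r ∨ g < s) ∧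
        (∀ s ∈ exponents (A : Module.End ℝ E), s ∉ Icc g₀ g) ∧
        maximalInvariantSet X U ∩ strongStableManifold X σ r = {σ}) := by
  subst hA
  set A := fderiv ℝ (localRep X σ) (extChartAt 𝓘(ℝ, E) σ σ) with hA
  have hF := finite_exponents (A : Module.End ℝ E)
  set S : Set ℝ := {r | r ∈ exponents (A : Module.End ℝ E) ∧ r < 0 ∧
      maximalInvariantSet X U ∩ strongStableManifold X σ r = {σ}} with hS
  have hSF : S.Finite := hF.subset fun r hr => hr.1
  rcases S.eq_empty_or_nonempty with hne | hne
  -- With no escaping exponent, `g` is taken below all exponents; then every vector decays backward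
  -- at this rate and the last clause is void.
  · have hev : ∀ᶠ g in atBot, ∀ s ∈ exponents (A : Module.End ℝ E), g < s :=
      (eventually_all_finite hF).2 fun s _ => eventually_lt_atBot s
    obtain ⟨g, hg, hg0⟩ := (hev.and (eventually_lt_atBot (0 : ℝ))).exists
    refine ⟨g, hg0, fun r hr => (hg r hr).ne', ?_, fun hu => absurd ?_ hu⟩
    · refine iSup₂_le fun r hr => ?_
      have : r ∈ S := hr
      rw [hne] at this
      exact absurd this (notMem_empty r)
    · have h1 : u ∈ (⊤ : Submodule ℝ E) := Submodule.mem_top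
      rw [← iSup_exponentSpace (A : Module.End ℝ E)] at h1
      exact (iSup₂_le fun r hr => exponentSpace_le_bwdDecay A (hg r hr) :
        ⨆ r ∈ exponents (A : Module.End ℝ E), exponentSpace (A : Module.End ℝ E) r ≤ _) h1
  -- With `r` the largest escaping exponent, `g` is taken just above `r`, before the next exponent
  -- and before `0`.
  · obtain ⟨r, hr, hmax⟩ := S.exists_max_image id hSF hne
    have hev : ∀ᶠ g in 𝓝[>] r, ∀ s ∈ exponents (A : Module.End ℝ E), s ≤ r ∨ g < s := by
      refine (eventually_all_finite hF).2 fun s _ => ?_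
      rcases le_or_gt s r with h | h
      · exact Eventually.of_forall fun g => Or.inl h
      · exact ((gt_mem_nhds h).filter_mono nhdsWithin_le_nhds).mono fun g hg => Or.inr hg
    have hev0 : ∀ᶠ g in 𝓝[>] r, g < 0 := (gt_mem_nhds hr.2.1).filter_mono nhdsWithin_le_nhds
    have hev1 : ∀ᶠ g in 𝓝[>] r, r < g := self_mem_nhdsWithin
    obtain ⟨g, hg, hg0, hrg⟩ := (hev.and (hev0.and hev1)).exists
    refine ⟨g, hg0, fun s hs => ?_, ?_, fun _ => ⟨r, (r + g) / 2, by linarith, hg, ?_, hr.2.2⟩⟩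
    · rcases hg s hs with h | h
      · exact (h.trans_lt hrg).ne
      · exact h.ne'
    · refine iSup₂_le fun r' hr' => iSup₂_le fun s hs => ?_
      have h1 : r' ≤ r := hmax r' hr'
      exact exponentSpace_le_fwdDecay A (by linarith)
    · rintro s hs ⟨h1, h2⟩
      rcases hg s hs with h | h <;> linarith

/-- The intersection of `E^c ⊕ E^uu` with `E^ss ⊕ E^c` is `E^c`: the outer components of `u` lie in
a forward and in a backward decay space of the same rate, hence vanish. -/
theorem mem_centralSpace_of_mem_decay (X : VField E M) (U : Set M) (σ : M) {A : E →L[ℝ] E}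
    (hA : A = fderiv ℝ (localRep X σ) (extChartAt 𝓘(ℝ, E) σ σ)) {g h : ℝ} (hgh : g < h)
    (hg : ∀ r ∈ exponents (A : Module.End ℝ E), r ≠ g)
    (hh : ∀ r ∈ exponents (A : Module.End ℝ E), r ≠ h)
    (hs : LE.le (α := Submodule ℝ E) (escapingStableSpace X U σ) (fwdDecay A g))
    (hu : LE.le (α := Submodule ℝ E) (escapingUnstableSpace X U σ) (bwdDecay A h)) {u : E}
    (h1 : u ∈ bwdDecay A g) (h2 : u ∈ fwdDecay A h) : u ∈ centralSpace X U σ := by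
  subst hA
  set A := fderiv ℝ (localRep X σ) (extChartAt 𝓘(ℝ, E) σ σ) with hA
  have hdg : Disjoint (fwdDecay A g) (bwdDecay A g) := disjoint_decay A le_rfl
    fun r hr hr' => hg r hr (by simpa using hr')
  have hdh : Disjoint (fwdDecay A h) (bwdDecay A h) := disjoint_decay A le_rfl
    fun r hr hr' => hh r hr (by simpa using hr')
  let V : Submodule ℝ E := centralSpace X U σ
  have hV : ∀ r ∈ exponents (A : Module.End ℝ E), g < r → r < h →
      exponentSpace (A : Module.End ℝ E) r ≤ V := by
    intro r hr hgr hrh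
    -- A trivial space is contained in the escaping spaces, so its exponent would not be counted as
    -- central; it is treated apart instead of proving that it does not occur.
    by_cases hbot : exponentSpace (A : Module.End ℝ E) r = ⊥
    · rw [hbot]
      exact bot_le
    · refine le_iSup₂_of_le (f := fun (r : ℝ) (_ : r ∈ {r : ℝ | r ∈ exponents (linearPart X σ) ∧
        ¬ exponentSpace (linearPart X σ) r ≤ escapingStableSpace X U σ ∧
        ¬ exponentSpace (linearPart X σ) r ≤ escapingUnstableSpace X U σ}) =>
          exponentSpace (linearPart X σ) r) r ⟨hr, fun hle => hbot ?_, fun hle => hbot ?_⟩ le_rfl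
      · have hle' : exponentSpace (A : Module.End ℝ E) r ≤ fwdDecay A g := le_trans hle hs
        exact le_bot_iff.1 (hdg hle' (exponentSpace_le_bwdDecay A hgr))
      · have hle' : exponentSpace (A : Module.End ℝ E) r ≤ bwdDecay A h := le_trans hle hu
        exact le_bot_iff.1 (hdh (exponentSpace_le_fwdDecay A hrh) hle')
  have hmem : u ∈ (⊤ : Submodule ℝ E) := Submodule.mem_top
  rw [← iSup_exponentSpace (A : Module.End ℝ E)] at hmem
  -- Each summand records its decay at both rates, so that the components can be removed one after
  -- the other.
  have hle : ⨆ r ∈ exponents (A : Module.End ℝ E), exponentSpace (A : Module.End ℝ E) r ≤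
      fwdDecay A g ⊓ fwdDecay A h ⊔ (V ⊓ bwdDecay A g ⊓ fwdDecay A h ⊔
        bwdDecay A g ⊓ bwdDecay A h) := by
    refine iSup₂_le fun r hr => ?_
    rcases lt_or_gt_of_ne (hg r hr) with hlt | hgt
    · exact le_sup_of_le_left (le_inf (exponentSpace_le_fwdDecay A hlt)
        (exponentSpace_le_fwdDecay A (hlt.trans hgh)))
    rcases lt_or_gt_of_ne (hh r hr) with hlt | hgt'
    · exact le_sup_of_le_right (le_sup_of_le_left (le_inf (le_inf (hV r hr hgt hlt)
        (exponentSpace_le_bwdDecay A hgt)) (exponentSpace_le_fwdDecay A hlt)))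
    · exact le_sup_of_le_right (le_sup_of_le_right (le_inf (exponentSpace_le_bwdDecay A hgt)
        (exponentSpace_le_bwdDecay A hgt')))
  obtain ⟨a, ha, y, hy, hay⟩ := Submodule.mem_sup.1 (hle hmem)
  obtain ⟨b, hb, d, hd, hbd⟩ := Submodule.mem_sup.1 hy
  have ha0 : a = 0 := by
    refine Submodule.disjoint_def.1 hdg a ha.1 ?_
    have : a = u - (b + d) := by rw [hbd, ← hay, add_sub_cancel_right]
    rw [this]
    exact sub_mem h1 (add_mem hb.1.2 hd.1)
  have hd0 : d = 0 := by
    refine Submodule.disjoint_def.1 hdh d ?_ hd.2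
    have : d = u - b := by rw [← hay, ← hbd, ha0]; abel
    rw [this]
    exact sub_mem h2 hb.2
  have : u = b := by rw [← hay, ← hbd, ha0, hd0]; abel
  rw [this]
  exact hb.1.1

theorem exists_form_of_stable_gap (X : VField E M) {U : Set M} (hU : IsClosed U) {σ : M}
    (hσ : IsHyperbolicSing X σ) {A : E →L[ℝ] E}
    (hA : A = fderiv ℝ (localRep X σ) (extChartAt 𝓘(ℝ, E) σ σ)) {u : E} {r g₀ g₁ : ℝ}
    (h01 : g₀ < g₁) (h1 : g₁ < 0)
    (hgap : ∀ s ∈ exponents (A : Module.End ℝ E), s ≤ r ∨ g₁ < s)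
    (hgap' : ∀ s ∈ exponents (A : Module.End ℝ E), s ∉ Icc g₀ g₁)
    (hesc : maximalInvariantSet X U ∩ strongStableManifold X σ r = {σ})
    (hu : u ∉ bwdDecay A g₁) :
    ∃ B : E →L[ℝ] E →L[ℝ] ℝ, B u u < 0 ∧ ∀ᶠ p : VField E M × M in 𝓝 (X, σ),
      (p.2 ∈ maximalInvariantSet p.1 U → p.1 p.2 ≠ 0 →
        0 < B (tangentCoordChange 𝓘(ℝ, E) p.2 σ p.2 (p.1 p.2))
          (tangentCoordChange 𝓘(ℝ, E) p.2 σ p.2 (p.1 p.2))) ∧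
      (p.2 ∈ U → p.1 p.2 = 0 → ∀ w ∈ centralSpace p.1 U p.2, w ≠ 0 →
        0 < B (tangentCoordChange 𝓘(ℝ, E) p.2 σ p.2 w)
          (tangentCoordChange 𝓘(ℝ, E) p.2 σ p.2 w)) := by
  subst hA
  have hyp : (0 : ℝ) ∉ exponents
      (fderiv ℝ (localRep X σ) (extChartAt 𝓘(ℝ, E) σ σ) : Module.End ℝ E) := hσ.2
  obtain ⟨B, hB, hBu, c, hc, hL₀, hL₁⟩ := exists_lyapunov_neg _ h01.le hgap' hu
  refine ⟨B, hBu, ?_⟩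
  have hsrc : ∀ᶠ p : VField E M × M in 𝓝 (X, σ), p.2 ∈ (extChartAt 𝓘(ℝ, E) σ).source :=
    continuousAt_snd.eventually (extChartAt_source_mem_nhds σ)
  filter_upwards [eventually_form_pos X hU hσ.1 hyp h01 h1 hgap hesc hB hc hL₀,
    eventually_form_pos_centralSpace X hU hσ.1 hyp h01 h1 hgap hesc hB hc hL₀ hL₁, hsrc]
    with p hp1 hp2 hps
  refine ⟨fun h h' => ?_, hp2⟩
  rw [← localRep_extChartAt p.1 hps]
  exact hp1 h h'

/-- A vector outside the central space is separated from it by a quadratic form that is positive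
on the vector field and on the central spaces, also for perturbed vector fields. -/
theorem exists_form_of_notMem_centralSpace (X : VField E M) {U : Set M} (hU : IsClosed U) {σ : M}
    (hσ : IsHyperbolicSing X σ) {u : E} (hu : u ∉ centralSpace X U σ) :
    ∃ B : E →L[ℝ] E →L[ℝ] ℝ, B u u < 0 ∧ ∀ᶠ p : VField E M × M in 𝓝 (X, σ),
      (p.2 ∈ maximalInvariantSet p.1 U → p.1 p.2 ≠ 0 →
        0 < B (tangentCoordChange 𝓘(ℝ, E) p.2 σ p.2 (p.1 p.2))
          (tangentCoordChange 𝓘(ℝ, E) p.2 σ p.2 (p.1 p.2))) ∧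
      (p.2 ∈ U → p.1 p.2 = 0 → ∀ w ∈ centralSpace p.1 U p.2, w ≠ 0 →
        0 < B (tangentCoordChange 𝓘(ℝ, E) p.2 σ p.2 w)
          (tangentCoordChange 𝓘(ℝ, E) p.2 σ p.2 w)) := by
  set A := fderiv ℝ (localRep X σ) (extChartAt 𝓘(ℝ, E) σ σ) with hA
  have hA' : -A = fderiv ℝ (localRep (-X) σ) (extChartAt 𝓘(ℝ, E) σ σ) :=
    (fderiv_localRep_neg X σ (mem_extChartAt_target σ)).symm
  obtain ⟨g, hg0, hg, hgs, hgu⟩ := exists_stable_gap X U σ hA u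
  obtain ⟨h, hh0, hh, hhs, hhu⟩ := exists_stable_gap (-X) U σ hA' u
  by_cases h1 : u ∈ bwdDecay A g
  · by_cases h2 : u ∈ bwdDecay (-A) h
    · refine absurd (mem_centralSpace_of_mem_decay X U σ hA (g := g) (h := -h) (by linarith) hg
        (fun r hr hrh => ?_) hgs ?_ h1 ?_) hu
      · refine hh (-r) (neg_mem_exponents_neg hr) ?_
        rw [hrh, neg_neg]
      · rw [escapingStableSpace_neg] at hhs
        rwa [bwdDecay, neg_neg]
      · rwa [bwdDecay, neg_neg] at h2
    · obtain ⟨r, g₀, hg01, hgap, hgap', hesc⟩ := hhu h2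
      have hσ' : IsHyperbolicSing (-X) σ := by
        refine ⟨?_, fun h0 => hσ.2 ?_⟩
        · change -(X σ) = 0
          rw [show X σ = 0 from hσ.1, neg_zero]
        · rw [linearPart_neg] at h0
          have := neg_mem_exponents_neg h0
          rwa [neg_neg, neg_zero] at this
      -- The form obtained for `-X` also serves for `X`: maximal invariant sets and central spaces
      -- are unchanged, and a quadratic form does not see the sign of the field.
      obtain ⟨B, hBu, hB⟩ := exists_form_of_stable_gap (-X) hU hσ' hA' hg01 hh0 hgap hgap' hesc h2
      refine ⟨B, hBu, ?_⟩
      have hcont : Tendsto (fun p : VField E M × M => (-p.1, p.2)) (𝓝 (X, σ)) (𝓝 (-X, σ)) :=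
        ((continuous_neg_vField.comp continuous_fst).prodMk continuous_snd).tendsto (X, σ)
      filter_upwards [hcont.eventually hB] with p hp
      simp only [maximalInvariantSet_neg, centralSpace_neg] at hp
      refine ⟨fun hpU hp0 => ?_, fun hpU hp0 => hp.2 hpU ?_⟩
      · have h3 := hp.1 hpU (fun h4 => hp0 (neg_eq_zero.1 h4))
        have h5 : tangentCoordChange 𝓘(ℝ, E) p.2 σ p.2 ((-p.1) p.2) =
            -tangentCoordChange 𝓘(ℝ, E) p.2 σ p.2 (p.1 p.2) := map_neg _ _
        rwa [h5, map_neg, map_neg, neg_apply, neg_neg] at h3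
      · change -(p.1 p.2) = 0
        rw [hp0, neg_zero]
  · obtain ⟨r, g₀, hg01, hgap, hgap', hesc⟩ := hgu h1
    exact exists_form_of_stable_gap X hU hσ hA hg01 hg0 hgap hgap' hesc h1

end Separation


/-! ### The topology of the projective tangent bundle -/

section ProjBundle

variable {E M : Type*} [NormedAddCommGroup E] [NormedSpace ℝ E]
  [TopologicalSpace M] [ChartedSpace E M] [IsManifold 𝓘(ℝ, E) ∞ M]

theorem form_smul_smul (B : E →L[ℝ] E →L[ℝ] ℝ) (a : ℝ) (u : E) :
    B (a • u) (a • u) = a ^ 2 * B u u := by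
  simp only [map_smul, smul_apply, smul_eq_mul]
  ring

/-- The lines over `N` on which the form `B`, read in the chart at `x₀`, is negative. -/
def negativeLines (B : E →L[ℝ] E →L[ℝ] ℝ) (x₀ : M) (N : Set M) : Set (ProjTangentBundle E M) :=
  {p | p.base ∈ N ∧ B (tangentCoordChange 𝓘(ℝ, E) p.base x₀ p.base p.line.rep)
    (tangentCoordChange 𝓘(ℝ, E) p.base x₀ p.base p.line.rep) < 0}

/-- A change of representative multiplies the form by a positive square, so its sign depends only on
the line. -/
theorem mk_mem_negativeLines {B : E →L[ℝ] E →L[ℝ] ℝ} {x₀ x : M} {N : Set M}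
    {v : TangentSpace 𝓘(ℝ, E) x} (hv : v ≠ 0) :
    (⟨x, Projectivization.mk ℝ v hv⟩ : ProjTangentBundle E M) ∈ negativeLines B x₀ N ↔
      x ∈ N ∧ B (tangentCoordChange 𝓘(ℝ, E) x x₀ x v) (tangentCoordChange 𝓘(ℝ, E) x x₀ x v) < 0 := by
  obtain ⟨a, ha⟩ := Projectivization.exists_smul_eq_mk_rep ℝ v hv
  have h1 : tangentCoordChange 𝓘(ℝ, E) x x₀ x (Projectivization.mk ℝ v hv).rep =
      (a : ℝ) • tangentCoordChange 𝓘(ℝ, E) x x₀ x v := by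
    rw [← ha]
    exact (tangentCoordChange 𝓘(ℝ, E) x x₀ x).map_smul (a : ℝ) v
  have ha0 : (a : ℝ) ≠ 0 := a.ne_zero
  have ha2 : 0 < (a : ℝ) ^ 2 := by positivity
  refine and_congr_right fun _ => ?_
  simp only
  rw [h1, form_smul_smul]
  exact smul_neg_iff_of_pos_left ha2

theorem isOpen_negativeLines (B : E →L[ℝ] E →L[ℝ] ℝ) {x₀ : M} {N : Set M} (hN : IsOpen N)
    (hNs : N ⊆ (extChartAt 𝓘(ℝ, E) x₀).source) : IsOpen (negativeLines B x₀ N) := by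
  let T := trivializationAt E (TangentSpace 𝓘(ℝ, E) : M → Type _) x₀
  refine isOpen_coinduced.2 ?_
  have h1 : IsOpen {v : TangentBundle 𝓘(ℝ, E) M | v.1 ∈ N ∧ B (T v).2 (T v).2 < 0} := by
    have hNo : IsOpen {v : TangentBundle 𝓘(ℝ, E) M | v.1 ∈ N} :=
      hN.preimage (FiberBundle.continuous_proj E (TangentSpace 𝓘(ℝ, E)))
    have hc : ContinuousOn (fun v : TangentBundle 𝓘(ℝ, E) M => B (T v).2 (T v).2)
        {v | v.1 ∈ N} := by
      have hT : ContinuousOn (fun v : TangentBundle 𝓘(ℝ, E) M => (T v).2) {v | v.1 ∈ N} := by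
        refine continuous_snd.comp_continuousOn (T.continuousOn.mono fun v hv => ?_)
        rw [T.mem_source]
        have h2 := hNs hv
        rwa [extChartAt_source] at h2
      exact (B.continuous.comp_continuousOn hT).clm_apply hT
    exact hc.isOpen_inter_preimage hNo isOpen_Iio
  have h2 : spanLine ⁻¹' negativeLines B x₀ N = Subtype.val ⁻¹'
      {v : TangentBundle 𝓘(ℝ, E) M | v.1 ∈ N ∧ B (T v).2 (T v).2 < 0} := by
    ext v
    exact mk_mem_negativeLines v.2
  rw [h2]
  exact h1.preimage continuous_subtype_val

/-- Every line over `K` is spanned by a vector whose image in the trivialization has norm one, so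
`K` times the unit sphere covers these lines. -/
theorem isCompact_lines_over [FiniteDimensional ℝ E] (x₀ : M) {K : Set M} (hK : IsCompact K)
    (hKs : K ⊆ (extChartAt 𝓘(ℝ, E) x₀).source) :
    ∃ S : Set (ProjTangentBundle E M), IsCompact S ∧ {p | p.base ∈ K} ⊆ S := by
  have : ProperSpace E := FiniteDimensional.proper_real E
  let T := trivializationAt E (TangentSpace 𝓘(ℝ, E) : M → Type _) x₀
  have hb : ∀ x ∈ K, x ∈ T.baseSet := fun x hx => by
    have h2 := hKs hx
    rwa [extChartAt_source] at h2
  have htgt : K ×ˢ Metric.sphere (0 : E) 1 ⊆ T.target := fun q hq => T.mem_target.2 (hb _ hq.1)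
  let S₀ : Set (TangentBundle 𝓘(ℝ, E) M) :=
    T.toOpenPartialHomeomorph.symm '' (K ×ˢ Metric.sphere (0 : E) 1)
  have hS₀ : IsCompact S₀ := (hK.prod (isCompact_sphere (0 : E) 1)).image_of_continuousOn
    (T.toOpenPartialHomeomorph.continuousOn_symm.mono htgt)
  have hne : ∀ v ∈ S₀, v.2 ≠ 0 := by
    rintro v ⟨q, hq, rfl⟩ h0
    have h1 : T (T.toOpenPartialHomeomorph.symm q) = q := T.apply_symm_apply (htgt hq)
    have h2 : (T (T.toOpenPartialHomeomorph.symm q)).2 = 0 := by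
      change tangentCoordChange 𝓘(ℝ, E) _ x₀ _ (T.toOpenPartialHomeomorph.symm q).2 = 0
      exact (congrArg _ h0).trans (map_zero _)
    have h3 : ‖q.2‖ = 1 := by simpa using hq.2
    rw [← h1, h2, norm_zero] at h3
    exact zero_ne_one h3
  let S₁ : Set {v : TangentBundle 𝓘(ℝ, E) M // v.2 ≠ 0} := {v | v.1 ∈ S₀}
  have hS₁ : IsCompact S₁ := by
    rw [Subtype.isCompact_iff]
    convert hS₀ using 1
    ext v
    exact ⟨fun ⟨w, hw, hwv⟩ => hwv ▸ hw, fun hv => ⟨⟨v, hne v hv⟩, hv, rfl⟩⟩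
  refine ⟨spanLine '' S₁, hS₁.image continuous_coinduced_rng, ?_⟩
  rintro ⟨x, L⟩ hx
  induction L using Projectivization.ind with | h v hv => ?_
  have hxK : x ∈ K := hx
  have hxs : x ∈ (extChartAt 𝓘(ℝ, E) x₀).source := hKs hxK
  set w : E := tangentCoordChange 𝓘(ℝ, E) x x₀ x v with hw
  have hw0 : w ≠ 0 := fun h => hv
    (tangentCoordChange_injective ⟨mem_extChartAt_source x, hxs⟩ (h.trans (map_zero _).symm))
  have hn : (‖w‖⁻¹ : ℝ) ≠ 0 := inv_ne_zero (norm_ne_zero_iff.2 hw0)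
  have hv' : (‖w‖⁻¹ • v : TangentSpace 𝓘(ℝ, E) x) ≠ 0 := smul_ne_zero hn hv
  refine ⟨⟨⟨x, ‖w‖⁻¹ • v⟩, hv'⟩, ⟨(x, ‖w‖⁻¹ • w), ⟨hxK, ?_⟩, ?_⟩, ?_⟩
  · rw [mem_sphere_zero_iff_norm, norm_smul, norm_inv, norm_norm,
      inv_mul_cancel₀ (norm_ne_zero_iff.2 hw0)]
  · have h1 : T ⟨x, ‖w‖⁻¹ • v⟩ = (x, ‖w‖⁻¹ • w) :=
      Prod.ext rfl ((tangentCoordChange 𝓘(ℝ, E) x x₀ x).map_smul ‖w‖⁻¹ v)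
    rw [← h1]
    exact T.toOpenPartialHomeomorph.left_inv (T.mem_source.2 (hb x hxK))
  · refine congrArg (ProjTangentBundle.mk x) ?_
    rw [Projectivization.mk_eq_mk_iff']
    exact ⟨‖w‖⁻¹, rfl⟩

instance [FiniteDimensional ℝ E] [CompactSpace M] [T2Space M] :
    CompactSpace (ProjTangentBundle E M) := by
  have : ProperSpace E := FiniteDimensional.proper_real E
  have h : ∃ S : Set (ProjTangentBundle E M), IsCompact S ∧ {p | p.base ∈ (univ : Set M)} ⊆ S := by
    refine isCompact_univ.induction_on (p := fun K : Set M => ∃ S : Set (ProjTangentBundle E M),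
      IsCompact S ∧ {p | p.base ∈ K} ⊆ S) ⟨∅, isCompact_empty, fun p hp => hp⟩ ?_ ?_ ?_
    · rintro s t hst ⟨S, hS, h⟩
      exact ⟨S, hS, fun p hp => h (hst hp)⟩
    · rintro s t ⟨S, hS, h⟩ ⟨S', hS', h'⟩
      exact ⟨S ∪ S', hS.union hS', fun p hp => hp.imp (fun q => h q) fun q => h' q⟩
    · intro x _
      obtain ⟨ρ, hρ, hρt⟩ := exists_chart_radius (E := E) x
      refine ⟨chartClosedBall E x ρ, mem_nhdsWithin_of_mem_nhds (mem_of_superset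
        ((isOpen_chartBall x ρ).mem_nhds (mem_chartBall_self x hρ))
        (chartBall_subset_closedBall x ρ)), ?_⟩
      exact isCompact_lines_over x (isCompact_setOf_chart_mem (isCompact_closedBall _ ρ) hρt)
        fun y hy => hy.1
  obtain ⟨S, hS, h⟩ := h
  exact ⟨hS.of_isClosed_subset isClosed_univ fun p _ => h (mem_univ p.base)⟩

end ProjBundle

/-! ### The extended maximal invariant set -/

section Extended

variable {E M : Type*} [NormedAddCommGroup E] [NormedSpace ℝ E] [FiniteDimensional ℝ E]
  [TopologicalSpace M] [ChartedSpace E M] [IsManifold 𝓘(ℝ, E) ∞ M] [CompactSpace M] [T2Space M]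

/-- The directions of the vector field along the maximal invariant set, and the lines of the
central spaces. -/
def extendedDirections (X : VField E M) (U : Set M) : Set (ProjTangentBundle E M) :=
  {p | ∃ (x : M) (hx : X x ≠ 0), x ∈ maximalInvariantSet X U ∧
    p = ⟨x, Projectivization.mk ℝ (X x) hx⟩} ∪ ⋃ σ ∈ sing X ∩ U, projCentralSpace X U σ

theorem extendedDirections_subset (X : VField E M) (U : Set M) :
    extendedDirections X U ⊆ extendedMaximalInvariantSet X U :=
  union_subset_union_left _ subset_closure

omit [FiniteDimensional ℝ E] in
theorem exists_form_neg {u : E} (hu : u ≠ 0) : ∃ B : E →L[ℝ] E →L[ℝ] ℝ, B u u < 0 := by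
  obtain ⟨m, hm⟩ := SeparatingDual.exists_ne_zero (R := ℝ) hu
  refine ⟨-m.smulRight m, ?_⟩
  have : (-m.smulRight m) u u = -(m u) ^ 2 := by
    simp only [neg_apply, ContinuousLinearMap.smulRight_apply, smul_apply, smul_eq_mul]
    ring
  rw [this, neg_lt_zero]
  positivity

/-- The form is `ε m² - ℓ²`, where `ℓ` vanishes at `y` and not at `u`, `m` does not vanish at `y`,
and `ε` is small enough for the sign at `u`. -/
theorem exists_form_of_notMem_span {y u : E} (hy : y ≠ 0) (hu : u ∉ Submodule.span ℝ {y}) :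
    ∃ B : E →L[ℝ] E →L[ℝ] ℝ, B u u < 0 ∧ 0 < B y y := by
  obtain ⟨ℓ, hℓu, hℓ⟩ := Submodule.exists_le_ker_of_notMem hu
  obtain ⟨m, hm⟩ := SeparatingDual.exists_ne_zero (R := ℝ) hy
  let ℓ' : E →L[ℝ] ℝ := LinearMap.toContinuousLinearMap ℓ
  have hℓy : ℓ' y = 0 := hℓ (Submodule.mem_span_singleton_self y)
  have hℓu' : 0 < (ℓ' u) ^ 2 := by
    have : ℓ' u ≠ 0 := hℓu
    positivity
  have hmy : 0 < (m y) ^ 2 := by positivity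
  set ε := (ℓ' u) ^ 2 / ((m u) ^ 2 + 1) with hε
  have hε0 : 0 < ε := by positivity
  have hεu : ε * (m u) ^ 2 < (ℓ' u) ^ 2 := by
    rw [hε, div_mul_eq_mul_div, div_lt_iff₀ (by positivity)]
    nlinarith
  refine ⟨ε • m.smulRight m - ℓ'.smulRight ℓ', ?_, ?_⟩
  · have : (ε • m.smulRight m - ℓ'.smulRight ℓ') u u = ε * (m u) ^ 2 - (ℓ' u) ^ 2 := by
      simp only [sub_apply, smul_apply, ContinuousLinearMap.smulRight_apply, smul_eq_mul]
      ring
    rw [this]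
    linarith
  · have : (ε • m.smulRight m - ℓ'.smulRight ℓ') y y = ε * (m y) ^ 2 - (ℓ' y) ^ 2 := by
      simp only [sub_apply, smul_apply, ContinuousLinearMap.smulRight_apply, smul_eq_mul]
      ring
    rw [this, hℓy]
    simpa using mul_pos hε0 hmy

/-- A line that is not an extended direction is separated from the extended directions by a
quadratic form, also for perturbed vector fields. -/
theorem exists_form_of_notMem_extendedDirections (X : VField E M) {U : Set M} (hU : IsClosed U)
    (hX : ∀ σ ∈ sing X, IsHyperbolicSing X σ) {x₀ : M} {u : TangentSpace 𝓘(ℝ, E) x₀} (hu : u ≠ 0)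
    (hp : (⟨x₀, Projectivization.mk ℝ u hu⟩ : ProjTangentBundle E M) ∉ extendedDirections X U) :
    ∃ B : E →L[ℝ] E →L[ℝ] ℝ, B u u < 0 ∧ ∀ᶠ p : VField E M × M in 𝓝 (X, x₀),
      (p.2 ∈ maximalInvariantSet p.1 U → p.1 p.2 ≠ 0 →
        0 < B (tangentCoordChange 𝓘(ℝ, E) p.2 x₀ p.2 (p.1 p.2))
          (tangentCoordChange 𝓘(ℝ, E) p.2 x₀ p.2 (p.1 p.2))) ∧
      (p.2 ∈ U → p.1 p.2 = 0 → ∀ w ∈ centralSpace p.1 U p.2, w ≠ 0 →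
        0 < B (tangentCoordChange 𝓘(ℝ, E) p.2 x₀ p.2 w)
          (tangentCoordChange 𝓘(ℝ, E) p.2 x₀ p.2 w)) := by
  by_cases hΛ : x₀ ∈ maximalInvariantSet X U
  · by_cases h0 : X x₀ = 0
    · have hxU : x₀ ∈ U := by
        have := mem_maximalInvariantSet.1 hΛ 0
        rwa [flow_zero] at this
      refine exists_form_of_notMem_centralSpace X hU (hX x₀ h0) fun hc => hp (Or.inr ?_)
      refine mem_iUnion₂.2 ⟨x₀, ⟨h0, hxU⟩, _, ?_, rfl⟩
      rw [Projectivization.submodule_mk, Submodule.span_singleton_le_iff_mem]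
      exact hc
    · have hspan : (u : E) ∉ Submodule.span ℝ {(X x₀ : E)} := by
        intro h
        obtain ⟨a, ha⟩ := Submodule.mem_span_singleton.1 h
        refine hp (Or.inl ⟨x₀, h0, hΛ, congrArg (ProjTangentBundle.mk x₀) ?_⟩)
        rw [Projectivization.mk_eq_mk_iff']
        exact ⟨a, ha⟩
      obtain ⟨B, hBu, hB⟩ := exists_form_of_notMem_span (E := E) h0 hspan
      refine ⟨B, hBu, ?_⟩
      have hx₀ : flow X 0 x₀ ∈ (extChartAt 𝓘(ℝ, E) x₀).source := by
        rw [flow_zero]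
        exact mem_extChartAt_source x₀
      have hc := continuousAt_localRep_flow X hx₀
      simp only [flow_zero] at hc
      have hcB : ContinuousAt (fun p : VField E M × M =>
          B (localRep p.1 x₀ (extChartAt 𝓘(ℝ, E) x₀ p.2))
            (localRep p.1 x₀ (extChartAt 𝓘(ℝ, E) x₀ p.2))) (X, x₀) :=
        (B.continuous.continuousAt.comp hc).clm_apply hc
      have hpos : 0 < B (localRep X x₀ (extChartAt 𝓘(ℝ, E) x₀ x₀))
          (localRep X x₀ (extChartAt 𝓘(ℝ, E) x₀ x₀)) := by
        rw [localRep_self]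
        exact hB
      have hsrc : ∀ᶠ p : VField E M × M in 𝓝 (X, x₀), p.2 ∈ (extChartAt 𝓘(ℝ, E) x₀).source :=
        continuousAt_snd.eventually (extChartAt_source_mem_nhds x₀)
      filter_upwards [hcB.eventually (lt_mem_nhds hpos), hsrc] with p hpB hps
      refine ⟨fun _ _ => by rwa [← localRep_extChartAt p.1 hps], fun _ hp0 => ?_⟩
      -- Positivity of the form on the field excludes singular points nearby, so the clause on
      -- central spaces is void.
      rw [(localRep_extChartAt_eq_zero_iff p.1 hps).2 hp0, map_zero] at hpB
      exact absurd hpB (lt_irrefl _)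
  · obtain ⟨B, hB⟩ := exists_form_neg (E := E) hu
    refine ⟨B, hB, ?_⟩
    rw [mem_maximalInvariantSet] at hΛ
    push Not at hΛ
    obtain ⟨t, ht⟩ := hΛ
    filter_upwards [(continuousAt_flow_fixed_time X t x₀).eventually
      (hU.isOpen_compl.mem_nhds ht)] with p hp
    exact ⟨fun h => absurd (mem_maximalInvariantSet.1 h t) hp, fun h h0 =>
      absurd (mem_maximalInvariantSet.1 (sing_mem_maximalInvariantSet h0 h) t) hp⟩

/-- A line that is not an extended direction has a neighbourhood that is avoided by the extended
maximal invariant sets of all nearby vector fields. -/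
theorem exists_avoiding_nhds (X : VField E M) {U : Set M} (hU : IsClosed U)
    (hX : ∀ σ ∈ sing X, IsHyperbolicSing X σ) {p : ProjTangentBundle E M}
    (hp : p ∉ extendedDirections X U) :
    ∃ O : Set (ProjTangentBundle E M), IsOpen O ∧ p ∈ O ∧
      ∀ᶠ Y in 𝓝 X, Disjoint O (extendedMaximalInvariantSet Y U) := by
  obtain ⟨x₀, L⟩ := p
  induction L using Projectivization.ind with | h u hu => ?_
  obtain ⟨B, hBu, hB⟩ := exists_form_of_notMem_extendedDirections X hU hX hu hp
  rw [nhds_prod_eq] at hB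
  obtain ⟨P, hP, Q, hQ, hPQ⟩ := eventually_prod_iff.1 hB
  obtain ⟨N, hN, hNo, hxN⟩ := eventually_nhds_iff.1
    (hQ.and (extChartAt_source_mem_nhds (I := 𝓘(ℝ, E)) x₀))
  have hO := isOpen_negativeLines B hNo fun y hy => (hN y hy).2
  refine ⟨negativeLines B x₀ N, hO, ?_, hP.mono fun Y hY => ?_⟩
  · rw [mk_mem_negativeLines]
    refine ⟨hxN, ?_⟩
    have h : tangentCoordChange 𝓘(ℝ, E) x₀ x₀ x₀ u = u :=
      tangentCoordChange_self (mem_extChartAt_source x₀)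
    exact (congrArg (fun w : E => B w w) h).trans_lt hBu
  · refine Disjoint.union_right ?_ ?_
    -- The neighbourhood is open, so avoiding the directions of `Y` it also avoids their closure.
    · refine Disjoint.closure_right (disjoint_left.2 ?_) hO
      rintro _ hq ⟨x, hx, hxΛ, rfl⟩
      obtain ⟨hxN', hlt⟩ := (mk_mem_negativeLines hx).1 hq
      exact lt_asymm hlt ((hPQ hY (hN x hxN').1).1 hxΛ hx)
    · refine disjoint_left.2 fun q hq hq' => ?_
      obtain ⟨σ, ⟨hσ, hσU⟩, L, hL, rfl⟩ := mem_iUnion₂.1 hq'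
      refine lt_asymm hq.2 ((hPQ hY (hN σ hq.1).1).2 hσU hσ L.rep (hL ?_) L.rep_nonzero)
      rw [Projectivization.submodule_eq]
      exact Submodule.mem_span_singleton_self _

/-! ### Closedness and semicontinuity from the separation -/

/-- This is the separation with `Y = X`: the closure adds only central lines, that is, limits of the
field directions at singular points are central. -/
theorem extendedMaximalInvariantSet_eq (X : VField E M) {U : Set M} (hU : IsClosed U)
    (hX : ∀ σ ∈ sing X, IsHyperbolicSing X σ) :
    extendedMaximalInvariantSet X U = extendedDirections X U := by
  refine Subset.antisymm (fun p hp => ?_) (extendedDirections_subset X U)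
  by_contra hcon
  obtain ⟨O, -, hpO, hO⟩ := exists_avoiding_nhds X hU hX hcon
  exact disjoint_left.1 hO.self_of_nhds hpO hp

theorem isCompact_extendedMaximalInvariantSet (X : VField E M) {U : Set M} (hU : IsClosed U)
    (hX : ∀ σ ∈ sing X, IsHyperbolicSing X σ) : IsCompact (extendedMaximalInvariantSet X U) := by
  refine IsClosed.isCompact (isOpen_compl_iff.1 (isOpen_iff_mem_nhds.2 fun p hp => ?_))
  obtain ⟨O, hOo, hpO, hO⟩ := exists_avoiding_nhds X hU hX
    fun h => hp (extendedDirections_subset X U h)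
  exact mem_of_superset (hOo.mem_nhds hpO) fun q hq => disjoint_left.1 hO.self_of_nhds hq

theorem upperHemicontinuousAt_extendedMaximalInvariantSet (X : VField E M) {U : Set M}
    (hU : IsClosed U) (hX : ∀ σ ∈ sing X, IsHyperbolicSing X σ) :
    UpperHemicontinuousAt (fun Y : VField E M => extendedMaximalInvariantSet Y U) X := by
  rw [upperHemicontinuousAt_iff]
  intro t ht
  obtain ⟨W, hWo, hXW, hWt⟩ := mem_nhdsSet_iff_exists.1 ht
  have hev : ∀ᶠ Y in 𝓝 X, Disjoint Wᶜ (extendedMaximalInvariantSet Y U) := by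
    -- The complement of `W` is compact, so finitely many avoiding neighbourhoods cover it and their
    -- conditions on `Y` can be intersected.
    refine hWo.isClosed_compl.isCompact.induction_on (p := fun S => ∀ᶠ Y in 𝓝 X,
      Disjoint S (extendedMaximalInvariantSet Y U)) (by simp) ?_ ?_ ?_
    · exact fun s t hst h => h.mono fun Y hY => hY.mono_left hst
    · intro s t hs ht
      filter_upwards [hs, ht] with Y h1 h2 using h1.union_left h2
    · intro p hp
      obtain ⟨O, hOo, hpO, hO⟩ := exists_avoiding_nhds X hU hX
        fun h => hp (hXW (extendedDirections_subset X U h))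
      exact ⟨O, mem_nhdsWithin_of_mem_nhds (hOo.mem_nhds hpO), hO⟩
  filter_upwards [hev] with Y hY
  exact mem_nhdsSet_iff_exists.2 ⟨W, hWo, fun p hp => by_contra fun h => disjoint_left.1 hY h hp, hWt⟩

/-! ### Invariance -/

theorem mem_centralSpace_of_linearPart (X : VField E M) (U : Set M) (σ : M) {v : E}
    (hv : v ∈ centralSpace X U σ) : linearPart X σ v ∈ centralSpace X U σ := by
  have h1 : ∀ r, exponentSpace (linearPart X σ) r ≤
      (exponentSpace (linearPart X σ) r).comap (linearPart X σ) := by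
    intro r
    refine iSup_le fun b v hv => ?_
    refine Submodule.mem_iSup_of_mem b ?_
    have hcomm : Commute ((linearPart X σ - algebraMap ℝ (Module.End ℝ _) r) ^ 2)
        (linearPart X σ) :=
      ((Commute.refl _).sub_left (Algebra.commute_algebraMap_left r _)).pow_left 2
    exact Module.End.mapsTo_maxGenEigenspace_of_comm hcomm _ hv
  have h2 : centralSpace X U σ ≤ (centralSpace X U σ).comap (linearPart X σ) :=
    iSup₂_le fun r hr => (h1 r).trans (Submodule.comap_mono (le_iSup₂_of_le r hr le_rfl))
  exact h2 hv

theorem projFlow_mk (X : VField E M) (t : ℝ) (x : M) {v : TangentSpace 𝓘(ℝ, E) x} (hv : v ≠ 0) :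
    projFlow X t ⟨x, Projectivization.mk ℝ v hv⟩ = ⟨flow X t x,
      Projectivization.mk ℝ (mfderiv 𝓘(ℝ, E) 𝓘(ℝ, E) (flow X t) x v)
        (fun h => hv ((bijective_mfderiv_flow X t x).1 (h.trans (map_zero _).symm)))⟩ := by
  rw [projFlow, dif_pos (bijective_mfderiv_flow X t x).1]
  rfl

omit [FiniteDimensional ℝ E] [IsManifold 𝓘(ℝ, E) ∞ M] [CompactSpace M] [T2Space M] in
theorem projTangentBundle_mk_congr {x y : M} (h : x = y) {v : TangentSpace 𝓘(ℝ, E) x}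
    {w : TangentSpace 𝓘(ℝ, E) y} (hv : v ≠ 0) (hw : w ≠ 0) (hvw : (v : E) = (w : E)) :
    (⟨x, Projectivization.mk ℝ v hv⟩ : ProjTangentBundle E M) =
      ⟨y, Projectivization.mk ℝ w hw⟩ := by
  subst h
  have h : v = w := hvw
  subst h
  rfl

theorem projFlow_projFlow_neg (X : VField E M) (t : ℝ) (p : ProjTangentBundle E M) :
    projFlow X t (projFlow X (-t) p) = p := by
  obtain ⟨x, L⟩ := p
  induction L using Projectivization.ind with | h v hv => ?_
  rw [projFlow_mk, projFlow_mk]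
  refine projTangentBundle_mk_congr (flow_flow_neg X t x) _ _ ?_
  refine (mfderiv_flow_add_apply X t (-t) x v).symm.trans ?_
  rw [add_neg_cancel]
  exact mfderiv_flow_zero_apply X x v

theorem projFlow_mem_extendedDirections (X : VField E M) (U : Set M) (t : ℝ)
    {p : ProjTangentBundle E M} (hp : p ∈ extendedDirections X U) :
    projFlow X t p ∈ extendedDirections X U := by
  rcases hp with ⟨x, hx, hxΛ, rfl⟩ | hp
  · refine Or.inl ⟨flow X t x, flow_ne_zero X hx t, flow_mem_maximalInvariantSet hxΛ t, ?_⟩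
    rw [projFlow_mk]
    exact projTangentBundle_mk_congr rfl _ _ (mfderiv_flow_apply_self X t x)
  · obtain ⟨σ, hσ, L, hL, rfl⟩ := mem_iUnion₂.1 hp
    refine Or.inr (mem_iUnion₂.2 ⟨σ, hσ, ?_⟩)
    induction L using Projectivization.ind with | h v hv => ?_
    rw [Projectivization.submodule_mk, Submodule.span_singleton_le_iff_mem] at hL
    set w : TangentSpace 𝓘(ℝ, E) σ := (mfderiv 𝓘(ℝ, E) 𝓘(ℝ, E) (flow X t) σ : E →L[ℝ] E) v
      with hw
    have hw0 : w ≠ 0 := fun h => hv ((bijective_mfderiv_flow X t σ).1 (h.trans (map_zero _).symm))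
    refine ⟨Projectivization.mk ℝ w hw0, ?_, ?_⟩
    · rw [Projectivization.submodule_mk, Submodule.span_singleton_le_iff_mem, hw,
        mfderiv_flow_sing X hσ.1]
      exact linearFlow_mem_of_invariant (E := E) _ (p := centralSpace X U σ)
        (fun v hv => mem_centralSpace_of_linearPart X U σ hv) t hL
    · rw [projFlow_mk]
      exact projTangentBundle_mk_congr (flow_of_eq_zero X hσ.1 t) _ _ rfl

theorem projFlow_image_extendedDirections (X : VField E M) (U : Set M) (t : ℝ) :
    projFlow X t '' extendedDirections X U = extendedDirections X U := by
  refine Subset.antisymm ?_ fun p hp => ?_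
  · rintro _ ⟨p, hp, rfl⟩
    exact projFlow_mem_extendedDirections X U t hp
  · exact ⟨projFlow X (-t) p, projFlow_mem_extendedDirections X U (-t) hp,
      projFlow_projFlow_neg X t p⟩

end Extended

end ExtendedMaximal

end

theorem propositionp {E M : Type*} [NormedAddCommGroup E] [NormedSpace ℝ E]
    [FiniteDimensional ℝ E] [TopologicalSpace M] [ChartedSpace E M] [IsManifold 𝓘(ℝ, E) ∞ M]
    [CompactSpace M] [T2Space M]
    (U : Set M) (hU : IsCompact U) (X : VField E M)
    (hX : ∀ σ ∈ sing X, IsHyperbolicSing X σ) :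
    IsCompact (extendedMaximalInvariantSet X U) ∧
    (∀ t : ℝ, MDifferentiable 𝓘(ℝ, E) 𝓘(ℝ, E) (flow X t) ∧
      (∀ x : M, Function.Bijective (mfderiv 𝓘(ℝ, E) 𝓘(ℝ, E) (flow X t) x)) ∧
      projFlow X t '' extendedMaximalInvariantSet X U = extendedMaximalInvariantSet X U) ∧
    UpperHemicontinuousAt (fun Y : VField E M => extendedMaximalInvariantSet Y U) X := by
  have hU' : IsClosed U := hU.isClosed
  refine ⟨isCompact_extendedMaximalInvariantSet X hU' hX,
    fun t => ⟨mdifferentiable_flow X t, bijective_mfderiv_flow X t, ?_⟩,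
    upperHemicontinuousAt_extendedMaximalInvariantSet X hU' hX⟩
  -- Without the closure invariance is a pointwise check, and continuity of `projFlow` is not
  -- needed.
  rw [extendedMaximalInvariantSet_eq X hU' hX]
  exact projFlow_image_extendedDirections X U t
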